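/- Let $L$ be a nondegenerate even lattice (a free $\mathbb Z$-module of finite rank with a nondegenerate symmetric $\mathbb Z$-valued bilinear form such that $x^2=(x,x)$ is always even), with dual lattice $L^*\subset L\otimes\mathbb Q$, discriminant group $A=L^*/L$, and $\mathrm{sgn}(L)=b^+-b^-$. Assume $L$ is elementary, i.e. $A$ is a direct sum of elementary abelian $p$-groups. Let $N$ be the level of $L$, the least positive integer with $N\gamma^2/2\in\mathbb Z$ for all $\gamma\in L^*$. Write $\mathbf e(x)=e^{2\pi i x}$; let $(\mathfrak e_\gamma)_{\gamma\in A}$ be the standard basis of $\mathbb C[A]$, and let $\mathrm{Aut}(A)$ be the group of automorphisms of $A$ preserving $\gamma\mapsto\gamma^2/2 \bmod 1$. Let $\mathrm{Mp}_2(\mathbb Z)$ be the group of pairs $g=\left(\begin{pmatrix}a&b\\c&d\end{pmatrix},\phi\right)$ with matrix in $\mathrm{SL}_2(\mathbb Z)$ and $\phi(\tau)=\pm\sqrt{c\tau+d}$ (principal square root), with product $(A,\phi)(B,\psi)=(AB,\phi(B\tau)\psi(\tau))$, let $\tilde\Gamma_0(N)$ be the inverse image of $\Gamma_0(N)$, and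 let $\rho_L$ be the Weil representation on $\mathbb C[A]$: for $T=\left(\begin{pmatrix}1&1\\0&1\end{pmatrix},1\right)$ and $S=\left(\begin{pmatrix}0&-1\\1&0\end{pmatrix},\sqrt\tau\right)$, $$\rho_L(T)\mathfrak e_\gamma=\mathbf e(\gamma^2/2)\,\mathfrak e_\gamma,\qquad \rho_L(S)\mathfrak e_\gamma=\frac{\mathbf e(-\mathrm{sgn}(L)/8)}{\sqrt{|A|}}\sum_{\delta\in A}\mathbf e(-(\gamma,\delta))\,\mathfrak e_\delta .$$ With the Kronecker symbol $(\tfrac{\cdot}{\cdot})$ put $\chi_n(g)=(\tfrac dn)$; for $d$ odd let $\chi_\vartheta(g)=\pm(\tfrac cd)$ if $d\equiv1\ (4)$ and $\mp i(\tfrac cd)$ if $d\equiv 3\ (4)$, where $\phi=\pm\sqrt{c\tau+d}$; and let $$\chi_A=\begin{cases}\chi_\vartheta^{\,\mathrm{sgn}(L)+\left(\frac{-1}{|A|}\right)-1}\,\chi_{|A|}\,\chi_2^{\,\mathrm{sgn}(L)}&\text{if }4\mid N,\\ \chi_{|A|}&\text{if }4\nmid N.\end{cases}$$ For $k\in\frac12\mathbb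 Z$ and $f:\mathbb H\to\mathbb C$ put $f|_g(\tau)=\phi(\tau)^{-2k}f(g\tau)$. Let $F=\sum_{\gamma\in A} F_\gamma\mathfrak e_\gamma:\mathbb H\to\mathbb C[A]$ be a (nearly holomorphic) modular form of weight $k$ and type $\rho_L$, i.e. $F$ is holomorphic on $\mathbb H$, $F(g\tau)=\phi(\tau)^{2k}\rho_L(g)F(\tau)$ for all $g\in\mathrm{Mp}_2(\mathbb Z)$, and $F$ has at most a pole at $i\infty$. Assume that $F$ is $\mathrm{Aut}(A)$-invariant: $F_{\sigma\gamma}=F_\gamma$ for all $\sigma\in\mathrm{Aut}(A)$ and $\gamma\in A$. Then there are $c_\gamma\in\mathbb C$ $(\gamma\in A)$, with $c_\gamma=0$ unless $\gamma^2/2\equiv0 \bmod 1$, such that $f=\sum_\gamma c_\gamma F_\gamma$ is a scalar-valued modular form of weight $k$ on $\tilde\Gamma_0(N)$ with character $\chi_A$ (holomorphic on $\mathbb H$, $f|_g=\chi_A(g)f$ for $g\in\tilde\Gamma_0(N)$, at most poles at the cusps; holomorphic at all cusps if $F$ is holomorphic at $i\infty$), and $F$ is induced from $f$: $$F(\tau)=\sum_{g\in\tilde\Gamma_0(N)\backslash\mathrm{Mp}_2(\mathbb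 Z)} f|_g(\tau)\,\rho_L(g^{-1})\,\mathfrak e_0\qquad(\tau\in\mathbb H).$$ -/

import Mathlib

open scoped UpperHalfPlane Manifold MatrixGroups TensorProduct

noncomputable section

/-! ### The metaplectic group -/

/-- `Mp₂(ℤ)`: pairs of a matrix in `SL₂(ℤ)` with lower row `(c, d)` and a continuous choice
`±√(cτ + d)` of a square root of `cτ + d` on the upper half plane. -/
@[ext]
structure Mp2Z where
  mat : SL(2, ℤ)
  root : ℍ → ℂ
  continuous_root : Continuous root
  root_sq : ∀ τ : ℍ, root τ ^ 2 = (mat 1 0 : ℂ) * (τ : ℂ) + (mat 1 1 : ℂ)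

namespace Mp2Z

theorem den_ne_zero (A : SL(2, ℤ)) (τ : ℍ) : (A 1 0 : ℂ) * (τ : ℂ) + (A 1 1 : ℂ) ≠ 0 := by
  have h := UpperHalfPlane.denom_ne_zero (A : GL (Fin 2) ℝ) τ
  simpa [UpperHalfPlane.denom] using h

theorem den_mul (A B : SL(2, ℤ)) (τ : ℍ) :
    ((A * B) 1 0 : ℂ) * (τ : ℂ) + ((A * B) 1 1 : ℂ) =
      ((A 1 0 : ℂ) * ((B • τ : ℍ) : ℂ) + (A 1 1 : ℂ)) * ((B 1 0 : ℂ) * (τ : ℂ) + (B 1 1 : ℂ)) := by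
  have h := den_ne_zero B τ
  rw [UpperHalfPlane.coe_specialLinearGroup_apply]
  simp only [Matrix.SpecialLinearGroup.coe_mul, Matrix.mul_apply, Fin.sum_univ_two,
    algebraMap_int_eq, Int.coe_castRingHom, Complex.ofReal_intCast, Int.cast_add, Int.cast_mul]
  field_simp
  ring

theorem root_ne_zero (g : Mp2Z) (τ : ℍ) : g.root τ ≠ 0 := by
  intro h
  have := g.root_sq τ
  rw [h] at this
  exact den_ne_zero g.mat τ (by rw [← this]; simp)

theorem continuous_smul_mat (A : SL(2, ℤ)) : Continuous fun τ : ℍ => A • τ :=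
  continuous_const_smul (A : GL (Fin 2) ℝ)

/-- `(A, f(τ)) (B, g(τ)) = (AB, f(Bτ) g(τ))`. -/
instance : Mul Mp2Z where
  mul g h :=
    { mat := g.mat * h.mat
      root := fun τ => g.root (h.mat • τ) * h.root τ
      continuous_root :=
        (g.continuous_root.comp (continuous_smul_mat h.mat)).mul h.continuous_root
      root_sq := fun τ => by rw [mul_pow, g.root_sq, h.root_sq, den_mul] }

instance : One Mp2Z where
  one := { mat := 1, root := fun _ => 1, continuous_root := continuous_const
           root_sq := fun τ => by simp }

instance : Inv Mp2Z where
  inv g :=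
    { mat := g.mat⁻¹
      root := fun τ => (g.root (g.mat⁻¹ • τ))⁻¹
      continuous_root :=
        (g.continuous_root.comp (continuous_smul_mat g.mat⁻¹)).inv₀ fun _ => g.root_ne_zero _
      root_sq := fun τ => by
        rw [inv_pow, g.root_sq]
        have h := den_mul g.mat g.mat⁻¹ τ
        rw [mul_inv_cancel] at h
        refine inv_eq_of_mul_eq_one_right ?_
        rw [← h]
        simp }

@[simp] theorem mul_mat (g h : Mp2Z) : (g * h).mat = g.mat * h.mat := rfl
@[simp] theorem mul_root (g h : Mp2Z) (τ : ℍ) :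
    (g * h).root τ = g.root (h.mat • τ) * h.root τ := rfl
@[simp] theorem one_mat : (1 : Mp2Z).mat = 1 := rfl
@[simp] theorem one_root (τ : ℍ) : (1 : Mp2Z).root τ = 1 := rfl
@[simp] theorem inv_mat (g : Mp2Z) : (g⁻¹).mat = g.mat⁻¹ := rfl
@[simp] theorem inv_root (g : Mp2Z) (τ : ℍ) : (g⁻¹).root τ = (g.root (g.mat⁻¹ • τ))⁻¹ := rfl

instance : Group Mp2Z where
  mul_assoc a b c := by
    ext1
    · simp [mul_assoc]
    · funext τ; simp [mul_assoc, mul_smul]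
  one_mul a := by
    ext1
    · simp
    · funext τ; simp
  mul_one a := by
    ext1
    · simp
    · funext τ; simp
  inv_mul_cancel a := by
    ext1
    · simp
    · funext τ; simp [a.root_ne_zero]

/-- The projection `Mp₂(ℤ) → SL₂(ℤ)`. -/
def proj : Mp2Z →* SL(2, ℤ) where
  toFun := Mp2Z.mat
  map_one' := rfl
  map_mul' _ _ := rfl

/-- `T = ((1, 1; 0, 1), +1)`. -/
def T : Mp2Z where
  mat := ModularGroup.T
  root := fun _ => 1
  continuous_root := continuous_const
  root_sq := fun τ => by simp [ModularGroup.T]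

/-- `S = ((0, -1; 1, 0), +√τ)`, with the principal square root. -/
def S : Mp2Z where
  mat := ModularGroup.S
  root := fun τ => (τ : ℂ) ^ (1 / 2 : ℂ)
  continuous_root := by
    refine UpperHalfPlane.continuous_coe.cpow continuous_const fun τ => Or.inr ?_
    exact τ.im_ne_zero
  root_sq := fun τ => by
    rw [← Complex.cpow_nat_mul]
    simp [ModularGroup.S]

open Classical in
/-- The sign `±1` of `(A, ±√(cτ + d))`, relative to the principal branch of the square root. -/
def sign (g : Mp2Z) : ℂ :=
  if ∀ τ : ℍ, g.root τ = ((g.mat 1 0 : ℂ) * (τ : ℂ) + (g.mat 1 1 : ℂ)) ^ (1 / 2 : ℂ) then 1 else -1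

/-- `Γ̃₀(N)`, the inverse image of `Γ₀(N)` in `Mp₂(ℤ)`. -/
def Gamma0 (N : ℕ) : Subgroup Mp2Z := (CongruenceSubgroup.Gamma0 N).comap proj

end Mp2Z

/-! ### Kronecker symbol -/

/-- The Kronecker symbol `(a / n)`. -/
def kroneckerSymbol (a n : ℤ) : ℤ :=
  if n = 0 then (if a.natAbs = 1 then 1 else 0)
  else (if n < 0 ∧ a < 0 then -1 else 1) * ZMod.χ₈ (a : ZMod 8) ^ (n.natAbs.factorization 2) *
    jacobiSym a (n.natAbs / 2 ^ (n.natAbs.factorization 2))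

/-- The character `χ_n(g) = (d / n)`. -/
def chiNat (n : ℕ) (g : Mp2Z) : ℂ := (kroneckerSymbol (g.mat 1 1) n : ℂ)

/-- The theta character: `±(c / d)` if `d ≡ 1 mod 4` and `∓i (c / d)` if `d ≡ 3 mod 4`
(only used on `Γ̃₀(N)` with `4 ∣ N`, where `d` is odd). -/
def chiTheta (g : Mp2Z) : ℂ :=
  g.sign * (if g.mat 1 1 % 4 = 1 then 1 else -Complex.I) *
    (kroneckerSymbol (g.mat 1 0) (g.mat 1 1) : ℂ)

/-! ### Lattices and discriminant forms -/

/-- A nondegenerate even lattice structure on a free `ℤ`-module `L` of finite rank. -/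
structure EvenLattice (L : Type*) [AddCommGroup L] [Module.Free ℤ L] [Module.Finite ℤ L] where
  form : LinearMap.BilinForm ℤ L
  symm : form.IsSymm
  nondeg : form.Nondegenerate
  even : ∀ x, Even (form x x)

namespace EvenLattice

theorem exists_smul_eq {L : Type*} [AddCommGroup L] (x : ℚ ⊗[ℤ] L) :
    ∃ n : ℤ, n ≠ 0 ∧ ∃ y : L, n • x = 1 ⊗ₜ[ℤ] y := by
  induction x with
  | zero => exact ⟨1, one_ne_zero, 0, by simp⟩
  | tmul a y =>
    refine ⟨a.den, by exact_mod_cast a.den_nz, a.num • y, ?_⟩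
    rw [← TensorProduct.smul_tmul, TensorProduct.smul_tmul']
    congr 1
    simp [mul_comm]
  | add x y hx hy =>
    obtain ⟨n, hn, u, hu⟩ := hx
    obtain ⟨m, hm, v, hv⟩ := hy
    refine ⟨n * m, mul_ne_zero hn hm, m • u + n • v, ?_⟩
    rw [smul_add, mul_comm n m, mul_smul, hu, mul_comm m n, mul_smul, hv, TensorProduct.tmul_add,
      TensorProduct.tmul_smul, TensorProduct.tmul_smul]

variable {L : Type*} [AddCommGroup L] [Module.Free ℤ L] [Module.Finite ℤ L] (Λ : EvenLattice L)

/-- The `ℚ`-valued form on `L ⊗ ℚ`. -/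
def formQ : LinearMap.BilinForm ℚ (ℚ ⊗[ℤ] L) := LinearMap.BilinForm.baseChange ℚ Λ.form

/-- The real form `(x, x) / 2` on `L ⊗ ℝ`. -/
def quadR : QuadraticForm ℝ (ℝ ⊗[ℤ] L) :=
  (1 / 2 : ℝ) • (LinearMap.BilinForm.baseChange ℝ Λ.form).toQuadraticMap

/-- `sgn(L) = m - n` for `L` of signature `(m, n)`. -/
def sgn : ℤ := (sigPos Λ.quadR : ℤ) - (sigNeg Λ.quadR : ℤ)

variable (L) in
/-- The lattice `L` inside `L ⊗ ℚ`. -/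
def base : Submodule ℤ (ℚ ⊗[ℤ] L) := LinearMap.range (TensorProduct.mk ℤ ℚ L 1)

/-- The dual lattice `L* = {x ∈ L ⊗ ℚ : (x, y) ∈ ℤ for all y ∈ L}`. -/
def dual : Submodule ℤ (ℚ ⊗[ℤ] L) := Λ.formQ.dualSubmodule (base L)

/-- The discriminant group `L* / L`. -/
abbrev Disc : Type _ := Λ.dual ⧸ (base L).submoduleOf Λ.dual

theorem formQ_comm (x y : ℚ ⊗[ℤ] L) : Λ.formQ x y = Λ.formQ y x :=
  ((LinearMap.BilinForm.IsSymm.baseChange ℚ ⟨Λ.symm.eq⟩).eq x y : _)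

theorem formQ_tmul_one (x y : L) :
    Λ.formQ (1 ⊗ₜ[ℤ] x) (1 ⊗ₜ[ℤ] y) = (Λ.form x y : ℚ) := by
  simp [formQ, LinearMap.BilinForm.baseChange_tmul]

theorem formQ_eq_zero {x : ℚ ⊗[ℤ] L} (hx : ∀ z : L, Λ.formQ x (1 ⊗ₜ[ℤ] z) = 0) : x = 0 := by
  obtain ⟨n, hn, y, hy⟩ := exists_smul_eq x
  have hy0 : y = 0 := by
    refine Λ.nondeg.1 y fun z => ?_
    have h := hx z
    have h2 : Λ.formQ (n • x) (1 ⊗ₜ[ℤ] z) = 0 := by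
      rw [← Int.cast_smul_eq_zsmul ℚ n x]; simp [h]
    rw [hy, formQ_tmul_one] at h2
    exact_mod_cast h2
  rw [hy0, TensorProduct.tmul_zero] at hy
  rw [← Int.cast_smul_eq_zsmul ℚ n x] at hy
  exact (smul_eq_zero.mp hy).resolve_left (by exact_mod_cast hn)

theorem formQ_mem {x y : ℚ ⊗[ℤ] L} (hx : x ∈ Λ.dual) (hy : y ∈ base L) :
    ∃ n : ℤ, Λ.formQ x y = n := by
  have := (LinearMap.BilinForm.mem_dualSubmodule _).mp hx y hy
  obtain ⟨n, hn⟩ := Submodule.mem_one.mp this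
  exact ⟨n, by simpa using hn.symm⟩

theorem finite_dual : Module.Finite ℤ Λ.dual := by
  have hnd : Λ.formQ.Nondegenerate := by
    refine ⟨fun x h => Λ.formQ_eq_zero fun z => h _, fun x h => Λ.formQ_eq_zero fun z => ?_⟩
    rw [formQ_comm]; exact h _
  have hspan : Submodule.span ℚ (base L : Set (ℚ ⊗[ℤ] L)) = ⊤ := by
    rw [eq_top_iff]
    rintro x -
    obtain ⟨n, hn, y, hy⟩ := exists_smul_eq x
    have hn' : (n : ℚ) ≠ 0 := by exact_mod_cast hn
    have : x = (n : ℚ)⁻¹ • ((1 : ℚ) ⊗ₜ[ℤ] y) := by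
      rw [← hy, ← Int.cast_smul_eq_zsmul ℚ n x, smul_smul, inv_mul_cancel₀ hn', one_smul]
    rw [this]
    exact Submodule.smul_mem _ _ (Submodule.subset_span ⟨y, rfl⟩)
  have hb : Module.Finite ℤ (base L) := Module.Finite.range _
  have ht : Module.IsTorsionFree ℤ (ℚ ⊗[ℤ] L) := Module.IsTorsionFree.trans ℚ
  have hb' : Module.Free ℤ (base L) := inferInstance
  exact Module.Finite.of_injective _
    (Λ.formQ.dualSubmoduleToDual_injective hnd (base L) hspan)

instance : Finite Λ.Disc := by
  have := Λ.finite_dual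
  refine Module.finite_of_fg_torsion Λ.Disc ?_
  intro γ
  obtain ⟨x, rfl⟩ := Submodule.Quotient.mk_surjective _ γ
  obtain ⟨n, hn, y, hy⟩ := exists_smul_eq (x : ℚ ⊗[ℤ] L)
  refine ⟨⟨n, mem_nonZeroDivisors_of_ne_zero hn⟩, ?_⟩
  change n • (Submodule.Quotient.mk x : Λ.Disc) = 0
  rw [← Submodule.Quotient.mk_smul, Submodule.Quotient.mk_eq_zero]
  exact ⟨y, hy.symm⟩

instance : Fintype Λ.Disc := Fintype.ofFinite _

/-- The discriminant quadratic form `γ ↦ γ² / 2 mod 1`, with `ℚ / ℤ` embedded in `ℝ / ℤ`. -/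
def q : Λ.Disc → UnitAddCircle :=
  Quotient.lift (fun x : Λ.dual => (((Λ.formQ x x / 2 : ℚ) : ℝ) : UnitAddCircle)) <| by
    intro x y hxy
    have h : (x : ℚ ⊗[ℤ] L) - y ∈ base L := by
      have := (Submodule.quotientRel_def _).mp hxy
      simpa [Submodule.submoduleOf] using this
    obtain ⟨z, hz⟩ := h
    obtain ⟨n, hn⟩ := Λ.formQ_mem y.2 ⟨z, rfl⟩
    obtain ⟨m, hm⟩ := Λ.even z
    have hx : (x : ℚ ⊗[ℤ] L) = (y : ℚ ⊗[ℤ] L) + (1 : ℚ) ⊗ₜ[ℤ] z := by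
      rw [← sub_eq_iff_eq_add']; exact hz.symm
    have key : Λ.formQ x x / 2 = Λ.formQ y y / 2 + ((m + n : ℤ) : ℚ) := by
      have h1 := Λ.formQ_tmul_one z z
      have h2 := Λ.formQ_comm (1 ⊗ₜ[ℤ] z) y
      replace hn : Λ.formQ y ((1 : ℚ) ⊗ₜ[ℤ] z) = n := hn
      rw [hx]
      simp only [map_add, LinearMap.add_apply]
      rw [h1, h2, hn, hm]
      push_cast
      ring
    change (((Λ.formQ x x / 2 : ℚ) : ℝ) : UnitAddCircle) = (((Λ.formQ y y / 2 : ℚ) : ℝ) : _)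
    rw [key, Rat.cast_add, AddCircle.coe_add, Rat.cast_intCast]
    rw [add_eq_left]
    exact (AddCircle.coe_eq_zero_iff 1).mpr ⟨m + n, by simp⟩

/-- The discriminant bilinear form `(γ, δ) mod 1`, with `ℚ / ℤ` embedded in `ℝ / ℤ`. -/
def b : Λ.Disc → Λ.Disc → UnitAddCircle :=
  Quotient.lift₂ (fun x y : Λ.dual => (((Λ.formQ x y : ℚ) : ℝ) : UnitAddCircle)) <| by
    intro x y x' y' hx hy
    have h1 : (x : ℚ ⊗[ℤ] L) - x' ∈ base L := by
      have := (Submodule.quotientRel_def _).mp hx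
      simpa [Submodule.submoduleOf] using this
    have h2 : (y : ℚ ⊗[ℤ] L) - y' ∈ base L := by
      have := (Submodule.quotientRel_def _).mp hy
      simpa [Submodule.submoduleOf] using this
    obtain ⟨n, hn⟩ := Λ.formQ_mem y.2 h1
    obtain ⟨m, hm⟩ := Λ.formQ_mem x'.2 h2
    have key : Λ.formQ x y = Λ.formQ x' y' + ((n + m : ℤ) : ℚ) := by
      rw [Λ.formQ_comm] at hn
      simp only [map_sub, LinearMap.sub_apply] at hn hm
      push_cast
      linarith
    change (((Λ.formQ x y : ℚ) : ℝ) : UnitAddCircle) = (((Λ.formQ x' y' : ℚ) : ℝ) : _)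
    rw [key, Rat.cast_add, AddCircle.coe_add, Rat.cast_intCast]
    rw [add_eq_left]
    exact (AddCircle.coe_eq_zero_iff 1).mpr ⟨n + m, by simp⟩

/-- `L` is elementary: `L* / L` is a direct sum of elementary abelian `p`-groups, that is, it is
annihilated by a squarefree integer. -/
def IsElementary : Prop := ∃ m : ℕ, Squarefree m ∧ ∀ γ : Λ.Disc, m • γ = 0

/-- The level: the least positive integer `N` with `N γ² / 2 ∈ ℤ` for all `γ ∈ L*`. -/
def level : ℕ :=
  sInf {N : ℕ | 0 < N ∧ ∀ x ∈ Λ.dual, ∃ m : ℤ, (N : ℚ) * (Λ.formQ x x / 2) = m}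

/-- `Aut(L* / L)`: group automorphisms preserving the discriminant quadratic form. -/
def discAut : Set (Λ.Disc ≃+ Λ.Disc) := {σ | ∀ γ, Λ.q (σ γ) = Λ.q γ}

/-- `𝐞(x) = exp(2πi x)` for `x ∈ ℝ / ℤ`. -/
def e (x : UnitAddCircle) : ℂ := (AddCircle.toCircle x : ℂ)

open Classical in
/-- The basis vector `𝔢_γ` of `ℂ[L* / L]`. -/
def basisVec (γ : Λ.Disc) : Λ.Disc → ℂ := Pi.single γ 1

/-- The defining values of the Weil representation on the generators `T`, `S` of `Mp₂(ℤ)`. -/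
def IsWeilRep (ρ : Representation ℂ Mp2Z (Λ.Disc → ℂ)) : Prop :=
  (∀ γ, ρ Mp2Z.T (Λ.basisVec γ) = e (Λ.q γ) • Λ.basisVec γ) ∧
  (∀ γ, ρ Mp2Z.S (Λ.basisVec γ) =
    (Complex.exp (-(2 * Real.pi * Complex.I * (Λ.sgn : ℂ) / 8)) /
      ((Real.sqrt (Nat.card Λ.Disc) : ℝ) : ℂ)) • ∑ δ, e (-(Λ.b γ δ)) • Λ.basisVec δ)

open Classical in
/-- The Weil representation `ρ_L` of `Mp₂(ℤ)` on `ℂ[L* / L]`: the representation with the prescribed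
values on the generators `S` and `T`. It exists for every nondegenerate even lattice, and it is
unique because `S` and `T` generate `Mp₂(ℤ)`; the `else` branch never occurs. -/
def weilRep : Representation ℂ Mp2Z (Λ.Disc → ℂ) :=
  if h : ∃ ρ, Λ.IsWeilRep ρ then h.choose else 1

/-- The character `χ_{L* / L}` of `Γ̃₀(N)`. The factor `χ_{|A| 2^sgn}` is written as
`(d / |A|) (d / 2) ^ sgn`, which makes sense for negative `sgn` as well. -/
def chi (g : Mp2Z) : ℂ :=
  if 4 ∣ Λ.level then
    chiTheta g ^ (Λ.sgn + kroneckerSymbol (-1) (Nat.card Λ.Disc) - 1) *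
      (chiNat (Nat.card Λ.Disc) g * chiNat 2 g ^ Λ.sgn)
  else chiNat (Nat.card Λ.Disc) g

end EvenLattice

/-! ### Modular forms -/

/-- `f` has a pole of order at most `n` in `q = exp(2πiτ)` at `i∞`: `q ^ n f` is bounded there. -/
def PoleAtMost (n : ℕ) (f : ℍ → ℂ) : Prop :=
  UpperHalfPlane.IsBoundedAtImInfty
    fun τ : ℍ => Complex.exp (2 * Real.pi * Complex.I * (τ : ℂ)) ^ n * f τ

/-- The slash operator of weight `κ / 2`: `(f|_g)(τ) = (±√(cτ + d)) ^ (-κ) f(gτ)`. -/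
def slashHalf (κ : ℤ) (f : ℍ → ℂ) (g : Mp2Z) (τ : ℍ) : ℂ := g.root τ ^ (-κ) * f (g.mat • τ)

/-- Scalar-valued (nearly holomorphic) modular forms of weight `κ / 2` on `Γ̃₀(N)` with character
`χ`: holomorphic on the upper half plane, with poles allowed at the cusps. -/
structure IsScalarForm (N : ℕ) (κ : ℤ) (χ : Mp2Z → ℂ) (f : ℍ → ℂ) : Prop where
  holo : MDifferentiable 𝓘(ℂ) 𝓘(ℂ) f
  slash_eq : ∀ g ∈ Mp2Z.Gamma0 N, ∀ τ, slashHalf κ f g τ = χ g * f τ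
  pole : ∀ g : Mp2Z, ∃ n, PoleAtMost n (slashHalf κ f g)

namespace EvenLattice

variable {L : Type*} [AddCommGroup L] [Module.Free ℤ L] [Module.Finite ℤ L] (Λ : EvenLattice L)

/-- Vector-valued (nearly holomorphic) modular forms of weight `κ / 2` and type `ρ_L`: holomorphic
on the upper half plane, with poles allowed at `i∞`. -/
structure IsVectorForm (κ : ℤ) (F : ℍ → Λ.Disc → ℂ) : Prop where
  holo : ∀ γ, MDifferentiable 𝓘(ℂ) 𝓘(ℂ) fun τ => F τ γ
  transform : ∀ (g : Mp2Z) (τ : ℍ), F (g.mat • τ) = g.root τ ^ κ • Λ.weilRep g (F τ)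
  pole : ∀ γ, ∃ n, PoleAtMost n fun τ => F τ γ

/-- The vector-valued function induced from `f`, namely
`∑ f|_g(τ) ρ_L(g⁻¹) 𝔢_0` over representatives `g` of `Γ̃₀(N) \ Mp₂(ℤ)`, `N` the level of `L`. -/
def induced (κ : ℤ) (f : ℍ → ℂ) (τ : ℍ) : Λ.Disc → ℂ :=
  ∑ᶠ x : Quotient (QuotientGroup.rightRel (Mp2Z.Gamma0 Λ.level)),
    slashHalf κ f x.out τ • Λ.weilRep (x.out⁻¹) (Λ.basisVec 0)

end EvenLattice

end

noncomputable section

/-! ### Generation of the metaplectic group and signs of square roots -/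

namespace Mp2Z

open Filter Topology

/-! Write `ρ` for the Weil representation and `W` for the `Aut(A)`-invariant vectors. The functional
`w ↦ w 0` is an eigenvector of `Γ̃₀(N)` with character `χ_A` (`rowScalar_chi`). As `ρ` is unitary,
the operator `P w = ∑ (ρ(g) w)_0 ρ(g⁻¹) 𝔢₀`, summed over `Γ̃₀(N) \ Mp₂(ℤ)`, is well defined. It
commutes with `ρ`, preserves `W`, and satisfies `⟨v, P w⟩ = ∑ conj((ρ(g) v)_0) (ρ(g) w)_0`, so it is
self-adjoint and positive. If it is injective on `W`, it is bijective there, and there is `u ∈ W`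
with `P u = 𝔢₀`. Every `w ∈ W` is then some `P w'`, and `⟨u, ρ(g) w⟩ = ⟨P u, ρ(g) w'⟩ = (ρ(g)
w')_0`. For `w = F(τ)` and `f = ⟨u, F⟩` this gives both the character of `f` and the induction
formula (`exists_induction`). Invariance of `𝔢₀` under `T` forces `u` to be supported on isotropic
elements.

Injectivity means that an invariant `w` with `(ρ(g) w)_0 = 0` for all `g` is zero
(`eq_zero_of_coeff_zero`). Since `A` is elementary, a power of `T` chosen by the Chinese remainder
theorem makes `S⁻¹ Tᵐ S` a convolution along the `p`-part alone. Combined with powers of `T`, this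
shows that the coefficients of `w` over each level set of `q` in a coset of the `p`-part sum to
zero. Witt-type transitivity (`conj_of_odd`, `conj_of_two`) makes the coefficients constant on such
a set, apart from `0` and, for `p = 2`, the characteristic vector, which `S⁻¹ T²ᵐ S` handles because
it is a translation.

The existence of `ρ` and its character on `𝔢₀` are obtained without a presentation of `Mp₂(ℤ)`. In
rank one the Jacobi theta functions carry a genuine slash action and are linearly independent, which
yields the representation; the multiplier of the basic theta function gives the eigenvalue at `0`.
Tensor products give diagonal lattices. Any `L` contains a diagonal sublattice `M` of finite index,
and `L*/L` is the subquotient of `M*/M` attached to the isotropic subgroup `L/M` (`exists_descent`).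
This determines the eigenvalue on some deep `Γ̃₀(M)` (`M` now an integer). Multiplication by `Tⁿ`
and `U(Nm)`, which act trivially on the coefficient at `0`, moves any element of `Γ̃₀(N)` into
`Γ̃₀(M)`. Applied to elements acting trivially, the same device yields the congruences on the
signature that turn the formula into `χ_A`. -/

theorem root_eq_or_neg {g h : Mp2Z} (hm : g.mat = h.mat) :
    g.root = h.root ∨ g.root = -h.root := by
  have := (isPreconnected_univ (α := ℍ)).eq_or_eq_neg_of_sq_eq (f := g.root) (g := h.root)
    g.continuous_root.continuousOn h.continuous_root.continuousOn
    (fun τ _ => by simp only [Pi.pow_apply, g.root_sq, h.root_sq, hm]) (fun _ => h.root_ne_zero _)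
  simpa [Set.eqOn_univ] using this

/-- The element `(1, -1)` of `Mp₂(ℤ)`. -/
def flip : Mp2Z where
  mat := 1
  root := fun _ => -1
  continuous_root := continuous_const
  root_sq := fun τ => by simp

@[simp] theorem flip_mat : flip.mat = 1 := rfl
@[simp] theorem flip_root (τ : ℍ) : flip.root τ = -1 := rfl

theorem eq_or_eq_flip_mul {g h : Mp2Z} (hm : g.mat = h.mat) : g = h ∨ g = flip * h := by
  rcases root_eq_or_neg hm with h1 | h1
  · exact Or.inl (Mp2Z.ext hm h1)
  · refine Or.inr (Mp2Z.ext (by simp [hm]) ?_)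
    funext τ
    simp [h1]

@[simp] theorem S_mat : S.mat = ModularGroup.S := rfl
@[simp] theorem T_mat : T.mat = ModularGroup.T := rfl
@[simp] theorem T_root (τ : ℍ) : T.root τ = 1 := rfl
theorem S_root (τ : ℍ) : S.root τ = (τ : ℂ) ^ (1 / 2 : ℂ) := rfl

/-- `S²` lies over `-1` and its root squares to `-1`, so `S⁴` is the nontrivial lift of the
identity. Thus the sign ambiguity over `SL₂(ℤ)` is already contained in the monoid generated by `S`.
-/
theorem S_pow_four : S ^ 4 = flip := by
  have hS2 : ∀ τ : ℍ, (S * S).root τ ^ 2 = -1 := fun τ => by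
    rw [(S * S).root_sq, mul_mat S S, S_mat, Matrix.SpecialLinearGroup.coe_mul, ModularGroup.coe_S]
    simp [Matrix.mul_apply]
  have hm : ModularGroup.S * ModularGroup.S = -1 := by
    ext i j
    rw [Matrix.SpecialLinearGroup.coe_mul, ModularGroup.coe_S]
    fin_cases i <;> fin_cases j <;> simp [Matrix.mul_apply]
  have h4 : S ^ 4 = (S * S) * (S * S) := by rw [← sq, ← sq, ← pow_mul]
  rw [h4]
  refine Mp2Z.ext ?_ ?_
  · rw [mul_mat (S * S), mul_mat S S, S_mat, hm]; simp
  · funext τ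
    rw [mul_root (S * S)]
    have : (S * S).mat • τ = τ := by
      rw [mul_mat S S, S_mat, hm, ModularGroup.SL_neg_smul, one_smul]
    rw [this, ← sq, hS2]; rfl

/-- `S` and `T` generate `Mp₂(ℤ)` already as a monoid. -/
theorem closure_S_T : Submonoid.closure {S, T} = ⊤ := by
  set C := Submonoid.closure ({S, T} : Set Mp2Z) with hC
  have hS : S ∈ C := Submonoid.subset_closure (by simp)
  have hT : T ∈ C := Submonoid.subset_closure (by simp)
  have hflip : flip ∈ C := S_pow_four ▸ C.pow_mem hS 4
  have lift : ∀ {g h : Mp2Z}, h ∈ C → g.mat = h.mat → g ∈ C := by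
    intro g h hh hm
    rcases eq_or_eq_flip_mul hm with rfl | rfl
    · exact hh
    · exact C.mul_mem hflip hh
  have hSi : S⁻¹ ∈ C := by
    refine lift (C.pow_mem hS 3) ?_
    have : (S ^ 3).mat = ModularGroup.S * (ModularGroup.S * ModularGroup.S) := by
      rw [show S ^ 3 = S * (S * S) by rw [← sq, ← pow_succ']]; rfl
    rw [this, inv_mat, S_mat, inv_eq_iff_mul_eq_one]
    ext i j
    simp only [Matrix.SpecialLinearGroup.coe_mul, ModularGroup.coe_S]
    fin_cases i <;> fin_cases j <;> simp [Matrix.mul_apply]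
  have hTi : T⁻¹ ∈ C := by
    -- The relation `(ST)³ = S²` in `SL₂(ℤ)` gives `T⁻¹ = S⁻¹ T S T S`; `lift` absorbs the sign.
    refine lift (C.mul_mem hSi (C.mul_mem hT (C.mul_mem hS (C.mul_mem hT hS)))) ?_
    simp only [inv_mat, mul_mat, S_mat, T_mat]
    rw [inv_eq_iff_mul_eq_one]
    ext i j
    simp only [Matrix.SpecialLinearGroup.coe_mul, ModularGroup.coe_S, ModularGroup.coe_T,
      Matrix.SpecialLinearGroup.coe_inv, Matrix.adjugate_fin_two]
    fin_cases i <;> fin_cases j <;> simp [Matrix.mul_apply]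
  have hinv : ∀ g ∈ C, g⁻¹ ∈ C := by
    intro g hg
    induction hg using Submonoid.closure_induction with
    | mem x hx =>
      rcases hx with rfl | rfl
      · exact hSi
      · exact hTi
    | one => simp
    | mul x y _ _ hx hy => rw [mul_inv_rev]; exact C.mul_mem hy hx
  have key : ∀ x : SL(2, ℤ), ∃ h ∈ C, h.mat = x := by
    intro x
    have hx : x ∈ Subgroup.closure {ModularGroup.S, ModularGroup.T} := by
      rw [SpecialLinearGroup.SL2Z_generators]; trivial
    induction hx using Subgroup.closure_induction with
    | mem x hx =>
      rcases hx with rfl | rfl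
      · exact ⟨S, hS, rfl⟩
      · exact ⟨T, hT, rfl⟩
    | one => exact ⟨1, C.one_mem, rfl⟩
    | mul x y _ _ hx hy =>
      obtain ⟨h, hh, rfl⟩ := hx
      obtain ⟨k, hk, rfl⟩ := hy
      exact ⟨h * k, C.mul_mem hh hk, rfl⟩
    | inv x _ hx =>
      obtain ⟨h, hh, rfl⟩ := hx
      exact ⟨h⁻¹, hinv _ hh, rfl⟩
  rw [eq_top_iff]
  intro g _
  obtain ⟨h, hh, hm⟩ := key g.mat
  exact lift hh hm.symm

/-- An induction principle for `Mp₂(ℤ)` from its monoid generators `S` and `T`. -/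
theorem induction_S_T {p : Mp2Z → Prop} (hS : p S) (hT : p T) (h1 : p 1)
    (hmul : ∀ g h, p g → p h → p (g * h)) (g : Mp2Z) : p g := by
  have hg : g ∈ Submonoid.closure {S, T} := by rw [closure_S_T]; trivial
  induction hg using Submonoid.closure_induction with
  | mem x hx =>
    rcases hx with rfl | rfl
    · exact hS
    · exact hT
  | one => exact h1
  | mul x y _ _ hx hy => exact hmul _ _ hx hy

theorem continuous_principal_root (A : SL(2, ℤ)) :
    Continuous fun τ : ℍ => ((A 1 0 : ℂ) * (τ : ℂ) + (A 1 1 : ℂ)) ^ (1 / 2 : ℂ) := by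
  by_cases hc : A 1 0 = 0
  · simp only [hc, Int.cast_zero, zero_mul, zero_add]
    exact continuous_const
  · refine Continuous.cpow (by fun_prop) continuous_const fun τ => Or.inr ?_
    simp [hc, τ.im_ne_zero]

theorem half_cpow_sq (w : ℂ) : (w ^ (1 / 2 : ℂ)) ^ 2 = w := by
  rw [← Complex.cpow_nat_mul]; simp

/-- The principal root over a matrix, as an element of `Mp₂(ℤ)`. -/
def principal (A : SL(2, ℤ)) : Mp2Z where
  mat := A
  root := fun τ => ((A 1 0 : ℂ) * (τ : ℂ) + (A 1 1 : ℂ)) ^ (1 / 2 : ℂ)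
  continuous_root := continuous_principal_root A
  root_sq := fun _ => half_cpow_sq _

theorem sign_eq_or (g : Mp2Z) : g.sign = 1 ∨ g.sign = -1 := by
  unfold sign; split_ifs <;> simp

theorem root_eq_sign_mul (g : Mp2Z) (τ : ℍ) :
    g.root τ = g.sign * ((g.mat 1 0 : ℂ) * (τ : ℂ) + (g.mat 1 1 : ℂ)) ^ (1 / 2 : ℂ) := by
  unfold sign
  split_ifs with h
  · rw [one_mul, h]
  · rcases root_eq_or_neg (g := g) (h := principal g.mat) rfl with h1 | h1
    · exact absurd (fun τ => congrFun h1 τ) h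
    · rw [h1]; simp [principal]

theorem sign_eq_of_root_eq {g : Mp2Z} {s : ℂ} {τ : ℍ}
    (h : g.root τ = s * ((g.mat 1 0 : ℂ) * (τ : ℂ) + (g.mat 1 1 : ℂ)) ^ (1 / 2 : ℂ)) :
    g.sign = s := by
  rw [root_eq_sign_mul] at h
  refine mul_right_cancel₀ ?_ h
  exact (principal g.mat).root_ne_zero τ

theorem coe_T_zpow_smul (n : ℤ) (τ : ℍ) : ((ModularGroup.T ^ n • τ : ℍ) : ℂ) = τ + n := by
  rw [UpperHalfPlane.coe_specialLinearGroup_apply, ModularGroup.coe_T_zpow]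
  simp

theorem T_zpow_mat (n : ℤ) : (T ^ n).mat = ModularGroup.T ^ n := map_zpow proj T n

theorem T_zpow_root (n : ℤ) (τ : ℍ) : (T ^ n).root τ = 1 := by
  induction n using Int.induction_on generalizing τ with
  | zero => simp
  | succ n ih => rw [zpow_add_one, mul_root, ih, T_root, mul_one]
  | pred n ih => rw [zpow_sub_one, mul_root, ih, inv_root, T_root]; simp

theorem mul_T_zpow_mat (g : Mp2Z) (n : ℤ) :
    (g * T ^ n).mat 1 0 = g.mat 1 0 ∧ (g * T ^ n).mat 1 1 = g.mat 1 1 + n * g.mat 1 0 := by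
  rw [mul_mat, T_zpow_mat]
  simp only [Matrix.SpecialLinearGroup.coe_mul, ModularGroup.coe_T_zpow, Matrix.mul_apply,
    Fin.sum_univ_two]
  constructor
  · simp
  · simp; ring

theorem sign_mul_T_zpow (g : Mp2Z) (n : ℤ) : (g * T ^ n).sign = g.sign := by
  refine sign_eq_of_root_eq (τ := UpperHalfPlane.I) ?_
  rw [mul_root, T_zpow_root, mul_one, root_eq_sign_mul, (mul_T_zpow_mat g n).1,
    (mul_T_zpow_mat g n).2, T_zpow_mat, coe_T_zpow_smul]
  congr 2
  push_cast; ring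

/-- The lower triangular unipotent element `S Tⁿ S⁻¹`. -/
def U (n : ℤ) : Mp2Z := S * T ^ n * S⁻¹

theorem U_mat (n : ℤ) : ((U n).mat : Matrix (Fin 2) (Fin 2) ℤ) = !![1, 0; -n, 1] := by
  unfold U
  rw [mul_mat, mul_mat, T_zpow_mat, inv_mat, S_mat]
  simp only [Matrix.SpecialLinearGroup.coe_mul, ModularGroup.coe_T_zpow, ModularGroup.coe_S,
    Matrix.SpecialLinearGroup.coe_inv, Matrix.adjugate_fin_two]
  ext i j; fin_cases i <;> fin_cases j <;> simp [Matrix.mul_apply, Fin.sum_univ_two]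

theorem mul_U_mat (g : Mp2Z) (n : ℤ) :
    (g * U n).mat 1 0 = g.mat 1 0 - n * g.mat 1 1 ∧ (g * U n).mat 1 1 = g.mat 1 1 := by
  rw [mul_mat]
  simp only [Matrix.SpecialLinearGroup.coe_mul, U_mat, Matrix.mul_apply, Fin.sum_univ_two]
  constructor
  · simp; ring
  · simp

/-- Used to identify principal branches: once a candidate root has positive real part and the right
square, it is the principal one. -/
theorem half_cpow_re_im_pos {w : ℂ} (hw : 0 < w.im) :
    0 < (w ^ (1 / 2 : ℂ)).re ∧ 0 < (w ^ (1 / 2 : ℂ)).im := by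
  have hw0 : w ≠ 0 := fun h => by simp [h] at hw
  have hre : 0 ≤ (w ^ (1 / 2 : ℂ)).re := by
    rw [Complex.cpow_def_of_ne_zero hw0, Complex.exp_re]
    refine mul_nonneg (Real.exp_pos _).le (Real.cos_nonneg_of_mem_Icc ?_)
    have : (Complex.log w * (1 / 2)).im = w.arg / 2 := by
      rw [show (1 / 2 : ℂ) = ((1 / 2 : ℝ) : ℂ) by norm_num, Complex.im_mul_ofReal, Complex.log_im]
      ring
    rw [this]
    constructor <;> linarith [w.neg_pi_lt_arg, w.arg_le_pi]
  have h2 := congrArg Complex.im (half_cpow_sq w)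
  rw [sq, Complex.mul_im] at h2
  set x := (w ^ (1 / 2 : ℂ)).re
  set y := (w ^ (1 / 2 : ℂ)).im
  have hxy : 0 < x * y := by nlinarith
  have hx : 0 < x := lt_of_le_of_ne hre fun h => by rw [← h] at hxy; simp at hxy
  exact ⟨hx, pos_of_mul_pos_right hxy hre⟩

/-- The root of `S Tⁿ S⁻¹` is a quotient of two numbers in the open first quadrant, so its real part
is positive and it is the principal root. -/
theorem U_root (n : ℤ) (τ : ℍ) : (U n).root τ = (1 - n * (τ : ℂ)) ^ (1 / 2 : ℂ) := by
  have h1 := (U n).root_sq τ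
  simp only [U_mat] at h1
  have h2 : 0 < ((U n).root τ).re := by
    unfold U
    rw [mul_root, mul_root, T_zpow_root, mul_one, inv_root]
    set w := (S⁻¹).mat • τ with hw
    have : S.mat⁻¹ • τ = w := rfl
    rw [this, S_root, S_root]
    obtain ⟨a1, a2⟩ := half_cpow_re_im_pos ((T ^ n).mat • w).im_pos
    obtain ⟨b1, b2⟩ := half_cpow_re_im_pos w.im_pos
    set x := (((T ^ n).mat • w : ℍ) : ℂ) ^ (1 / 2 : ℂ)
    set y := (w : ℂ) ^ (1 / 2 : ℂ)
    rw [Complex.mul_re, Complex.inv_re, Complex.inv_im]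
    have : 0 < Complex.normSq y := by
      rw [Complex.normSq_pos]; intro h; simp [h] at b1
    field_simp
    nlinarith [mul_pos a1 b1, mul_pos a2 b2]
  have h3 := Complex.sq_cpow_two_inv h2
  rw [h1] at h3
  rw [← h3, one_div]
  congr 1
  simp; ring

/-! ### Behaviour of the square roots at the cusp `0`. -/

/-- The filter of neighbourhoods of the cusp `0`, for approach from anywhere in `ℍ`. -/
def nearZero : Filter ℍ := comap ((↑) : ℍ → ℂ) (𝓝 0)

instance : NeBot nearZero := by
  rw [nearZero, comap_neBot_iff]
  intro t ht
  obtain ⟨ε, hε, hb⟩ := Metric.mem_nhds_iff.mp ht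
  refine ⟨⟨((ε / 2 : ℝ) : ℂ) * Complex.I, by simpa using hε⟩, hb ?_⟩
  simp only [Metric.mem_ball, dist_zero_right, norm_mul, Complex.norm_real, Complex.norm_I, mul_one,
    Real.norm_eq_abs]
  rw [abs_of_pos (by linarith)]
  linarith

theorem tendsto_coe_nearZero : Tendsto ((↑) : ℍ → ℂ) nearZero (𝓝 0) := tendsto_comap

/-- The sign of `g` relative to the square root of `d`, at the cusp `0`. -/
def cuspSign (g : Mp2Z) : ℂ := g.sign * if g.mat 1 1 < 0 ∧ g.mat 1 0 < 0 then -1 else 1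

/-- For `d < 0` the limit point lies on the branch cut. The points `cτ + d` approach it from below
when `c < 0` and from above, or along the cut, when `c ≥ 0`; only approach from below flips the
sign. This is the analytic source of the sign in the Kronecker symbol for negative `c` and `d`. -/
theorem tendsto_principal_nearZero (c d : ℤ) (hd : d ≠ 0) :
    Tendsto (fun τ : ℍ => ((c : ℂ) * (τ : ℂ) + d) ^ (1 / 2 : ℂ)) nearZero
      (𝓝 ((if d < 0 ∧ c < 0 then -1 else 1) * (d : ℂ) ^ (1 / 2 : ℂ))) := by
  have hlim : Tendsto (fun τ : ℍ => (c : ℂ) * (τ : ℂ) + d) nearZero (𝓝 (d : ℂ)) := by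
    simpa using (tendsto_coe_nearZero.const_mul (c : ℂ)).add_const (d : ℂ)
  have hd0 : (d : ℂ) ≠ 0 := by exact_mod_cast hd
  rcases lt_or_gt_of_ne hd with hneg | hpos
  · have hre : (d : ℂ).re < 0 := by simpa using hneg
    have him : (d : ℂ).im = 0 := by simp
    have hne : ∀ᶠ τ : ℍ in nearZero, (c : ℂ) * (τ : ℂ) + d ≠ 0 := hlim.eventually_ne hd0
    have hlogd : Complex.log d = Real.log ‖(d : ℂ)‖ + Real.pi * Complex.I := by
      rw [Complex.log, Complex.arg_eq_pi_iff.mpr ⟨hre, him⟩]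
    have hexp : ∀ l : ℂ, Tendsto (fun τ : ℍ => Complex.log ((c : ℂ) * (τ : ℂ) + d)) nearZero (𝓝 l) →
        Tendsto (fun τ : ℍ => ((c : ℂ) * (τ : ℂ) + d) ^ (1 / 2 : ℂ)) nearZero
          (𝓝 (Complex.exp (l * (1 / 2)))) := by
      intro l hl
      refine ((Complex.continuous_exp.tendsto _).comp (hl.mul_const (1 / 2))).congr' ?_
      filter_upwards [hne] with τ hτ
      simp [Complex.cpow_def_of_ne_zero hτ]
    by_cases hc : c < 0
    · rw [if_pos ⟨hneg, hc⟩]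
      have h1 := (Complex.tendsto_log_nhdsWithin_im_neg_of_re_neg_of_im_zero hre him).comp
        (tendsto_nhdsWithin_iff.mpr ⟨hlim, Eventually.of_forall fun τ => by
          simpa using mul_neg_of_neg_of_pos (by exact_mod_cast hc) τ.im_pos⟩)
      convert hexp _ h1 using 2
      rw [Complex.cpow_def_of_ne_zero hd0, hlogd, show ((Real.log ‖(d : ℂ)‖ : ℂ) -
        Real.pi * Complex.I) * (1 / 2) = ((Real.log ‖(d : ℂ)‖ : ℂ) + Real.pi * Complex.I) * (1 / 2)
          - Real.pi * Complex.I by ring, Complex.exp_sub, Complex.exp_pi_mul_I, div_neg, div_one,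
        neg_one_mul]
    · rw [if_neg (fun h => hc h.2), one_mul]
      have h1 := (Complex.tendsto_log_nhdsWithin_im_nonneg_of_re_neg_of_im_zero hre him).comp
        (tendsto_nhdsWithin_iff.mpr ⟨hlim, Eventually.of_forall fun τ => by
          simpa using mul_nonneg (by exact_mod_cast not_lt.mp hc) τ.im_pos.le⟩)
      convert hexp _ h1 using 2
      rw [Complex.cpow_def_of_ne_zero hd0, hlogd]
  · rw [if_neg (fun h => absurd h.1 (not_lt.mpr hpos.le)), one_mul]
    have hc : ContinuousAt (fun w : ℂ => w ^ (1 / 2 : ℂ)) (d : ℂ) :=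
      continuousAt_id.cpow continuousAt_const (Or.inl (by simpa using hpos))
    exact hc.tendsto.comp hlim

theorem tendsto_root_nearZero (g : Mp2Z) (hd : g.mat 1 1 ≠ 0) :
    Tendsto g.root nearZero (𝓝 (g.cuspSign * (g.mat 1 1 : ℂ) ^ (1 / 2 : ℂ))) := by
  rw [cuspSign, mul_assoc]
  refine ((tendsto_principal_nearZero (g.mat 1 0) (g.mat 1 1) hd).const_mul g.sign).congr ?_
  exact fun τ => (g.root_eq_sign_mul τ).symm

/-- `U n` fixes the cusp `0` and its root tends to `1` there, so the limits of the roots of `g` and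
`g * U n` coincide. -/
theorem cuspSign_mul_U (g : Mp2Z) (n : ℤ) (hd : g.mat 1 1 ≠ 0) :
    (g * U n).cuspSign = g.cuspSign := by
  have h1 := tendsto_root_nearZero (g * U n) (by rwa [(mul_U_mat g n).2])
  rw [(mul_U_mat g n).2] at h1
  have h2 : Tendsto (fun τ : ℍ => (U n).mat • τ) nearZero nearZero := by
    refine tendsto_comap_iff.mpr ?_
    have : Tendsto (fun τ : ℍ => (τ : ℂ) / (1 - n * (τ : ℂ))) nearZero (𝓝 0) := by
      have h := tendsto_coe_nearZero.div
        ((tendsto_coe_nearZero.const_mul (n : ℂ)).const_sub 1) (by simp)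
      rwa [zero_div] at h
    refine this.congr fun τ => ?_
    rw [Function.comp_apply, UpperHalfPlane.coe_specialLinearGroup_apply, U_mat]
    simp
    ring
  have h3 : Tendsto (U n).root nearZero (𝓝 1) := by
    have := tendsto_principal_nearZero (-n) 1 one_ne_zero
    simp only [Int.reduceLT, false_and, if_false, one_mul, Int.cast_one, Complex.one_cpow] at this
    refine this.congr fun τ => ?_
    rw [U_root]
    congr 1
    push_cast; ring
  have h4 := ((tendsto_root_nearZero g hd).comp h2).mul h3
  have h5 := tendsto_nhds_unique h1 h4
  rw [mul_one] at h5
  refine mul_right_cancel₀ ?_ h5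
  rw [Complex.cpow_ne_zero_iff]
  left; exact_mod_cast hd

end Mp2Z
end

noncomputable section

/-! ### Theta functions of rank one lattices -/

open Complex (I)

theorem EvenLattice.e_coe (r : ℝ) : EvenLattice.e (r : UnitAddCircle) =
    Complex.exp (2 * Real.pi * I * r) := by
  rw [EvenLattice.e, AddCircle.toCircle_apply_mk, Circle.coe_exp]
  congr 1
  push_cast
  ring

theorem EvenLattice.e_add (x y : UnitAddCircle) :
    EvenLattice.e (x + y) = EvenLattice.e x * EvenLattice.e y := by
  simp [EvenLattice.e, AddCircle.toCircle_add]

theorem EvenLattice.e_toAddCircle {n : ℕ} [NeZero n] (j : ZMod n) :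
    EvenLattice.e (ZMod.toAddCircle j) = ZMod.stdAddChar j := rfl

/-- The slash operator of weight `1/2` and index `m` for functions on `ℍ × ℂ`. -/
def jacobiSlash (m : ℕ) (g : Mp2Z) (Ψ : ℍ → ℂ → ℂ) (τ : ℍ) (z : ℂ) : ℂ :=
  (g.root τ)⁻¹ *
    Complex.exp (-(2 * Real.pi * I * (m * (g.mat 1 0 : ℂ) * z ^ 2 /
      ((g.mat 1 0 : ℂ) * (τ : ℂ) + (g.mat 1 1 : ℂ))))) *
    Ψ (g.mat • τ) (z / ((g.mat 1 0 : ℂ) * (τ : ℂ) + (g.mat 1 1 : ℂ)))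

theorem jacobiSlash_mul (m : ℕ) (g h : Mp2Z) (Ψ : ℍ → ℂ → ℂ) :
    jacobiSlash m (g * h) Ψ = jacobiSlash m h (jacobiSlash m g Ψ) := by
  funext τ z
  have hden := Mp2Z.den_mul g.mat h.mat τ
  have h0 := Mp2Z.den_ne_zero h.mat τ
  have g0 := Mp2Z.den_ne_zero g.mat (h.mat • τ)
  have hdet : (h.mat 0 0 : ℂ) * h.mat 1 1 - h.mat 0 1 * h.mat 1 0 = 1 := by
    have := h.mat.det_coe
    rw [Matrix.det_fin_two] at this
    exact_mod_cast this
  have hc : ((g.mat * h.mat) 1 0 : ℂ) =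
      (g.mat 1 0 : ℂ) * h.mat 0 0 + g.mat 1 1 * h.mat 1 0 := by
    simp [Matrix.SpecialLinearGroup.coe_mul, Matrix.mul_apply, Fin.sum_univ_two]
  have hτ : ((h.mat • τ : ℍ) : ℂ) * ((h.mat 1 0 : ℂ) * (τ : ℂ) + (h.mat 1 1 : ℂ)) =
      h.mat 0 0 * τ + h.mat 0 1 := by
    rw [UpperHalfPlane.coe_specialLinearGroup_apply]
    simp only [algebraMap_int_eq, Int.coe_castRingHom, Complex.ofReal_intCast]
    exact div_mul_cancel₀ _ h0
  simp only [jacobiSlash, Mp2Z.mul_mat, Mp2Z.mul_root, hden, mul_smul, mul_inv]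
  set j := (h.mat 1 0 : ℂ) * (τ : ℂ) + (h.mat 1 1 : ℂ) with hj
  set w := ((h.mat • τ : ℍ) : ℂ) with hw
  set k := (g.mat 1 0 : ℂ) * w + (g.mat 1 1 : ℂ) with hk
  -- The cocycle relation for `c z² / (cτ + d)`, which comes from `det h = 1`.
  have hexp : (m : ℂ) * ((g.mat * h.mat) 1 0 : ℂ) * z ^ 2 / (k * j) =
      m * (h.mat 1 0 : ℂ) * z ^ 2 / j + m * (g.mat 1 0 : ℂ) * (z / j) ^ 2 / k := by
    have : ((g.mat * h.mat) 1 0 : ℂ) * j = h.mat 1 0 * (k * j) + g.mat 1 0 := by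
      rw [hc, hk]
      linear_combination (g.mat 1 0 : ℂ) * hdet - (h.mat 1 0 * g.mat 1 0 : ℂ) * hτ +
        (g.mat 1 0 * h.mat 0 0 : ℂ) * hj
    clear_value j k
    field_simp
    linear_combination m * z ^ 2 * this
  rw [hexp, mul_add, neg_add, Complex.exp_add, div_div, mul_comm j k]
  ring

/-- The theta function `∑ 𝐞(n² τ / 4a + n z)` over the integers `n ≡ k mod 2a`. -/
def thetaCoset (a : ℕ) (k : ℤ) (τ z : ℂ) : ℂ :=
  ∑' m : ℤ, jacobiTheta₂_term (k + 2 * a * m) z (τ / (2 * a))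

section theta

variable {a : ℕ} [NeZero a]

theorem summable_thetaCoset (k : ℤ) {τ : ℂ} (hτ : 0 < τ.im) (z : ℂ) :
    Summable fun m : ℤ => jacobiTheta₂_term (k + 2 * a * m) z (τ / (2 * a)) := by
  have ha : (0 : ℝ) < a := by exact_mod_cast NeZero.pos a
  have h1 : Summable (jacobiTheta₂_term · z (τ / (2 * a))) := by
    rw [summable_jacobiTheta₂_term_iff]
    rw [show (2 * a : ℂ) = ((2 * a : ℝ) : ℂ) by push_cast; ring, Complex.div_ofReal_im]
    positivity
  refine h1.comp_injective (i := fun m : ℤ => k + 2 * a * m) fun m n h => ?_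
  have : (2 * a : ℤ) ≠ 0 := by simpa using NeZero.ne a
  simpa [NeZero.ne a] using h

theorem thetaCoset_eq_jacobiTheta₂ (k : ℤ) (τ z : ℂ) :
    thetaCoset a k τ z = Complex.exp (2 * Real.pi * I * (k ^ 2 * τ / (4 * a) + k * z)) *
      jacobiTheta₂ (k * τ + 2 * a * z) (2 * a * τ) := by
  have ha : (a : ℂ) ≠ 0 := by exact_mod_cast NeZero.ne a
  unfold thetaCoset jacobiTheta₂
  rw [← tsum_mul_left]
  refine tsum_congr fun m => ?_
  rw [jacobiTheta₂_term, jacobiTheta₂_term, ← Complex.exp_add]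
  congr 1
  push_cast
  field_simp
  ring

theorem exp_two_pi_I_congr {x y : ℂ} (n : ℤ) (h : x = y + n) :
    Complex.exp (2 * Real.pi * I * x) = Complex.exp (2 * Real.pi * I * y) := by
  rw [h, mul_add, Complex.exp_add, mul_comm _ (n : ℂ), Complex.exp_int_mul_two_pi_mul_I, mul_one]

theorem thetaCoset_add_one (k : ℤ) (τ z : ℂ) :
    thetaCoset a k (τ + 1) z =
      Complex.exp (2 * Real.pi * I * (k ^ 2 / (4 * a))) * thetaCoset a k τ z := by
  have ha : (a : ℂ) ≠ 0 := by exact_mod_cast NeZero.ne a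
  unfold thetaCoset
  rw [← tsum_mul_left]
  refine tsum_congr fun m => ?_
  rw [jacobiTheta₂_term, jacobiTheta₂_term, ← exp_two_pi_I_congr (k * m + a * m ^ 2)
    (x := (k + 2 * a * m) ^ 2 / (4 * a)), ← Complex.exp_add]
  · congr 1
    push_cast
    field_simp
    ring
  · push_cast
    field_simp
    ring

/-- The translations of `z` by multiples of `1 / 2a` act on the different cosets by different
characters of `ℤ / 2a`. This separates the theta functions, and it also turns a Fourier transform
over the cosets into a shift of `z`. -/
theorem thetaCoset_add_div (k l : ℤ) (τ z : ℂ) :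
    thetaCoset a k τ (z + l / (2 * a)) =
      ZMod.stdAddChar ((l : ZMod (2 * a)) * (k : ZMod (2 * a))) * thetaCoset a k τ z := by
  have ha : (a : ℂ) ≠ 0 := by exact_mod_cast NeZero.ne a
  unfold thetaCoset
  rw [← tsum_mul_left]
  refine tsum_congr fun m => ?_
  rw [← Int.cast_mul, ZMod.stdAddChar_coe, mul_div_assoc, jacobiTheta₂_term, jacobiTheta₂_term,
    ← exp_two_pi_I_congr (l * m)
    (x := (k + 2 * a * m) * l / (2 * a)), ← Complex.exp_add]
  · congr 1
    push_cast
    field_simp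
    ring
  · push_cast
    field_simp

/-- At `τ = i`, `z = 0` every term of the series is a positive real number. -/
theorem thetaCoset_I_ne_zero (k : ℤ) : thetaCoset a k I 0 ≠ 0 := by
  have ha : (a : ℂ) ≠ 0 := by exact_mod_cast NeZero.ne a
  have hs := summable_thetaCoset (a := a) k (τ := I) (by simp) 0
  have hterm : ∀ m : ℤ, jacobiTheta₂_term (k + 2 * a * m) 0 (I / (2 * a)) =
      (Real.exp (-Real.pi * (k + 2 * a * m) ^ 2 / (2 * a)) : ℂ) := by
    intro m
    rw [jacobiTheta₂_term, Complex.ofReal_exp]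
    congr 1
    push_cast
    field_simp
    ring_nf
    simp only [Complex.I_sq]
    ring
  unfold thetaCoset
  simp only [hterm] at hs ⊢
  rw [← Complex.ofReal_tsum]
  have hs' := Complex.summable_ofReal.mp hs
  exact_mod_cast (hs'.tsum_pos (fun _ => (Real.exp_pos _).le) 0 (Real.exp_pos _)).ne'

/-- Every integer is congruent to a unique standard representative modulo `n`. -/
def intResidueEquiv (n : ℕ) [NeZero n] : ZMod n × ℤ ≃ ℤ where
  toFun p := (p.1.val : ℤ) + n * p.2
  invFun k := (k, k / n)
  left_inv p := by
    have hn : (0 : ℤ) < n := by exact_mod_cast NeZero.pos n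
    have h1 : (p.1.val : ℤ) / n = 0 :=
      Int.ediv_eq_zero_of_lt (by positivity) (by exact_mod_cast p.1.val_lt)
    ext
    · simp
    · simp [-ZMod.natCast_val, Int.add_mul_ediv_left _ _ hn.ne', h1]
  right_inv k := by
    simp [-ZMod.natCast_val, ZMod.val_intCast, Int.emod_add_mul_ediv]

/-- By `thetaCoset_add_div` the characters shift `z` by `-k / 2a` in every coset at once, and the
residue classes together exhaust `ℤ`. -/
theorem sum_thetaCoset (k : ℤ) {τ : ℂ} (hτ : 0 < τ.im) (z : ℂ) :
    ∑ y : ZMod (2 * a), ZMod.stdAddChar (-((k : ZMod (2 * a)) * y)) * thetaCoset a y.val τ z =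
      jacobiTheta₂ (z - k / (2 * a)) (τ / (2 * a)) := by
  have ha : (a : ℂ) ≠ 0 := by exact_mod_cast NeZero.ne a
  have ha' : (0 : ℝ) < a := by exact_mod_cast NeZero.pos a
  unfold jacobiTheta₂
  have h1 : Summable (jacobiTheta₂_term · (z - k / (2 * a)) (τ / (2 * a))) := by
    rw [summable_jacobiTheta₂_term_iff]
    rw [show (2 * a : ℂ) = ((2 * a : ℝ) : ℂ) by push_cast; ring, Complex.div_ofReal_im]
    positivity
  have h2 : Summable fun p : ZMod (2 * a) × ℤ => jacobiTheta₂_term (intResidueEquiv (2 * a) p)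
      (z - k / (2 * a)) (τ / (2 * a)) := (intResidueEquiv (2 * a)).summable_iff.mpr h1
  rw [← (intResidueEquiv (2 * a)).tsum_eq, h2.tsum_prod, tsum_fintype]
  refine Finset.sum_congr rfl fun y _ => ?_
  have := thetaCoset_add_div (a := a) y.val (-k) τ z
  rw [show (((-k : ℤ) : ZMod (2 * a)) * ((y.val : ℤ) : ZMod (2 * a))) = -((k : ZMod (2 * a)) * y) by simp] at this
  rw [← this]
  unfold thetaCoset
  refine tsum_congr fun m => ?_
  simp only [intResidueEquiv, Equiv.coe_fn_mk]
  congr 1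
  push_cast; ring

/-- Both sides have the same square. The right side has positive real part: a point of the first
quadrant is rotated by `-π / 4`. -/
theorem half_cpow_neg_I_mul {τ : ℂ} (hτ : 0 < τ.im) :
    (-I * (τ / (2 * a))) ^ (1 / 2 : ℂ) =
      τ ^ (1 / 2 : ℂ) * (Complex.exp (-(2 * Real.pi * I / 8)) / (Real.sqrt (2 * a) : ℂ)) := by
  have ha : (a : ℂ) ≠ 0 := by exact_mod_cast NeZero.ne a
  have ha' : (0 : ℝ) < a := by exact_mod_cast NeZero.pos a
  obtain ⟨h1, h2⟩ := Mp2Z.half_cpow_re_im_pos hτ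
  set r := τ ^ (1 / 2 : ℂ) * (Complex.exp (-(2 * Real.pi * I / 8)) / (Real.sqrt (2 * a) : ℂ)) with hr
  have hsqrt : ((Real.sqrt (2 * a) : ℝ) : ℂ) ^ 2 = 2 * a := by
    rw [← Complex.ofReal_pow, Real.sq_sqrt (by positivity)]; push_cast; ring
  have hsq : r ^ 2 = -I * (τ / (2 * a)) := by
    rw [hr, mul_pow, Mp2Z.half_cpow_sq, div_pow, hsqrt, ← Complex.exp_nat_mul]
    rw [show ((2 : ℕ) : ℂ) * -(2 * Real.pi * I / 8) = -(Real.pi / 2 * I) by push_cast; ring,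
      Complex.exp_neg, Complex.exp_pi_div_two_mul_I, Complex.inv_I]
    ring
  have hre : 0 < r.re := by
    have hexp : Complex.exp (-(2 * Real.pi * I / 8)) =
        ((Real.sqrt 2 / 2 : ℝ) : ℂ) + ((-(Real.sqrt 2 / 2) : ℝ) : ℂ) * I := by
      rw [show -(2 * Real.pi * I / 8) = ((-(Real.pi / 4) : ℝ) : ℂ) * I by push_cast; ring,
        Complex.exp_mul_I, ← Complex.ofReal_cos, ← Complex.ofReal_sin, Real.cos_neg, Real.sin_neg,
        Real.cos_pi_div_four, Real.sin_pi_div_four]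
    rw [hr, hexp, ← mul_div_assoc, Complex.div_ofReal_re]
    have h3 : 0 < Real.sqrt 2 := by positivity
    refine div_pos ?_ (by positivity)
    simp only [Complex.mul_re, Complex.add_re, Complex.ofReal_re, Complex.ofReal_im, Complex.I_re,
      Complex.I_im, Complex.add_im, Complex.mul_im]
    nlinarith [mul_pos h1 h3, mul_pos h2 h3]
  have := Complex.sq_cpow_two_inv hre
  rw [hsq] at this
  rw [one_div, this]

/-- Poisson summation, in the form of the functional equation of `jacobiTheta₂`, applied to the
single theta series of `sum_thetaCoset`. -/
theorem thetaCoset_S (k : ℤ) {τ : ℂ} (hτ : 0 < τ.im) (z : ℂ) :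
    (τ ^ (1 / 2 : ℂ))⁻¹ * Complex.exp (-(2 * Real.pi * I * (a * z ^ 2 / τ))) *
      thetaCoset a k (-1 / τ) (z / τ) =
    (Complex.exp (-(2 * Real.pi * I / 8)) / (Real.sqrt (2 * a) : ℂ)) *
      ∑ y : ZMod (2 * a), ZMod.stdAddChar (-((k : ZMod (2 * a)) * y)) * thetaCoset a y.val τ z := by
  have ha : (a : ℂ) ≠ 0 := by exact_mod_cast NeZero.ne a
  have hτ0 : τ ≠ 0 := fun h => by simp [h] at hτ
  have hr : τ ^ (1 / 2 : ℂ) ≠ 0 := by rw [Complex.cpow_ne_zero_iff]; exact Or.inl hτ0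
  have ha' : (0 : ℝ) < a := by exact_mod_cast NeZero.pos a
  have hs : ((Real.sqrt (2 * a) : ℝ) : ℂ) ≠ 0 := by
    exact_mod_cast (Real.sqrt_pos.mpr (mul_pos two_pos ha')).ne'
  have he := Complex.exp_ne_zero (-(2 * Real.pi * I / 8))
  rw [sum_thetaCoset k hτ, jacobiTheta₂_functional_equation, thetaCoset_eq_jacobiTheta₂,
    half_cpow_neg_I_mul hτ]
  rw [show (z - k / (2 * a)) / (τ / (2 * a)) = k * (-1 / τ) + 2 * a * (z / τ) by
      field_simp; ring, show -1 / (τ / (2 * a)) = 2 * a * (-1 / τ) by field_simp]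
  have hexp : Complex.exp (-(2 * Real.pi * I * (a * z ^ 2 / τ))) *
      Complex.exp (2 * Real.pi * I * (k ^ 2 * (-1 / τ) / (4 * a) + k * (z / τ))) =
      Complex.exp (-Real.pi * I * (z - k / (2 * a)) ^ 2 / (τ / (2 * a))) := by
    rw [← Complex.exp_add]
    congr 1
    field_simp
    ring
  rw [← hexp]
  field_simp

variable (a) in
/-- The theta functions of the lattice `ℤ` with form `2a x y`, indexed by its discriminant group. -/
def theta (x : ZMod (2 * a)) (τ : ℍ) (z : ℂ) : ℂ := thetaCoset a x.val τ z

/-- Summing the relation over the translates `z = l / 2a` against a character isolates one coset by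
orthogonality, and its theta value at `(i, 0)` is nonzero. -/
theorem theta_linearIndependent {c : ZMod (2 * a) → ℂ}
    (h : ∀ z, ∑ y, c y * theta a y UpperHalfPlane.I z = 0) (x : ZMod (2 * a)) : c x = 0 := by
  have h1 : ∑ l : ZMod (2 * a), ZMod.stdAddChar (-(l * x)) *
      ∑ y, c y * theta a y UpperHalfPlane.I (0 + (l.val : ℤ) / (2 * a)) = 0 :=
    Finset.sum_eq_zero fun l _ => by rw [h, mul_zero]
  simp only [theta, thetaCoset_add_div, Finset.mul_sum] at h1
  rw [Finset.sum_comm] at h1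
  have h2 : ∀ y : ZMod (2 * a), ∑ l : ZMod (2 * a), ZMod.stdAddChar (-(l * x)) *
      (c y * (ZMod.stdAddChar (((l.val : ℤ) : ZMod (2 * a)) * ((y.val : ℤ) : ZMod (2 * a))) *
        thetaCoset a y.val UpperHalfPlane.I 0)) =
      if y = x then (2 * a : ℕ) * (c y * thetaCoset a y.val UpperHalfPlane.I 0) else 0 := by
    intro y
    have := AddChar.sum_mulShift (y - x) (ZMod.isPrimitive_stdAddChar (2 * a))
    simp only [ZMod.card, sub_eq_zero] at this
    rw [show (if y = x then ((2 * a : ℕ) : ℂ) * (c y * thetaCoset a y.val UpperHalfPlane.I 0)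
      else 0) = ((if y = x then 2 * a else 0 : ℕ) : ℂ) *
        (c y * thetaCoset a y.val UpperHalfPlane.I 0) by split_ifs <;> simp, ← this, Finset.sum_mul]
    refine Finset.sum_congr rfl fun l _ => ?_
    rw [show l * (y - x) = -(l * x) + ((l.val : ℤ) : ZMod (2 * a)) * ((y.val : ℤ) : ZMod (2 * a)) by
      simp; ring, AddChar.map_add_eq_mul]
    ring
  simp only [h2, Finset.sum_ite_eq', Finset.mem_univ, if_true] at h1
  have ha : ((2 * a : ℕ) : ℂ) ≠ 0 := by exact_mod_cast NeZero.ne (2 * a)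
  have h3 : thetaCoset a x.val I 0 ≠ 0 := thetaCoset_I_ne_zero _
  simpa [-ZMod.natCast_val, h3, NeZero.ne a] using h1

/-- The quadratic form `x² / 4a` on `ℤ / 2a`. -/
def cyclicQ (x : ZMod (2 * a)) : UnitAddCircle := ((x.val ^ 2 / (4 * a) : ℝ) : UnitAddCircle)

theorem cyclicQ_intCast (k : ℤ) :
    cyclicQ (k : ZMod (2 * a)) = ((k ^ 2 / (4 * a) : ℝ) : UnitAddCircle) := by
  have ha : (a : ℝ) ≠ 0 := by exact_mod_cast NeZero.ne a
  unfold cyclicQ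
  have h : (((k : ZMod (2 * a)).val : ℤ) : ZMod (2 * a)) = k := by simp
  obtain ⟨m, hm⟩ := (ZMod.intCast_eq_intCast_iff_dvd_sub _ _ _).mp h
  set v := (k : ZMod (2 * a)).val
  have hk : (k : ℝ) = v + 2 * a * m := by
    have : k = v + 2 * a * m := by push_cast at hm; linarith
    exact_mod_cast this
  rw [← sub_eq_zero, ← AddCircle.coe_sub, AddCircle.coe_eq_zero_iff]
  refine ⟨-(v * m + a * m ^ 2), ?_⟩
  rw [hk]
  simp only [zsmul_eq_mul]
  push_cast
  field_simp
  ring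

theorem jacobiSlash_T_theta (x : ZMod (2 * a)) :
    jacobiSlash a Mp2Z.T (theta a x) = EvenLattice.e (cyclicQ x) • theta a x := by
  funext τ z
  have h : ((ModularGroup.T • τ : ℍ) : ℂ) = τ + 1 := by
    simpa using Mp2Z.coe_T_zpow_smul 1 τ
  simp only [jacobiSlash, Mp2Z.T_root, Mp2Z.T_mat, Pi.smul_apply, theta, h, thetaCoset_add_one]
  rw [cyclicQ, EvenLattice.e_coe]
  simp [-ZMod.natCast_val, ModularGroup.T]

theorem jacobiSlash_S_theta (x : ZMod (2 * a)) :
    jacobiSlash a Mp2Z.S (theta a x) = ∑ y : ZMod (2 * a),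
      ((Complex.exp (-(2 * Real.pi * I / 8)) / (Real.sqrt (2 * a) : ℂ)) *
        ZMod.stdAddChar (-(x * y))) • theta a y := by
  funext τ z
  have h : ((ModularGroup.S • τ : ℍ) : ℂ) = -1 / τ := by
    rw [UpperHalfPlane.coe_specialLinearGroup_apply]; simp [ModularGroup.S]
  have := thetaCoset_S (a := a) x.val τ.im_pos z
  simp only [jacobiSlash, Mp2Z.S_root, Mp2Z.S_mat, theta, h, Finset.sum_apply, Pi.smul_apply,
    smul_eq_mul]
  simp only [ModularGroup.S] at *
  simp only [mul_assoc, ← Finset.mul_sum]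
  simpa [mul_assoc] using this

theorem jacobiSlash_one (m : ℕ) (Ψ : ℍ → ℂ → ℂ) : jacobiSlash m 1 Ψ = Ψ := by
  funext τ z
  simp [jacobiSlash]

theorem jacobiSlash_sum {ι : Type*} [Fintype ι] (m : ℕ) (g : Mp2Z) (c : ι → ℂ)
    (Ψ : ι → ℍ → ℂ → ℂ) :
    jacobiSlash m g (∑ i, c i • Ψ i) = ∑ i, c i • jacobiSlash m g (Ψ i) := by
  funext τ z
  simp only [jacobiSlash, Finset.sum_apply, Pi.smul_apply, smul_eq_mul, Finset.mul_sum]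
  refine Finset.sum_congr rfl fun i _ => ?_
  ring

/-- Stability of the span is needed only for the generators. Since the slash operation is a true
action and the theta functions are independent, the resulting matrices are unique and hence
multiplicative. This is how the representation arises with no relations of `Mp₂(ℤ)` to check. -/
theorem exists_theta_matrix (g : Mp2Z) : ∃ M : Matrix (ZMod (2 * a)) (ZMod (2 * a)) ℂ,
    ∀ x, jacobiSlash a g (theta a x) = ∑ y, M x y • theta a y := by
  induction g using Mp2Z.induction_S_T with
  | hS => exact ⟨fun x y => _, jacobiSlash_S_theta⟩
  | hT =>
    refine ⟨Matrix.diagonal fun x => EvenLattice.e (cyclicQ x), fun x => ?_⟩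
    rw [jacobiSlash_T_theta, Finset.sum_eq_single x] <;>
      simp +contextual [eq_comm]
  | h1 =>
    refine ⟨1, fun x => ?_⟩
    rw [jacobiSlash_one, Finset.sum_eq_single x] <;> simp +contextual [eq_comm]
  | hmul g h hg hh =>
    obtain ⟨M, hM⟩ := hg
    obtain ⟨N, hN⟩ := hh
    refine ⟨M * N, fun x => ?_⟩
    rw [jacobiSlash_mul, hM, jacobiSlash_sum]
    simp only [hN, Finset.smul_sum, Matrix.mul_apply, Finset.sum_smul, smul_smul]
    rw [Finset.sum_comm]

theorem theta_matrix_unique {M N : ZMod (2 * a) → ℂ}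
    (h : ∑ y, M y • theta a y = ∑ y, N y • theta a y) : M = N := by
  funext y
  rw [← sub_eq_zero]
  refine theta_linearIndependent (c := fun y => M y - N y) (fun z => ?_) y
  have := congrFun (congrFun h UpperHalfPlane.I) z
  simp only [Finset.sum_apply, Pi.smul_apply, smul_eq_mul] at this
  simp only [sub_mul, Finset.sum_sub_distrib, this, sub_self]

variable (a) in
/-- The matrix of the slash operator on theta functions. -/
def thetaMatrix (g : Mp2Z) : Matrix (ZMod (2 * a)) (ZMod (2 * a)) ℂ :=
  (exists_theta_matrix g).choose

theorem thetaMatrix_spec (g : Mp2Z) (x : ZMod (2 * a)) :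
    jacobiSlash a g (theta a x) = ∑ y, thetaMatrix a g x y • theta a y :=
  (exists_theta_matrix g).choose_spec x

variable (a) in
/-- The Weil representation of the rank one lattice with form `2a x y`, in matrix form. -/
def thetaRep : Mp2Z →* Matrix (ZMod (2 * a)) (ZMod (2 * a)) ℂ where
  toFun := thetaMatrix a
  map_one' := by
    funext x
    refine theta_matrix_unique ?_
    rw [← thetaMatrix_spec 1 x, jacobiSlash_one, Finset.sum_eq_single x] <;>
      simp +contextual [eq_comm]
  map_mul' g h := by
    funext x
    refine theta_matrix_unique ?_
    rw [← thetaMatrix_spec (g * h) x, jacobiSlash_mul, thetaMatrix_spec g x, jacobiSlash_sum]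
    simp only [thetaMatrix_spec h, Finset.smul_sum, Matrix.mul_apply, Finset.sum_smul, smul_smul]
    rw [Finset.sum_comm]

theorem jacobiSlash_theta (g : Mp2Z) (x : ZMod (2 * a)) :
    jacobiSlash a g (theta a x) = ∑ y, thetaRep a g x y • theta a y :=
  thetaMatrix_spec g x

theorem thetaRep_T (x y : ZMod (2 * a)) :
    thetaRep a Mp2Z.T x y = if x = y then EvenLattice.e (cyclicQ x) else 0 := by
  have : thetaRep a Mp2Z.T x = fun y => if x = y then EvenLattice.e (cyclicQ x) else 0 := by
    refine theta_matrix_unique ?_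
    rw [← jacobiSlash_theta, jacobiSlash_T_theta]
    simp
  rw [this]

theorem thetaRep_S (x y : ZMod (2 * a)) :
    thetaRep a Mp2Z.S x y = (Complex.exp (-(2 * Real.pi * I / 8)) / (Real.sqrt (2 * a) : ℂ)) *
      ZMod.stdAddChar (-(x * y)) := by
  have : thetaRep a Mp2Z.S x = fun y => (Complex.exp (-(2 * Real.pi * I / 8)) /
      (Real.sqrt (2 * a) : ℂ)) * ZMod.stdAddChar (-(x * y)) := by
    refine theta_matrix_unique ?_
    rw [← jacobiSlash_theta, jacobiSlash_S_theta]
  rw [this]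

end theta
end

noncomputable section

/-! ### The Kronecker symbol and the theta character -/

open Complex (I)
open scoped NumberTheorySymbols
open ZMod (χ₄ χ₈)

theorem kroneckerSymbol_of_odd (c : ℤ) {d : ℤ} (hd : Odd d) :
    kroneckerSymbol c d = (if d < 0 ∧ c < 0 then -1 else 1) * J(c | d.natAbs) := by
  have hd0 : d ≠ 0 := by rintro rfl; simp at hd
  have hf : d.natAbs.factorization 2 = 0 := by
    refine Nat.factorization_eq_zero_of_not_dvd fun h => ?_
    have := Int.natAbs_odd.mpr hd
    rw [← Nat.not_even_iff_odd] at this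
    exact this (even_iff_two_dvd.mpr h)
  simp [kroneckerSymbol, hd0, hf]

theorem chi₄_neg (n : ZMod 4) : χ₄ (-n) = -χ₄ n := by revert n; decide

theorem chi₈_neg (n : ZMod 8) : χ₈ (-n) = χ₈ n := by revert n; decide

theorem jacobiSym_reciprocity_nat {c n : ℕ} (hc : Odd c) (hn : Odd n) :
    J(c | n) = (if c % 4 = 3 then χ₄ n else 1) * J(n | c) := by
  rcases Nat.odd_mod_four_iff.mp (Nat.odd_iff.mp hc) with h | h
  · rw [if_neg (by omega), one_mul, jacobiSym.quadratic_reciprocity_one_mod_four h hn]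
  · rw [if_pos h]
    rcases Nat.odd_mod_four_iff.mp (Nat.odd_iff.mp hn) with h' | h'
    · rw [ZMod.χ₄_nat_one_mod_four h', one_mul,
        jacobiSym.quadratic_reciprocity_one_mod_four' hc h']
    · rw [ZMod.χ₄_nat_three_mod_four h', jacobiSym.quadratic_reciprocity_three_mod_four h h']
      ring

/-- Quadratic reciprocity for the Kronecker symbol with odd lower entry, which may be negative. -/
theorem kroneckerSymbol_reciprocity {s : ℤ} (hs : s = 1 ∨ s = -1) (k : ℕ) {c : ℕ} (hc : Odd c)
    {d : ℤ} (hd : Odd d) :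
    kroneckerSymbol (s * (2 ^ k * c)) d = χ₈ d ^ k * (if s = -1 then χ₄ d else 1) *
      (if c % 4 = 3 then χ₄ d else 1) * J(d | c) := by
  have hc0 : 0 < c := hc.pos
  have hpos : (0 : ℤ) < 2 ^ k * c := by positivity
  have hn : Odd d.natAbs := Int.natAbs_odd.mpr hd
  have hJ : J(s * (2 ^ k * c) | d.natAbs) = (if s = -1 then χ₄ d.natAbs else 1) *
      (χ₈ d.natAbs ^ k * ((if c % 4 = 3 then χ₄ d.natAbs else 1) * J(d.natAbs | c))) := by
    rw [jacobiSym.mul_left, jacobiSym.mul_left, jacobiSym.pow_left, jacobiSym.at_two hn,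
      jacobiSym_reciprocity_nat hc hn]
    rcases hs with rfl | rfl
    · simp [jacobiSym.one_left]
    · simp [jacobiSym.at_neg_one hn]
  rw [kroneckerSymbol_of_odd _ hd, hJ]
  rcases Int.natAbs_eq d with h | h
  · have h0 : ¬ d < 0 := by omega
    set n := d.natAbs
    rw [h]
    simp only [Int.cast_natCast]
    rw [if_neg (by omega)]
    ring
  · have h0 : d < 0 := by have := hn.pos; omega
    set n := d.natAbs
    have hsc : s * (2 ^ k * c) < 0 ↔ s = -1 := by
      rcases hs with rfl | rfl
      · simp
      · simp; omega
    have hJd : J(d | c) = χ₄ c * J(n | c) := by rw [h, jacobiSym.neg _ hc]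
    have h4 : χ₄ (d : ZMod 4) = -χ₄ n := by rw [h]; push_cast; exact chi₄_neg _
    have h8 : χ₈ (d : ZMod 8) = χ₈ n := by rw [h]; push_cast; exact chi₈_neg _
    rw [hJd, h4, h8]
    simp only [h0, true_and, hsc]
    rcases Nat.odd_mod_four_iff.mp (Nat.odd_iff.mp hc) with h' | h'
    · rw [ZMod.χ₄_nat_one_mod_four h']
      simp only [show ¬ c % 4 = 3 by omega, if_false]
      split_ifs <;> ring
    · rw [ZMod.χ₄_nat_three_mod_four h']
      simp only [h', if_true]
      split_ifs <;> ring

theorem chi₈_sq_of_odd {d : ℤ} (hd : Odd d) : χ₈ (d : ZMod 8) ^ 2 = 1 := by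
  have : (d : ZMod 8) = ((d % 8 : ℤ) : ZMod 8) := (ZMod.intCast_mod d 8).symm
  rw [this]
  have h1 : d % 8 = 1 ∨ d % 8 = 3 ∨ d % 8 = 5 ∨ d % 8 = 7 := by
    have := Int.odd_iff.mp hd; omega
  rcases h1 with h | h | h | h <;> rw [h] <;> decide

theorem exists_eq_sign_mul_two_pow_mul_odd {c : ℤ} (hc : c ≠ 0) :
    ∃ s : ℤ, (s = 1 ∨ s = -1) ∧ ∃ (k m : ℕ), Odd m ∧ c = s * (2 ^ k * m) := by
  obtain ⟨k, m, hm, h⟩ := Nat.exists_eq_two_pow_mul_odd (Int.natAbs_ne_zero.mpr hc)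
  rcases Int.natAbs_eq c with h' | h'
  · exact ⟨1, Or.inl rfl, k, m, hm, by rw [h', h]; push_cast; ring⟩
  · exact ⟨-1, Or.inr rfl, k, m, hm, by rw [h', h]; push_cast; ring⟩

/-- For `4 ∣ c`, the Kronecker symbol `(c / d)` is periodic in `d` with period `c`. -/
theorem kroneckerSymbol_add_mul {c d : ℤ} (hc : 4 ∣ c) (hd : Odd d) (n : ℤ) :
    kroneckerSymbol c (d + n * c) = kroneckerSymbol c d := by
  rcases eq_or_ne c 0 with rfl | hc0
  · simp
  have hd' : Odd (d + n * c) := hd.add_even (((even_iff_two_dvd.mpr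
    (dvd_trans (by norm_num) hc))).mul_left n)
  obtain ⟨s, hs, k, m, hm, hcs⟩ := exists_eq_sign_mul_two_pow_mul_odd hc0
  have h4 : χ₄ ((d + n * c : ℤ) : ZMod 4) = χ₄ (d : ZMod 4) := by
    have : (c : ZMod 4) = 0 := (ZMod.intCast_zmod_eq_zero_iff_dvd c 4).mpr (by exact_mod_cast hc)
    push_cast; rw [this, mul_zero, add_zero]
  -- If `k` is even, the power of `χ₈` is `1`. If `k` is odd, then `4 ∣ c` excludes `k = 1`, so `8 ∣
  -- c` and `d` does not change modulo `8`.
  have h8 : χ₈ ((d + n * c : ℤ) : ZMod 8) ^ k = χ₈ (d : ZMod 8) ^ k := by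
    rcases Nat.even_or_odd k with ⟨j, rfl⟩ | ⟨j, hj⟩
    · rw [← two_mul, pow_mul, pow_mul, chi₈_sq_of_odd hd, chi₈_sq_of_odd hd']
    · have hj1 : 1 ≤ j := by
        by_contra h
        have hj0 : j = 0 := by omega
        subst hj0
        simp only [mul_zero, zero_add] at hj
        subst hj
        obtain ⟨l, hl⟩ := hm
        rcases hs with rfl | rfl <;> (subst hl; push_cast at hcs; omega)
      have : (8 : ℤ) ∣ c := by
        rw [hcs, hj]
        obtain ⟨i, rfl⟩ := Nat.exists_eq_add_of_le hj1
        exact ⟨s * (4 ^ i * m), by rw [show 2 * (1 + i) + 1 = 2 * i + 3 by ring, pow_add, pow_mul]; ring⟩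
      have : (c : ZMod 8) = 0 := (ZMod.intCast_zmod_eq_zero_iff_dvd c 8).mpr (by exact_mod_cast this)
      push_cast; rw [this, mul_zero, add_zero]
  have hJ : J(d + n * c | m) = J(d | m) := by
    refine jacobiSym.mod_left' ?_
    rw [hcs, show d + n * (s * (2 ^ k * (m : ℤ))) = d + m * (n * s * 2 ^ k) by ring,
      Int.add_mul_emod_self_left]
  have key := fun {d : ℤ} (hd : Odd d) => kroneckerSymbol_reciprocity hs k hm hd
  rw [← hcs] at key
  rw [key hd, key hd', h4, h8, hJ]

namespace Mp2Z

theorem gcd_eq_one (g : Mp2Z) : IsCoprime (g.mat 1 0) (g.mat 1 1) := by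
  have := g.mat.det_coe
  rw [Matrix.det_fin_two] at this
  exact ⟨-g.mat 0 1, g.mat 0 0, by linarith⟩

theorem odd_of_dvd (g : Mp2Z) (h : 2 ∣ g.mat 1 0) : Odd (g.mat 1 1) := by
  rw [← Int.not_even_iff_odd, even_iff_two_dvd]
  intro h'
  have := g.gcd_eq_one.isUnit_of_dvd' h h'
  rw [Int.isUnit_iff] at this
  omega

/-- The sign of the Kronecker symbol for negative `c` and `d` is exactly what distinguishes
`cuspSign` from `sign`. What remains is a Jacobi symbol that depends only on `c` modulo `d`, so
invariance under `U n` becomes visible. -/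
theorem chiTheta_eq (g : Mp2Z) (hd : Odd (g.mat 1 1)) :
    chiTheta g = g.cuspSign * (if g.mat 1 1 % 4 = 1 then 1 else -I) *
      (J(g.mat 1 0 | (g.mat 1 1).natAbs) : ℂ) := by
  rw [chiTheta, kroneckerSymbol_of_odd _ hd, cuspSign]
  split_ifs <;> push_cast <;> ring

theorem chiTheta_mul_U (g : Mp2Z) (hd : Odd (g.mat 1 1)) (n : ℤ) :
    chiTheta (g * U n) = chiTheta g := by
  have h0 : g.mat 1 1 ≠ 0 := by intro h; rw [h] at hd; simp at hd
  rw [chiTheta_eq _ (by rwa [(mul_U_mat g n).2]), chiTheta_eq _ hd, cuspSign_mul_U g n h0,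
    (mul_U_mat g n).2, (mul_U_mat g n).1]
  congr 2
  refine jacobiSym.mod_left' ?_
  rw [Int.emod_eq_emod_iff_emod_sub_eq_zero, sub_sub_cancel_left]
  refine Int.emod_eq_zero_of_dvd ?_
  rw [dvd_neg]
  exact Dvd.dvd.mul_left (Int.natAbs_dvd.mpr dvd_rfl) _

theorem chiTheta_mul_T_zpow (g : Mp2Z) (hc : 4 ∣ g.mat 1 0) (n : ℤ) :
    chiTheta (g * T ^ n) = chiTheta g := by
  have hd := g.odd_of_dvd (dvd_trans (by norm_num) hc)
  rw [chiTheta, chiTheta, sign_mul_T_zpow, (mul_T_zpow_mat g n).1, (mul_T_zpow_mat g n).2,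
    kroneckerSymbol_add_mul hc hd]
  congr 3
  have : (g.mat 1 1 + n * g.mat 1 0) % 4 = g.mat 1 1 % 4 := by
    obtain ⟨k, hk⟩ := hc
    rw [hk, show n * (4 * k) = 4 * (n * k) by ring, Int.add_mul_emod_self_left]
  rw [this]

theorem chiTheta_pow_four (g : Mp2Z) (hd : Odd (g.mat 1 1)) : chiTheta g ^ 4 = 1 := by
  have hJ : J(g.mat 1 0 | (g.mat 1 1).natAbs) ^ 4 = 1 := by
    rcases jacobiSym.eq_one_or_neg_one (a := g.mat 1 0) (b := (g.mat 1 1).natAbs) (by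
      have := Int.isCoprime_iff_gcd_eq_one.mp g.gcd_eq_one
      rw [Int.gcd] at this ⊢
      simpa only [Int.natAbs_natCast] using this) with h | h <;> rw [h] <;> norm_num
  have hJ' : (J(g.mat 1 0 | (g.mat 1 1).natAbs) : ℂ) ^ 4 = 1 := by exact_mod_cast hJ
  rw [chiTheta_eq g hd, mul_pow, mul_pow, hJ', cuspSign, mul_pow]
  rcases g.sign_eq_or with h | h <;> rw [h] <;> split_ifs <;>
    simp [Complex.I_pow_four, neg_pow I, show (-1 : ℂ) ^ 4 = 1 by norm_num]

end Mp2Z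

/-! ### Transformation of the theta functions of index zero under `Γ̃₀(4)` and `Γ̃₀(4a)`. -/

/-- The subgroup of `Mp₂(ℤ)` that fixes a function under the slash operator. -/
def jacobiStabilizer (m : ℕ) (Ψ : ℍ → ℂ → ℂ) : Subgroup Mp2Z where
  carrier := {g | jacobiSlash m g Ψ = Ψ}
  one_mem' := jacobiSlash_one m Ψ
  mul_mem' {g h} hg hh := by
    simp only [Set.mem_ofPred_eq] at *
    rw [jacobiSlash_mul, hg, hh]
  inv_mem' {g} hg := by
    simp only [Set.mem_ofPred_eq] at *
    conv_lhs => rw [← hg]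
    rw [← jacobiSlash_mul, mul_inv_cancel, jacobiSlash_one]

theorem jacobiSlash_smul (m : ℕ) (g : Mp2Z) (c : ℂ) (Ψ : ℍ → ℂ → ℂ) :
    jacobiSlash m g (c • Ψ) = c • jacobiSlash m g Ψ := by
  funext τ z
  simp only [jacobiSlash, Pi.smul_apply, smul_eq_mul]
  ring

theorem T_mem_jacobiStabilizer (a : ℕ) [NeZero a] : Mp2Z.T ∈ jacobiStabilizer a (theta a 0) := by
  change jacobiSlash a Mp2Z.T (theta a 0) = theta a 0
  rw [jacobiSlash_T_theta]
  simp [cyclicQ, EvenLattice.e]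

/-- `T^{4a}` acts trivially because `q` takes values in `(1 / 4a)ℤ / ℤ`, and `U (4an)` is conjugate
to a power of it. -/
theorem thetaRep_U (a : ℕ) [NeZero a] (n : ℤ) : thetaRep a (Mp2Z.U (4 * a * n)) = 1 := by
  have hT : Mp2Z.T ^ (4 * a) ∈ (thetaRep a).ker := by
    rw [MonoidHom.mem_ker, map_pow]
    have : thetaRep a Mp2Z.T = Matrix.diagonal fun x => EvenLattice.e (cyclicQ x) := by
      ext x y; rw [thetaRep_T, Matrix.diagonal_apply]
    rw [this, Matrix.diagonal_pow, ← Matrix.diagonal_one]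
    congr 1
    funext x
    have ha : (a : ℂ) ≠ 0 := by exact_mod_cast NeZero.ne a
    rw [Pi.pow_apply, cyclicQ, EvenLattice.e_coe, ← Complex.exp_nat_mul,
      Complex.exp_eq_one_iff]
    refine ⟨x.val ^ 2, ?_⟩
    push_cast
    field_simp
  have : Mp2Z.U (4 * a * n) ∈ (thetaRep a).ker := by
    unfold Mp2Z.U
    refine (inferInstance : (thetaRep a).ker.Normal).conj_mem _ ?_ _
    rw [zpow_mul]
    exact Subgroup.zpow_mem _ (by exact_mod_cast hT) n
  exact this

theorem U_mem_jacobiStabilizer (n : ℤ) : Mp2Z.U (4 * n) ∈ jacobiStabilizer 1 (theta 1 0) := by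
  change jacobiSlash 1 (Mp2Z.U (4 * n)) (theta 1 0) = theta 1 0
  have := thetaRep_U 1 n
  rw [jacobiSlash_theta]
  simp only [Nat.cast_one, mul_one] at this
  rw [this, Finset.sum_eq_single 0] <;> simp +contextual [eq_comm]

/-- The reduction step of the Euclidean descent: right multiplication by an element that changes
neither the theta function nor the character. -/
theorem jacobiSlash_theta_one_of_mul {g k : Mp2Z} (hk : k ∈ jacobiStabilizer 1 (theta 1 0))
    (hχ : chiTheta (g * k) = chiTheta g)
    (h : jacobiSlash 1 (g * k) (theta 1 0) = chiTheta (g * k) • theta 1 0) :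
    jacobiSlash 1 g (theta 1 0) = chiTheta g • theta 1 0 := by
  have hk' : jacobiSlash 1 k⁻¹ (theta 1 0) = theta 1 0 := Subgroup.inv_mem _ hk
  rw [show g = (g * k) * k⁻¹ by group, jacobiSlash_mul, h, jacobiSlash_smul, hk', hχ]
  simp

theorem neg_one_half_cpow : (-1 : ℂ) ^ (1 / 2 : ℂ) = I := by
  rw [Complex.cpow_def_of_ne_zero (by norm_num), Complex.log_neg_one,
    show (Real.pi : ℂ) * I * (1 / 2) = Real.pi / 2 * I by ring, Complex.exp_pi_div_two_mul_I]

theorem theta_one_zero_neg (τ : ℍ) (z : ℂ) : theta 1 0 τ (-z) = theta 1 0 τ z := by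
  have h : ((0 : ZMod (2 * 1)).val : ℤ) = 0 := rfl
  rw [theta, theta, h, thetaCoset_eq_jacobiTheta₂, thetaCoset_eq_jacobiTheta₂]
  simp [mul_neg, jacobiTheta₂_neg_left]

/-- The end of the descent. A power of `T` reduces to an element over `±1`; over `-1` the root is
`±i`, and the theta function is even in `z`. -/
theorem jacobiSlash_theta_one_of_zero {g : Mp2Z} (hc : g.mat 1 0 = 0) :
    jacobiSlash 1 g (theta 1 0) = chiTheta g • theta 1 0 := by
  have hdet := g.mat.det_coe
  rw [Matrix.det_fin_two, hc, mul_zero, sub_zero] at hdet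
  refine jacobiSlash_theta_one_of_mul (k := Mp2Z.T ^ (-(g.mat 0 1 * g.mat 1 1)))
    (Subgroup.zpow_mem _ (T_mem_jacobiStabilizer 1) _)
    (Mp2Z.chiTheta_mul_T_zpow g (by simp [hc]) _) ?_
  obtain ⟨h10, h11⟩ := Mp2Z.mul_T_zpow_mat g (-(g.mat 0 1 * g.mat 1 1))
  have h01 : (g * Mp2Z.T ^ (-(g.mat 0 1 * g.mat 1 1))).mat 0 1 = 0 := by
    rw [Mp2Z.mul_mat, Mp2Z.T_zpow_mat]
    simp only [Matrix.SpecialLinearGroup.coe_mul, ModularGroup.coe_T_zpow, Matrix.mul_apply,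
      Fin.sum_univ_two]
    simp
    linear_combination (-g.mat 0 1) * hdet
  rw [hc] at h10
  rw [hc, mul_zero, add_zero] at h11
  set k := g * Mp2Z.T ^ (-(g.mat 0 1 * g.mat 1 1)) with hk
  have hdet' := k.mat.det_coe
  rw [Matrix.det_fin_two, h10, mul_zero, sub_zero, h11] at hdet'
  rcases Int.isUnit_iff.mp (IsUnit.of_mul_eq_one_right _ hdet) with hd | hd
  · rw [hd] at h11 hdet'
    have hkm : k.mat = 1 := by
      ext i j; fin_cases i <;> fin_cases j <;> simp [h10, h11, h01]
      simpa using hdet'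
    funext τ z
    have hroot : k.root τ = k.sign := by
      rw [k.root_eq_sign_mul, h10, h11]; simp
    have hχ : chiTheta k = k.sign := by
      rw [chiTheta, h10, h11, kroneckerSymbol_of_odd _ odd_one]; simp
    rw [jacobiSlash, hroot, Pi.smul_apply, Pi.smul_apply, hχ, h10, h11, hkm]
    rcases k.sign_eq_or with h | h <;> simp [h, inv_neg]
  · rw [hd] at h11 hdet'
    have hkm : k.mat = -1 := by
      ext i j; fin_cases i <;> fin_cases j <;> simp [h10, h11, h01]
      linarith
    funext τ z
    have hroot : k.root τ = k.sign * I := by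
      rw [k.root_eq_sign_mul, h10, h11]; simp [← neg_one_half_cpow]
    have hχ : chiTheta k = k.sign * -I := by
      rw [chiTheta, h10, h11, kroneckerSymbol_of_odd _ (by decide)]; simp
    rw [jacobiSlash, hroot, Pi.smul_apply, Pi.smul_apply, hχ, h10, h11, hkm,
      ModularGroup.SL_neg_smul, one_smul]
    rcases k.sign_eq_or with h | h <;> simp [h, div_neg, theta_one_zero_neg]

theorem exists_two_mul_abs_add_mul_le (d : ℤ) {c : ℤ} (hc : c ≠ 0) :
    ∃ n : ℤ, 2 * |d + n * c| ≤ |c| := by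
  have h1 := Int.emod_add_mul_ediv d c
  have h2 := Int.emod_nonneg d hc
  have h3 := Int.emod_lt_abs d hc
  by_cases h : 2 * (d % c) ≤ |c|
  · refine ⟨-(d / c), ?_⟩
    rw [show d + -(d / c) * c = d % c by linarith, abs_of_nonneg h2]
    exact h
  · refine ⟨-(d / c) - c.sign, ?_⟩
    have hs : c.sign * c = |c| := Int.sign_mul_self_eq_abs c
    rw [show d + (-(d / c) - c.sign) * c = d % c - |c| by linarith, abs_of_neg (by linarith)]
    linarith

/-- The theta function has character `χ_ϑ` on `Γ̃₀(4)`. -/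
theorem jacobiSlash_theta_one (g : Mp2Z) (hc : 4 ∣ g.mat 1 0) :
    jacobiSlash 1 g (theta 1 0) = chiTheta g • theta 1 0 := by
  induction hn : (g.mat 1 0).natAbs using Nat.strong_induction_on generalizing g with
  | _ N ih =>
  rcases eq_or_ne (g.mat 1 0) 0 with h0 | h0
  · exact jacobiSlash_theta_one_of_zero h0
  obtain ⟨n, hn1⟩ := exists_two_mul_abs_add_mul_le (g.mat 1 1) h0
  obtain ⟨h10, h11⟩ := Mp2Z.mul_T_zpow_mat g n
  refine jacobiSlash_theta_one_of_mul (k := Mp2Z.T ^ n)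
    (Subgroup.zpow_mem _ (T_mem_jacobiStabilizer 1) _) (Mp2Z.chiTheta_mul_T_zpow g hc n) ?_
  set k := g * Mp2Z.T ^ n
  rw [← h11, ← h10] at hn1
  rw [← h10] at hc h0 hn
  have hodd := k.odd_of_dvd (dvd_trans (by norm_num) hc)
  have hd0 : 4 * k.mat 1 1 ≠ 0 := by
    intro h; have : k.mat 1 1 = 0 := by omega
    rw [this] at hodd; simp at hodd
  -- Powers of `U 4` change `c` by multiples of `4d`, so `|c|` can be brought down to at most
  -- `2|d|`, which is less than the old `|c|`.
  obtain ⟨m, hm⟩ := exists_two_mul_abs_add_mul_le (k.mat 1 0) hd0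
  obtain ⟨u10, u11⟩ := Mp2Z.mul_U_mat k (4 * -m)
  refine jacobiSlash_theta_one_of_mul (U_mem_jacobiStabilizer (-m))
    (Mp2Z.chiTheta_mul_U k hodd _) ?_
  have e1 : k.mat 1 0 + m * (4 * k.mat 1 1) = (k * Mp2Z.U (4 * -m)).mat 1 0 := by rw [u10]; ring
  rw [e1] at hm
  refine ih _ ?_ _ ?_ rfl
  -- The inequality is strict because `4` divides `c`, whereas `2d` with `d` odd is not divisible by
  -- `4`.
  · have hlt : 2 * |k.mat 1 1| < |k.mat 1 0| := by
      refine lt_of_le_of_ne hn1 fun h => ?_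
      have h4 : (4 : ℤ) ∣ |k.mat 1 0| := (dvd_abs _ _).mpr hc
      rw [← h] at h4
      obtain ⟨j, hj⟩ := odd_abs.mpr hodd
      rw [hj] at h4
      omega
    rw [abs_mul] at hm
    have h5 : |(4 : ℤ)| = 4 := rfl
    rw [h5] at hm
    rw [← hn]
    zify
    linarith
  · rw [← e1]
    exact dvd_add hc (Dvd.dvd.mul_left (dvd_mul_right _ _) _)

/-- There is an element of `Mp₂(ℤ)` over `(α, aβ; c / a, d)`, conjugate to `g` by `τ ↦ a τ`. -/
theorem exists_scaled (a : ℕ) [NeZero a] (g : Mp2Z) (hc : (a : ℤ) ∣ g.mat 1 0) :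
    ∃ h : Mp2Z, h.mat 1 0 = g.mat 1 0 / a ∧ h.mat 1 1 = g.mat 1 1 ∧ h.sign = g.sign ∧
      ∀ τ σ : ℍ, (σ : ℂ) = a * τ →
        h.root σ = g.root τ ∧ ((h.mat • σ : ℍ) : ℂ) = a * (g.mat • τ : ℍ) := by
  obtain ⟨c, hc⟩ := hc
  have ha : (a : ℤ) ≠ 0 := by exact_mod_cast NeZero.ne a
  have ha' : (0 : ℝ) < a := by exact_mod_cast NeZero.pos a
  have hdet := g.mat.det_coe
  rw [Matrix.det_fin_two, hc] at hdet
  have hroot : Continuous fun σ : ℍ => g.root ⟨(σ : ℂ) / a, by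
      rw [Complex.div_natCast_im]; exact div_pos σ.im_pos ha'⟩ :=
    g.continuous_root.comp (by
      refine UpperHalfPlane.isEmbedding_coe.continuous_iff.mpr ?_
      exact UpperHalfPlane.continuous_coe.div_const _)
  let A : SL(2, ℤ) := ⟨!![g.mat 0 0, a * g.mat 0 1; c, g.mat 1 1], by
    rw [Matrix.det_fin_two_of]; linarith⟩
  have hA10 : A 1 0 = c := rfl
  have hA11 : A 1 1 = g.mat 1 1 := rfl
  have haC : (a : ℂ) ≠ 0 := by exact_mod_cast NeZero.ne a
  let h : Mp2Z :=
    { mat := A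
      root := _
      continuous_root := hroot
      root_sq := fun σ => by
        rw [g.root_sq, hA10, hA11, hc]
        push_cast
        field_simp }
  have hdiv : ∀ τ σ : ℍ, (σ : ℂ) = a * τ → h.root σ = g.root τ := fun τ σ hσ => by
    change g.root _ = g.root τ
    congr 1
    refine UpperHalfPlane.ext ?_
    change (σ : ℂ) / a = τ
    rw [hσ]; field_simp
  have hscale : ∀ τ : ℍ, 0 < ((a : ℂ) * τ).im := fun τ => by
    simpa using mul_pos ha' τ.im_pos
  refine ⟨h, ?_, rfl, ?_, fun τ σ hσ => ⟨hdiv τ σ hσ, ?_⟩⟩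
  · rw [hc, Int.mul_ediv_cancel_left _ ha]; rfl
  · refine Mp2Z.sign_eq_of_root_eq (τ := ⟨(a : ℂ) * UpperHalfPlane.I, hscale _⟩) ?_
    rw [hdiv UpperHalfPlane.I _ rfl, g.root_eq_sign_mul, hc]
    change _ = g.sign * ((A 1 0 : ℂ) * ((a : ℂ) * UpperHalfPlane.I) + A 1 1) ^ (1 / 2 : ℂ)
    rw [hA10, hA11]
    congr 2
    push_cast; ring
  · change ((A • σ : ℍ) : ℂ) = _
    rw [UpperHalfPlane.coe_specialLinearGroup_apply, UpperHalfPlane.coe_specialLinearGroup_apply]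
    simp only [algebraMap_int_eq, Int.coe_castRingHom, Complex.ofReal_intCast]
    rw [hA10, hA11, hc, hσ, show A 0 0 = g.mat 0 0 from rfl, show A 0 1 = a * g.mat 0 1 from rfl]
    push_cast
    rw [show (c : ℂ) * (a * τ) = a * c * τ by ring]
    ring

theorem theta_zero_eq (a : ℕ) [NeZero a] {τ σ : ℍ} (h : (σ : ℂ) = a * τ) (z : ℂ) :
    theta a 0 τ z = theta 1 0 σ (a * z) := by
  have ha : (a : ℂ) ≠ 0 := by exact_mod_cast NeZero.ne a
  rw [theta, theta, ZMod.val_zero, ZMod.val_zero, thetaCoset, thetaCoset, h]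
  refine tsum_congr fun m => ?_
  rw [jacobiTheta₂_term, jacobiTheta₂_term]
  congr 1
  push_cast
  field_simp
  ring

theorem isCoprime_natAbs {a : ℕ} {g : Mp2Z} (hc : (a : ℤ) ∣ g.mat 1 0) :
    (a : ℤ).gcd (g.mat 1 1).natAbs = 1 := by
  have := Int.isCoprime_iff_gcd_eq_one.mp (g.gcd_eq_one.of_isCoprime_of_dvd_left hc)
  rw [Int.gcd] at this ⊢
  simpa only [Int.natAbs_natCast] using this

/-- The function `θ_{a,0}(τ, z)` equals `θ_{1,0}(aτ, az)`, and conjugation by `τ ↦ aτ` replaces `c`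
by `c / a`, which is still divisible by `4`. The theta character then changes by the factor `(a /
|d|)`. -/
theorem thetaRep_zero_row (a : ℕ) [NeZero a] {g : Mp2Z} (hc : (4 * a : ℤ) ∣ g.mat 1 0)
    (y : ZMod (2 * a)) :
    thetaRep a g 0 y = if y = 0 then chiTheta g * (J(a | (g.mat 1 1).natAbs) : ℂ) else 0 := by
  have haC : (a : ℂ) ≠ 0 := by exact_mod_cast NeZero.ne a
  have ha' : (0 : ℝ) < a := by exact_mod_cast NeZero.pos a
  have ha : (a : ℤ) ≠ 0 := by exact_mod_cast NeZero.ne a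
  have hac : (a : ℤ) ∣ g.mat 1 0 := dvd_trans (dvd_mul_left _ _) hc
  obtain ⟨h, h10, h11, hsign, hτ⟩ := exists_scaled a g hac
  obtain ⟨c, hc'⟩ := hac
  rw [hc', Int.mul_ediv_cancel_left _ ha] at h10
  have h4 : 4 ∣ h.mat 1 0 := by
    rw [h10]
    rw [hc', mul_comm (4 : ℤ)] at hc
    exact Int.dvd_of_mul_dvd_mul_left ha hc
  have hodd := h.odd_of_dvd (dvd_trans (by norm_num) h4)
  have hχ : chiTheta h = chiTheta g * (J(a | (g.mat 1 1).natAbs) : ℂ) := by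
    rw [chiTheta, chiTheta, hsign, h11, h10, hc', kroneckerSymbol_of_odd _ (h11 ▸ hodd),
      kroneckerSymbol_of_odd _ (h11 ▸ hodd), jacobiSym.mul_left]
    have hneg : a * c < 0 ↔ c < 0 := by
      have : (0 : ℤ) < a := by exact_mod_cast NeZero.pos a
      constructor
      · intro h; by_contra h'; exact absurd h (not_lt.mpr (mul_nonneg this.le (not_lt.mp h')))
      · exact fun h => mul_neg_of_pos_of_neg this h
    have hsq : (J(a | (g.mat 1 1).natAbs) : ℂ) ^ 2 = 1 := by
      exact_mod_cast jacobiSym.sq_one (isCoprime_natAbs ⟨c, hc'⟩)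
    simp only [hneg]
    push_cast
    linear_combination (-(g.sign * (if g.mat 1 1 % 4 = 1 then 1 else -I) *
      ((if g.mat 1 1 < 0 ∧ c < 0 then -1 else 1) * (J(c | (g.mat 1 1).natAbs) : ℂ)))) * hsq
  have key : jacobiSlash a g (theta a 0) = chiTheta h • theta a 0 := by
    funext τ z
    obtain ⟨σ, hσ⟩ : ∃ σ : ℍ, (σ : ℂ) = a * τ :=
      ⟨⟨a * τ, by simpa using mul_pos ha' τ.im_pos⟩, rfl⟩
    obtain ⟨hr, hm⟩ := hτ τ σ hσ
    have h1 := congrFun (congrFun (jacobiSlash_theta_one h h4) σ) (a * z)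
    have h2 := theta_zero_eq a hσ z
    have h3 := theta_zero_eq a hm (z / ((g.mat 1 0 : ℂ) * (τ : ℂ) + (g.mat 1 1 : ℂ)))
    have hden : (g.mat 1 0 : ℂ) * (τ : ℂ) + (g.mat 1 1 : ℂ) = (c : ℂ) * σ + g.mat 1 1 := by
      rw [hσ, hc']; push_cast; ring
    simp only [Pi.smul_apply] at h1 ⊢
    rw [h2, ← h1]
    unfold jacobiSlash
    rw [h3, hr, h10, h11, hden, hc']
    congr 2
    · congr 1
      push_cast
      ring
    · ring
  have : thetaRep a g 0 = fun y => if y = 0 then chiTheta h else 0 := by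
    refine theta_matrix_unique ?_
    rw [← jacobiSlash_theta, key]
    simp
  rw [this, hχ]

end

noncomputable section

/-! ### Finite quadratic modules -/

open EvenLattice (e)

theorem EvenLattice.e_zero : e 0 = 1 := by simp [e]

theorem EvenLattice.e_ne_zero (x : UnitAddCircle) : e x ≠ 0 := Circle.coe_ne_zero _

theorem EvenLattice.e_neg (x : UnitAddCircle) : e (-x) = (e x)⁻¹ := by
  rw [e, AddCircle.toCircle_neg, Circle.coe_inv, ← e]

theorem EvenLattice.e_nsmul (n : ℕ) (x : UnitAddCircle) : e (n • x) = e x ^ n := by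
  induction n with
  | zero => simp [e_zero]
  | succ n ih => rw [succ_nsmul, e_add, ih, pow_succ]

theorem EvenLattice.e_eq_one_iff {x : UnitAddCircle} : e x = 1 ↔ x = 0 := by
  constructor
  · intro h
    refine AddCircle.injective_toCircle one_ne_zero ?_
    ext1
    simpa [e] using h
  · rintro rfl; exact e_zero

theorem EvenLattice.star_e (x : UnitAddCircle) : star (e x) = e (-x) := by
  rw [e_neg, e]
  exact (Circle.coe_inv_eq_conj _).symm

open EvenLattice

theorem sum_range_e_nsmul {n : ℕ} {x : UnitAddCircle} (hx : n • x = 0) :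
    ∑ j ∈ Finset.range n, e (j • x) = if x = 0 then (n : ℂ) else 0 := by
  split_ifs with h
  · simp [h, e_zero]
  · simp only [e_nsmul]
    have h1 : e x ≠ 1 := fun h' => h (e_eq_one_iff.mp h')
    have h2 : e x ^ n = 1 := by rw [← e_nsmul, hx, e_zero]
    rw [geom_sum_eq h1, h2, sub_self, zero_div]

theorem sum_e_hom {A : Type*} [AddCommGroup A] [Fintype A] (φ : A →+ UnitAddCircle)
    (hφ : φ ≠ 0) : ∑ x, e (φ x) = 0 := by
  obtain ⟨y, hy⟩ : ∃ y, φ y ≠ 0 := by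
    by_contra h; push Not at h; exact hφ (AddMonoidHom.ext h)
  have h1 : ∑ x, e (φ x) = e (φ y) * ∑ x, e (φ x) := by
    conv_lhs => rw [← Equiv.sum_comp (Equiv.addLeft y)]
    rw [Finset.mul_sum]
    simp [e_add]
  have h2 : (e (φ y) - 1) * ∑ x, e (φ x) = 0 := by rw [sub_mul, ← h1]; ring
  exact (mul_eq_zero.mp h2).resolve_left fun h => hy (e_eq_one_iff.mp (sub_eq_zero.mp h))

theorem exists_toAddCircle_eq {n : ℕ} [NeZero n] {t : UnitAddCircle} (ht : n • t = 0) :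
    ∃ k : ZMod n, ZMod.toAddCircle k = t := by
  obtain ⟨r, rfl⟩ := QuotientAddGroup.mk_surjective t
  have h1 : (((n : ℝ) * r : ℝ) : UnitAddCircle) = 0 := by
    rw [← nsmul_eq_mul]; exact ht
  obtain ⟨k, hk⟩ := (AddCircle.coe_eq_zero_iff 1).mp h1
  refine ⟨k, ?_⟩
  rw [ZMod.toAddCircle_intCast]
  have hn : (n : ℝ) ≠ 0 := by exact_mod_cast NeZero.ne n
  have : (k : ℝ) / n = r := by
    simp only [zsmul_eq_mul, mul_one] at hk
    rw [hk]; field_simp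
  rw [this]

/-- A nondegenerate quadratic form with values in `ℝ / ℤ` on an abelian group. -/
structure QuadModule (A : Type*) [AddCommGroup A] where
  b : A →+ A →+ UnitAddCircle
  q : A → UnitAddCircle
  b_comm : ∀ x y, b x y = b y x
  nondeg : ∀ x, (∀ y, b x y = 0) → x = 0
  q_add : ∀ x y, q (x + y) = q x + q y + b x y
  q_neg : ∀ x, q (-x) = q x

namespace QuadModule

variable {A : Type*} [AddCommGroup A] (Q : QuadModule A)

theorem q_zero : Q.q 0 = 0 := by
  have := Q.q_add 0 0
  simpa using this

theorem b_self (x : A) : Q.b x x = 2 • Q.q x := by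
  have := Q.q_add x (-x)
  rw [add_neg_cancel, q_zero, Q.q_neg, map_neg] at this
  rw [two_nsmul]
  exact (sub_eq_zero.mp (by rw [sub_eq_add_neg]; exact this.symm)).symm

theorem q_nsmul (n : ℕ) (x : A) : Q.q (n • x) = (n ^ 2) • Q.q x := by
  induction n with
  | zero => simp [q_zero]
  | succ n ih =>
    rw [succ_nsmul, Q.q_add, ih, map_nsmul, AddMonoidHom.nsmul_apply, b_self, ← mul_nsmul']
    rw [show (n + 1) ^ 2 = n ^ 2 + 1 + n * 2 by ring, add_nsmul, add_nsmul, one_nsmul]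

theorem q_zsmul (n : ℤ) (x : A) : Q.q (n • x) = (n ^ 2) • Q.q x := by
  obtain ⟨k, rfl | rfl⟩ := n.eq_nat_or_neg
  · rw [natCast_zsmul, q_nsmul]; norm_cast
  · rw [neg_smul, natCast_zsmul, Q.q_neg, q_nsmul, neg_sq]; norm_cast

theorem q_sub (x y : A) : Q.q (x - y) = Q.q x + Q.q y - Q.b x y := by
  rw [sub_eq_add_neg, Q.q_add, Q.q_neg, map_neg, ← sub_eq_add_neg]

/-- The automorphisms preserving the quadratic form. -/
def aut : Set (A ≃+ A) := {σ | ∀ x, Q.q (σ x) = Q.q x}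

/-- Preserving `q` entails preserving `b`, and nondegeneracy makes such a map injective; on a finite
group it is then bijective. -/
theorem exists_aut [Finite A] (f : A →+ A) (hf : ∀ x, Q.q (f x) = Q.q x) :
    ∃ σ ∈ Q.aut, ∀ x, σ x = f x := by
  have hb : ∀ x y, Q.b (f x) (f y) = Q.b x y := by
    intro x y
    have h1 := Q.q_add (f x) (f y)
    rw [← map_add, hf, hf, hf, Q.q_add] at h1
    exact (add_left_cancel h1).symm
  have hinj : Function.Injective f := by
    refine (injective_iff_map_eq_zero f).mpr fun x hx => Q.nondeg x fun y => ?_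
    rw [← hb, hx, map_zero, AddMonoidHom.zero_apply]
  exact ⟨AddEquiv.ofBijective f (Finite.injective_iff_bijective.mp hinj), hf, fun x => rfl⟩

/-- `γ` is conjugate to `γ'` by an automorphism fixing the elements of order dividing `d`. -/
def Conj (d : ℕ) (γ γ' : A) : Prop :=
  ∃ σ ∈ Q.aut, (∀ x, d • x = 0 → σ x = x) ∧ σ γ = γ'

theorem Conj.trans {Q : QuadModule A} {d : ℕ} {x y z : A} (h1 : Q.Conj d x y)
    (h2 : Q.Conj d y z) : Q.Conj d x z := by
  obtain ⟨σ, hσ, hσ', rfl⟩ := h1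
  obtain ⟨τ, hτ, hτ', rfl⟩ := h2
  refine ⟨σ.trans τ, fun x => ?_, fun x hx => ?_, rfl⟩
  · exact (hτ _).trans (hσ _)
  · change τ (σ x) = x
    rw [hσ' x hx, hτ' x hx]

/-! ### Reflections, and transitivity on the `p`-torsion for odd `p`. -/

section prime

variable {p : ℕ} [Fact p.Prime] {d : ℕ}

/-- The linear functional `p b(·, u)` with values in `ℤ / p`, for `u` of order `p`. -/
theorem exists_functional (p : ℕ) [Fact p.Prime] {u : A} (hu : p • u = 0) :
    ∃ φ : A →+ ZMod p, ∀ x, ZMod.toAddCircle (φ x) = Q.b x u := by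
  have h : ∀ x, ∃ k : ZMod p, ZMod.toAddCircle k = Q.b x u := fun x =>
    exists_toAddCircle_eq (by rw [← map_nsmul, hu, map_zero])
  choose f hf using h
  refine ⟨AddMonoidHom.mk' f fun x y => ZMod.toAddCircle_injective p ?_, hf⟩
  rw [map_add, hf, hf, hf, map_add, AddMonoidHom.add_apply]

/-- The action of `ℤ / p` on an element of order `p`. -/
theorem exists_action {u : A} (hu : p • u = 0) :
    ∃ f : ZMod p →+ A, ∀ k : ℤ, f k = k • u :=
  ⟨ZMod.lift p ⟨zmultiplesHom A u, by simpa using hu⟩, fun k => by simp⟩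

theorem b_action {u : A} {f : ZMod p →+ A} (hf : ∀ k : ℤ, f k = k • u) {φ : A →+ ZMod p}
    (hφ : ∀ x, ZMod.toAddCircle (φ x) = Q.b x u) (x : A) (k : ZMod p) :
    Q.b x (f k) = ZMod.toAddCircle (k * φ x) := by
  obtain ⟨k, rfl⟩ := ZMod.intCast_surjective k
  rw [hf, map_zsmul, ← hφ, ← map_zsmul, zsmul_eq_mul]

theorem q_action {u : A} {f : ZMod p →+ A} (hf : ∀ k : ℤ, f k = k • u) {c : ZMod p}
    (hc : ZMod.toAddCircle c = Q.q u) (k : ZMod p) :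
    Q.q (f k) = ZMod.toAddCircle (k ^ 2 * c) := by
  obtain ⟨k, rfl⟩ := ZMod.intCast_surjective k
  rw [hf, q_zsmul, ← hc, ← map_zsmul, zsmul_eq_mul]
  push_cast; rfl

theorem hom_eq_zero_of_coprime (hd : p.Coprime d) (φ : A →+ ZMod p) {x : A} (hx : d • x = 0) :
    φ x = 0 := by
  have h1 : (d : ZMod p) * φ x = 0 := by rw [← nsmul_eq_mul, ← map_nsmul, hx, map_zero]
  refine (mul_eq_zero.mp h1).resolve_left fun h => ?_
  rw [ZMod.natCast_eq_zero_iff] at h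
  exact (Fact.out : p.Prime).one_lt.ne' (Nat.dvd_one.mp (hd ▸ Nat.dvd_gcd dvd_rfl h))

/-- Conjugation by the reflection in `γ' - γ`. -/
theorem conj_of_q_sub_ne_zero [Finite A] (hd : p.Coprime d) {γ γ' : A} (hγ : p • γ = 0)
    (hγ' : p • γ' = 0) (hq : Q.q γ = Q.q γ') (hu : Q.q (γ' - γ) ≠ 0) : Q.Conj d γ γ' := by
  set u := γ' - γ with hudef
  have hpu : p • u = 0 := by rw [hudef, nsmul_sub, hγ, hγ', sub_zero]
  obtain ⟨φ, hφ⟩ := Q.exists_functional p hpu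
  obtain ⟨f, hf⟩ := exists_action hpu
  -- Equality of `q γ` and `q γ'` gives this, so the reflection in `u` sends `γ` to `γ + u = γ'`. It
  -- also shows that `q u` has denominator `p`, even for `p = 2`, where `q` may have denominator
  -- `4`.
  have hqu : Q.q u = -Q.b γ u := by
    rw [hudef, Q.q_sub, map_sub, Q.b_self, ← hq, two_nsmul, Q.b_comm γ' γ]; abel
  have hc : ZMod.toAddCircle (-φ γ) = Q.q u := by rw [map_neg, hφ, hqu]
  set c := -φ γ with hcdef
  have hc0 : c ≠ 0 := fun h => hu (by rw [← hc, h, map_zero])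
  -- The reflection `x ↦ x - (b(x, u) / q(u)) u`, with the quotient taken in `ℤ / p`; no division by
  -- `2` occurs.
  let g : A →+ A := AddMonoidHom.id A + f.comp ((AddMonoidHom.mulLeft (-c⁻¹)).comp φ)
  have hg : ∀ x, g x = x + f (-c⁻¹ * φ x) := fun x => rfl
  obtain ⟨σ, hσ, hσg⟩ := Q.exists_aut g fun x => by
    rw [hg, Q.q_add, Q.b_action hf hφ, Q.q_action hf hc, add_assoc, ← map_add]
    rw [show (-c⁻¹ * φ x) ^ 2 * c + -c⁻¹ * φ x * φ x = 0 by field_simp; ring, map_zero, add_zero]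
  refine ⟨σ, hσ, fun x hx => ?_, ?_⟩
  · rw [hσg, hg, hom_eq_zero_of_coprime hd φ hx, mul_zero, map_zero, add_zero]
  · rw [hσg, hg, show φ γ = -c by rw [hcdef, neg_neg], neg_mul_neg, inv_mul_cancel₀ hc0]
    have := hf 1
    rw [Int.cast_one, one_smul] at this
    rw [this, hudef]; abel

/-- Both `p²` and `2p` annihilate `q x`, and their greatest common divisor is `p`. -/
theorem nsmul_q_of_odd (hp : p ≠ 2) {x : A} (hx : p • x = 0) : p • Q.q x = 0 := by
  have h1 : p ^ 2 • Q.q x = 0 := by rw [← q_nsmul, hx, q_zero]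
  have h2 : (p * 2) • Q.q x = 0 := by
    rw [mul_nsmul', ← b_self, ← map_nsmul, hx, map_zero]
  have h3 := Nat.dvd_gcd (addOrderOf_dvd_of_nsmul_eq_zero h1) (addOrderOf_dvd_of_nsmul_eq_zero h2)
  rw [sq, Nat.gcd_mul_left,
    (Nat.coprime_primes (Fact.out : p.Prime) Nat.prime_two).mpr hp, mul_one] at h3
  exact addOrderOf_dvd_iff_nsmul_eq_zero.mp h3

/-- Transitivity of the orthogonal group for odd primes. -/
theorem conj_of_odd [Finite A] (hp : p ≠ 2) (hd : p.Coprime d) (hA : ∀ x : A, (p * d) • x = 0)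
    {γ γ' : A} (hγ : p • γ = 0) (hγ' : p • γ' = 0) (h0 : γ ≠ 0) (h0' : γ' ≠ 0)
    (hq : Q.q γ = Q.q γ') : Q.Conj d γ γ' := by
  by_cases hu : Q.q (γ' - γ) = 0
  swap
  · exact Q.conj_of_q_sub_ne_zero hd hγ hγ' hq hu
  have hb : Q.b γ γ' = 2 • Q.q γ := by
    rw [Q.q_sub, ← hq, ← two_nsmul, sub_eq_zero] at hu
    rw [Q.b_comm, hu]
  have hn : p • (-γ) = 0 := by rw [smul_neg, hγ, neg_zero]
  have htors : ∀ {t : UnitAddCircle}, p • t = 0 → 4 • t = 0 → t = 0 := by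
    intro t h1 h2
    have h3 := Nat.dvd_gcd (addOrderOf_dvd_of_nsmul_eq_zero h1) (addOrderOf_dvd_of_nsmul_eq_zero h2)
    have : Nat.Coprime p 4 := by
      rw [show 4 = 2 ^ 2 by norm_num]
      exact Nat.Coprime.pow_right 2 ((Nat.coprime_primes (Fact.out : p.Prime) Nat.prime_two).mpr hp)
    rw [this] at h3
    exact AddMonoid.addOrderOf_eq_one_iff.mp (Nat.dvd_one.mp h3)
  by_cases hq0 : Q.q γ = 0
  · -- both isotropic: pass through an isotropic vector orthogonal to neither
    have hexists : ∀ {x : A}, p • x = 0 → x ≠ 0 → ∃ y, p • y = 0 ∧ Q.b x y ≠ 0 := by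
      intro x hx hx0
      by_contra h
      push Not at h
      refine hx0 (Q.nondeg x fun y => ?_)
      have h1 := h (d • y) (by rw [← mul_nsmul', hA])
      have h2 : p • Q.b x y = 0 := by rw [← AddMonoidHom.nsmul_apply, ← map_nsmul, hx]; simp
      rw [map_nsmul] at h1
      have h3 := Nat.dvd_gcd (addOrderOf_dvd_of_nsmul_eq_zero h2)
        (addOrderOf_dvd_of_nsmul_eq_zero h1)
      rw [hd] at h3
      exact AddMonoid.addOrderOf_eq_one_iff.mp (Nat.dvd_one.mp h3)
    obtain ⟨δ, hpδ, hδ, hδ'⟩ : ∃ δ, p • δ = 0 ∧ Q.b γ δ ≠ 0 ∧ Q.b γ' δ ≠ 0 := by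
      obtain ⟨x, hx, hx1⟩ := hexists hγ h0
      obtain ⟨y, hy, hy1⟩ := hexists hγ' h0'
      by_cases hx2 : Q.b γ' x = 0
      · by_cases hy2 : Q.b γ y = 0
        · refine ⟨x + y, by rw [nsmul_add, hx, hy, add_zero], ?_, ?_⟩
          · rwa [map_add, hy2, add_zero]
          · rwa [map_add, hx2, zero_add]
        · exact ⟨y, hy, hy2, hy1⟩
      · exact ⟨x, hx, hx1, hx2⟩
    obtain ⟨φ, hφ⟩ := Q.exists_functional p hγ
    obtain ⟨f, hf⟩ := exists_action hγ
    obtain ⟨c, hc⟩ := exists_toAddCircle_eq (Q.nsmul_q_of_odd hp hpδ)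
    have hφδ : φ δ ≠ 0 := fun h => hδ (by rw [Q.b_comm, ← hφ, h, map_zero])
    obtain ⟨φ', hφ'⟩ := Q.exists_functional p hγ'
    -- A multiple of the isotropic `γ` is added to make `δ` isotropic. Since `γ` is orthogonal to
    -- `γ` and `γ'`, the nonzero pairings with both survive, and two reflections lead from `γ`
    -- through `ε` to `γ'`.
    set ε := δ + f (-c / φ δ) with hε
    have hqε : Q.q ε = 0 := by
      rw [hε, Q.q_add, Q.b_action hf hφ, Q.q_action hf (c := 0) (by rw [map_zero, hq0]), ← hc,
        ← map_add, ← map_add]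
      rw [show c + (-c / φ δ) ^ 2 * 0 + -c / φ δ * φ δ = 0 by field_simp; ring, map_zero]
    have hpε : p • ε = 0 := by rw [hε, nsmul_add, hpδ, ← map_nsmul]; simp
    have hγγ : Q.b γ γ = 0 := by rw [b_self, hq0, smul_zero]
    have hγγ' : Q.b γ' γ = 0 := by rw [Q.b_comm, hb, hq0, smul_zero]
    have hb1 : Q.b γ ε ≠ 0 := by
      rw [hε, map_add, Q.b_action hf hφ, (ZMod.toAddCircle_injective p).eq_iff.mp
        ((hφ γ).trans (hγγ.trans (map_zero _).symm)), mul_zero, map_zero, add_zero]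
      exact hδ
    have hb2 : Q.b γ' ε ≠ 0 := by
      rw [hε, map_add, Q.b_action hf hφ, (ZMod.toAddCircle_injective p).eq_iff.mp
        ((hφ γ').trans (hγγ'.trans (map_zero _).symm)), mul_zero, map_zero, add_zero]
      exact hδ'
    refine (Q.conj_of_q_sub_ne_zero hd hγ hpε (by rw [hq0, hqε]) ?_).trans
      (Q.conj_of_q_sub_ne_zero hd hpε hγ' (by rw [← hq, hq0, hqε]) ?_)
    · rw [Q.q_sub, hq0, hqε, add_zero, zero_sub, Q.b_comm]; exact neg_ne_zero.mpr hb1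
    · rw [Q.q_sub, ← hq, hq0, hqε, add_zero, zero_sub]; exact neg_ne_zero.mpr hb2
  -- In the anisotropic case the path goes through `-γ`: both `-γ - γ` and `γ' + γ` have norm `4
  -- q(γ)`.
  · have h4 : 4 • Q.q γ ≠ 0 := fun h => hq0 (htors (Q.nsmul_q_of_odd hp hγ) h)
    refine (Q.conj_of_q_sub_ne_zero hd hγ hn (Q.q_neg γ).symm ?_).trans
      (Q.conj_of_q_sub_ne_zero hd hn hγ' (by rw [Q.q_neg, hq]) ?_)
    · rw [show -γ - γ = -(2 • γ) by rw [two_nsmul]; abel, Q.q_neg, q_nsmul]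
      exact h4
    · rw [sub_neg_eq_add, Q.q_add, ← hq, Q.b_comm, hb, ← two_nsmul, ← add_nsmul]
      exact h4

end prime

/-! ### Siegel transformations on the `2`-torsion. -/

section two

variable [Finite A] {d : ℕ} {γ₀ : A}

/-- Conjugation by a Siegel transformation, for `p = 2`. -/
theorem conj_of_siegel (hd : Nat.Coprime 2 d) {γ u w : A} (hu : 2 • u = 0) (hw : 2 • w = 0)
    (hqu : Q.q u = 0) (hqw : 2 • Q.q w = 0) (huw : Q.b u w = 0) (hγu : Q.b γ u = 0)
    (hγw : Q.b γ w ≠ 0) : Q.Conj d γ (γ + u) := by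
  obtain ⟨φ, hφ⟩ := Q.exists_functional 2 hu
  obtain ⟨ψ, hψ⟩ := Q.exists_functional 2 hw
  obtain ⟨f, hf⟩ := exists_action (p := 2) hu
  obtain ⟨g, hg⟩ := exists_action (p := 2) hw
  obtain ⟨c, hc⟩ := exists_toAddCircle_eq hqw
  have inj := ZMod.toAddCircle_injective 2
  -- The Siegel transformation `x ↦ x + (b(x, w) + q(w) b(x, u)) u + b(x, u) w`; signs are
  -- irrelevant modulo `2`. The condition `2 q(w) = 0` allows `q(w)` to be read as a scalar in `ℤ /
  -- 2`.
  let h : A →+ A := AddMonoidHom.id A + f.comp (ψ + (AddMonoidHom.mulLeft c).comp φ) + g.comp φ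
  have hh : ∀ x, h x = x + f (ψ x + c * φ x) + g (φ x) := fun x => rfl
  have hψu : ψ u = 0 := inj (by rw [hψ, huw, map_zero])
  have hψf : ∀ k, ψ (f k) = 0 := by
    intro k
    obtain ⟨k, rfl⟩ := ZMod.intCast_surjective k
    rw [hf, map_zsmul, hψu, smul_zero]
  have h2 : ∀ k : ZMod 2, 2 * k = 0 := by decide
  obtain ⟨σ, hσ, hσh⟩ := Q.exists_aut h fun x => by
    rw [hh, Q.q_add, Q.q_add, Q.b_action hf hφ, Q.q_action hf (c := 0) (by rw [map_zero, hqu]),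
      Q.b_action hg hψ, Q.q_action hg hc, map_add, hψf, add_zero, add_assoc, add_assoc, add_assoc,
      ← map_add, ← map_add, ← map_add]
    rw [show (ψ x + c * φ x) ^ 2 * 0 + ((ψ x + c * φ x) * φ x + (φ x ^ 2 * c + φ x * ψ x)) =
      2 * (φ x ^ 2 * c + φ x * ψ x) by ring, h2, map_zero, add_zero]
  refine ⟨σ, hσ, fun x hx => ?_, ?_⟩
  · rw [hσh, hh, hom_eq_zero_of_coprime hd φ hx, hom_eq_zero_of_coprime hd ψ hx]
    simp
  · have hφγ : φ γ = 0 := inj (by rw [hφ, hγu, map_zero])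
    have hψγ : ψ γ = 1 := by
      have h1 : ψ γ ≠ 0 := fun h => hγw (by rw [← hψ, h, map_zero])
      generalize ψ γ = k at *
      revert k; decide
    have := hf 1
    rw [Int.cast_one, one_smul] at this
    rw [hσh, hh, hφγ, hψγ, mul_zero, add_zero, map_zero, add_zero, this]

end two

/-! ### Character orthogonality and annihilators. -/

section annihilator

variable [Fintype A]

theorem sum_e_b (x : A) [Decidable (x = 0)] :
    ∑ y, e (Q.b x y) = if x = 0 then (Fintype.card A : ℂ) else 0 := by
  split_ifs with h
  · simp [h, e_zero]
  · exact sum_e_hom (Q.b x) fun h' => h (Q.nondeg x fun y => by rw [h']; rfl)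

/-- Every homomorphism to `ℝ / ℤ` is represented by the form. -/
theorem exists_b_eq (φ : A →+ UnitAddCircle) : ∃ x, ∀ y, Q.b x y = φ y := by
  classical
  by_contra h
  push Not at h
  have h1 : ∑ x, ∑ y, e (Q.b x y) * e (-φ y) = 0 := by
    refine Finset.sum_eq_zero fun x _ => ?_
    have := sum_e_hom (Q.b x - φ) fun h' => by
      obtain ⟨y, hy⟩ := h x
      exact hy (sub_eq_zero.mp (DFunLike.congr_fun h' y))
    rw [← this]
    exact Finset.sum_congr rfl fun y _ => by
      rw [← e_add, AddMonoidHom.sub_apply, sub_eq_add_neg]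
  rw [Finset.sum_comm] at h1
  simp only [← Finset.sum_mul] at h1
  have h2 : ∀ y, ∑ x, e (Q.b x y) = if y = 0 then (Fintype.card A : ℂ) else 0 := fun y => by
    rw [← Q.sum_e_b y]
    exact Finset.sum_congr rfl fun x _ => by rw [Q.b_comm]
  simp only [h2, ite_mul, zero_mul, Finset.sum_ite_eq', Finset.mem_univ, if_true, map_zero, neg_zero,
    e_zero, mul_one, Nat.cast_eq_zero, Fintype.card_ne_zero] at h1

/-- Double annihilator property: an element outside of `H` is detected by the annihilator of `H`. -/
theorem exists_annihilator (H : AddSubgroup A) {γ : A} (hγ : γ ∉ H) :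
    ∃ w, (∀ h ∈ H, Q.b w h = 0) ∧ Q.b w γ ≠ 0 := by
  classical
  by_contra hcon
  push Not at hcon
  -- sum of `e(b(w, γ)) e(-b(w, h))` over all `w` and `h ∈ H`
  have h1 : ∑ w : A, ∑ h : H, e (Q.b w (γ - h)) = 0 := by
    rw [Finset.sum_comm]
    refine Finset.sum_eq_zero fun h _ => ?_
    have : γ - h ≠ 0 := fun h' => hγ (by rw [sub_eq_zero.mp h']; exact h.2)
    have h2 := Q.sum_e_b (γ - h)
    rw [if_neg this] at h2
    rw [← h2]
    exact Finset.sum_congr rfl fun x _ => by rw [Q.b_comm]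
  have h2 : ∀ w : A, ∑ h : H, e (Q.b w (γ - h)) =
      if ∀ h ∈ H, Q.b w h = 0 then (Fintype.card H : ℂ) else 0 := by
    intro w
    split_ifs with hw
    · have : ∀ h : H, e (Q.b w (γ - h)) = 1 := fun h => by
        rw [map_sub, hcon w hw, hw h h.2, sub_zero, e_zero]
      simp only [this, Finset.sum_const, Finset.card_univ, nsmul_eq_mul, mul_one]
    · have := sum_e_hom (-((Q.b w).comp H.subtype)) fun h' => hw fun h hh => by
        have := DFunLike.congr_fun h' ⟨h, hh⟩
        simpa using this
      have h3 : ∀ h : H, e (Q.b w (γ - h)) =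
          e (Q.b w γ) * e ((-(Q.b w).comp H.subtype) h) := fun h => by
        rw [← e_add, map_sub, sub_eq_add_neg]; rfl
      rw [Finset.sum_congr rfl fun h _ => h3 h, ← Finset.mul_sum, this, mul_zero]
  simp only [h2] at h1
  rw [Finset.sum_ite, Finset.sum_const_zero, add_zero, Finset.sum_const, nsmul_eq_mul,
    ← Nat.cast_mul, Nat.cast_eq_zero, mul_eq_zero, Finset.card_eq_zero] at h1
  rcases h1 with h1 | h1
  · have : (0 : A) ∈ ({w | ∀ h ∈ H, Q.b w h = 0} : Finset A) := by simp
    rw [h1] at this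
    simp at this
  · exact Fintype.card_ne_zero h1

end annihilator

/-- Transitivity of the orthogonal group for `p = 2`, away from `0` and the characteristic
vector. -/
theorem conj_of_two [Fintype A] {d : ℕ} (hd : Nat.Coprime 2 d) (hA : ∀ x : A, (2 * d) • x = 0)
    {γ₀ γ γ' : A} (hγ₀ : 2 • γ₀ = 0) (hchar : ∀ x : A, 2 • x = 0 → Q.b γ₀ x = 2 • Q.q x)
    (hγ : 2 • γ = 0) (hγ' : 2 • γ' = 0) (h0 : γ ≠ 0) (h0' : γ' ≠ 0)
    (h1 : γ ≠ γ₀) (h1' : γ' ≠ γ₀) (hq : Q.q γ = Q.q γ') : Q.Conj d γ γ' := by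
  have : Fact (Nat.Prime 2) := ⟨Nat.prime_two⟩
  by_cases hu : Q.q (γ' - γ) = 0
  swap
  · exact Q.conj_of_q_sub_ne_zero hd hγ hγ' hq hu
  have hneg : ∀ {x : A}, 2 • x = 0 → -x = x := fun {x} hx => by
    rw [two_nsmul] at hx; exact neg_eq_of_add_eq_zero_left hx
  set u := γ' - γ with hudef
  have hpu : 2 • u = 0 := by rw [hudef, nsmul_sub, hγ, hγ', sub_zero]
  have hγu : Q.b γ u = 0 := by
    have : Q.q u = -Q.b γ u := by
      rw [hudef, Q.q_sub, map_sub, Q.b_self, ← hq, two_nsmul, Q.b_comm γ' γ]; abel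
    rw [hu] at this
    exact neg_eq_zero.mp this.symm
  -- The Siegel transformation requires `w` orthogonal to `u` and to `γ₀`, the latter because `b(γ₀,
  -- w) = 2 q(w)`, but not to `γ`. The four elements `0`, `γ₀`, `u`, `u + γ₀` of the span equal `γ`
  -- only if `γ` or `γ'` is `0` or `γ₀`.
  have hnot : γ ∉ AddSubgroup.closure {u, γ₀} := by
    intro hmem
    obtain ⟨m, n, hmn⟩ := AddSubgroup.mem_closure_pair.mp hmem
    have hz : ∀ {x : A}, 2 • x = 0 → ∀ k : ℤ, k • x = 0 ∨ k • x = x := by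
      intro x hx k
      have hx' : (2 : ℤ) • x = 0 := by exact_mod_cast hx
      rcases Int.even_or_odd' k with ⟨j, rfl | rfl⟩
      · left; rw [mul_comm, mul_smul, hx', smul_zero]
      · right; rw [add_smul, mul_comm, mul_smul, hx', smul_zero, zero_add, one_smul]
    rcases hz hpu m with hm | hm <;> rcases hz hγ₀ n with hn | hn <;> rw [hm, hn] at hmn
    · exact h0 (by rw [← hmn, add_zero])
    · exact h1 (by rw [← hmn, zero_add])
    · rw [add_zero, hudef, sub_eq_iff_eq_add, ← two_nsmul, hγ] at hmn
      exact h0' hmn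
    · rw [hudef, sub_add_eq_add_sub, sub_eq_iff_eq_add, ← two_nsmul, hγ] at hmn
      exact h1' (by rw [← hneg hγ₀]; exact eq_neg_of_add_eq_zero_left hmn)
  obtain ⟨w, hw, hwγ⟩ := Q.exists_annihilator _ hnot
  have hwu : Q.b w u = 0 := hw u (AddSubgroup.subset_closure (by simp))
  have hw0 : Q.b w γ₀ = 0 := hw γ₀ (AddSubgroup.subset_closure (by simp))
  -- Multiplication by the odd number `d` pushes `w` into the `2`-torsion without changing its
  -- pairings with `2`-torsion.
  have hbd : ∀ {x : A}, 2 • x = 0 → Q.b (d • w) x = Q.b w x := by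
    intro x hx
    obtain ⟨j, hj⟩ := (Nat.coprime_two_left.mp hd)
    rw [map_nsmul, AddMonoidHom.nsmul_apply, ← map_nsmul, hj, add_nsmul, mul_comm, mul_nsmul', hx,
      smul_zero, zero_add, one_nsmul]
  have hdw : 2 • d • w = 0 := by rw [← mul_nsmul', hA]
  have := Q.conj_of_siegel hd (γ := γ) (w := d • w) hpu hdw hu
    (by rw [← hchar _ hdw, Q.b_comm, hbd hγ₀, hw0]) (by rw [Q.b_comm, hbd hpu, hwu]) hγu
    (by rw [Q.b_comm, hbd hγ]; exact hwγ)
  rwa [hudef, add_sub_cancel] at this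

/-! ### Invariant vectors are detected by their coefficients at zero -/

section detect

variable [Fintype A]

/-- The convolution kernel of `S⁻¹ Tⁿ S` in the Weil representation. -/
def kernel (n : ℕ) (x : A) : ℂ :=
  (Fintype.card A : ℂ)⁻¹ * ∑ y, e (n • Q.q y + Q.b x y)

/-- Summing over `x` first leaves only `y = 0`. Total mass one is what later prevents the localised
kernel from vanishing. -/
theorem sum_kernel (n : ℕ) : ∑ x, Q.kernel n x = 1 := by
  classical
  have h2 : ∀ y, ∑ x, e (Q.b x y) = if y = 0 then (Fintype.card A : ℂ) else 0 := fun y => by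
    rw [← Q.sum_e_b y]
    exact Finset.sum_congr rfl fun x _ => by rw [Q.b_comm]
  simp only [kernel, ← Finset.mul_sum]
  rw [Finset.sum_comm]
  simp only [e_add, ← Finset.mul_sum, h2]
  simp [q_zero, e_zero]

variable {p d m : ℕ}

/-- Completing the square: `m` acts as `1` on the `p`-part, so the substitution `y ↦ y + x` absorbs
the linear term. -/
theorem kernel_of_mem (hm1 : ∀ x : A, p • x = 0 → m • x = x ∧ m • Q.q x = Q.q x) {x : A}
    (hx : p • x = 0) : Q.kernel m x = e (-Q.q x) * Q.kernel m 0 := by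
  have h : ∀ y, e (m • Q.q (y + x) + Q.b 0 (y + x)) * e (-Q.q x) = e (m • Q.q y + Q.b x y) := by
    intro y
    rw [← e_add]
    congr 1
    rw [Q.q_add, smul_add, smul_add, (hm1 x hx).2, ← map_nsmul (Q.b y), (hm1 x hx).1, Q.b_comm y x,
      map_zero, AddMonoidHom.zero_apply]
    abel
  simp only [kernel, ← h]
  have := Equiv.sum_comp (Equiv.addRight x) fun y => e (m • Q.q y + Q.b 0 y)
  simp only [Equiv.coe_addRight] at this
  rw [← Finset.sum_mul, this]
  ring

/-- Translation of `y` by an element `z` of the `d`-part leaves `m q(y)` unchanged, since `m` acts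
there as `0`. The sum thereby equals itself times `e(b(x, z)) ≠ 1`. Hence `S⁻¹ Tᵐ S` convolves along
the `p`-part only. -/
theorem kernel_of_not_mem (hA : ∀ x : A, (p * d) • x = 0)
    (hm0 : ∀ x : A, d • x = 0 → m • x = 0 ∧ m • Q.q x = 0) {x : A}
    (hx : p • x ≠ 0) : Q.kernel m x = 0 := by
  obtain ⟨y, hy⟩ : ∃ y, Q.b (p • x) y ≠ 0 := by
    by_contra h; push Not at h; exact hx (Q.nondeg _ h)
  have hy' : Q.b x (p • y) ≠ 0 := by
    rwa [map_nsmul, ← AddMonoidHom.nsmul_apply, ← map_nsmul]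
  have hdy : d • p • y = 0 := by rw [← mul_nsmul', mul_comm, hA]
  set z := p • y
  have h : ∀ y, e (m • Q.q (y + z) + Q.b x (y + z)) = e (Q.b x z) * e (m • Q.q y + Q.b x y) := by
    intro y
    rw [← e_add]
    congr 1
    rw [Q.q_add, smul_add, smul_add, (hm0 z hdy).2, ← map_nsmul (Q.b y), (hm0 z hdy).1, map_zero,
      map_add]
    abel
  have h1 : ∑ y, e (m • Q.q y + Q.b x y) = e (Q.b x z) * ∑ y, e (m • Q.q y + Q.b x y) := by
    conv_lhs => rw [← Equiv.sum_comp (Equiv.addRight z)]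
    rw [Finset.mul_sum]
    exact Finset.sum_congr rfl fun y _ => h y
  have h2 : (e (Q.b x z) - 1) * ∑ y, e (m • Q.q y + Q.b x y) = 0 := by rw [sub_mul, ← h1]; ring
  rw [kernel, (mul_eq_zero.mp h2).resolve_left fun h => hy' (e_eq_one_iff.mp (sub_eq_zero.mp h)),
    mul_zero]

theorem kernel_zero_ne_zero (hA : ∀ x : A, (p * d) • x = 0)
    (hm1 : ∀ x : A, p • x = 0 → m • x = x ∧ m • Q.q x = Q.q x)
    (hm0 : ∀ x : A, d • x = 0 → m • x = 0 ∧ m • Q.q x = 0) : Q.kernel m 0 ≠ 0 := by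
  intro h
  have : ∑ x, Q.kernel m x = 0 := Finset.sum_eq_zero fun x _ => by
    by_cases hx : p • x = 0
    · rw [Q.kernel_of_mem hm1 hx, h, mul_zero]
    · exact Q.kernel_of_not_mem hA hm0 hx
  rw [Q.sum_kernel] at this
  exact one_ne_zero this

variable {K : Set (A → ℂ)}

/-- The coefficients over a coset of the `p`-part sum to zero over each level set of `q`. -/
theorem sum_levelSet_eq_zero (hA : ∀ x : A, (p * d) • x = 0) (hp : 0 < p)
    (hm1 : ∀ x : A, p • x = 0 → m • x = x ∧ m • Q.q x = Q.q x)
    (hm0 : ∀ x : A, d • x = 0 → m • x = 0 ∧ m • Q.q x = 0)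
    (hT : ∀ w ∈ K, ∀ n : ℕ, (fun x => e (n • Q.q x) * w x) ∈ K)
    (hX : ∀ w ∈ K, ∀ n : ℕ, (fun x => ∑ y, Q.kernel n (x - y) * w y) ∈ K)
    {γ : A} (hγ : d • γ = 0) (h0 : ∀ w ∈ K, w γ = 0) {w : A → ℂ} (hw : w ∈ K)
    (t : UnitAddCircle) [DecidablePred fun z : A => p • z = 0 ∧ Q.q z = t] :
    ∑ z with p • z = 0 ∧ Q.q z = t, w (γ + z) = 0 := by
  classical
  have hκ := Q.kernel_zero_ne_zero hA hm1 hm0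
  -- The coefficient at `γ` of `S⁻¹ Tᵐ S T^{jm} w`. As `m` kills the contribution of `γ`, the power
  -- of `T` multiplies the coefficient at `γ + z` by `e(j q(z))`.
  have h1 : ∀ j : ℕ, ∑ z with p • z = 0, e (-Q.q z) * e (j • Q.q z) * w (γ + z) = 0 := by
    intro j
    have h2 := h0 _ (hX _ (hT w hw (j * m)) m)
    rw [← Equiv.sum_comp (Equiv.addLeft γ)] at h2
    simp only [Equiv.coe_addLeft, sub_add_cancel_left] at h2
    have h3 : ∀ z, Q.kernel m (-z) * (e ((j * m) • Q.q (γ + z)) * w (γ + z)) =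
        if p • z = 0 then
          Q.kernel m 0 * (e (-Q.q z) * e (j • Q.q z) * w (γ + z)) else 0 := by
      intro z
      split_ifs with hz
      · rw [Q.kernel_of_mem hm1 (by rw [smul_neg, hz, neg_zero]), Q.q_neg]
        have : (j * m) • Q.q (γ + z) = j • Q.q z := by
          have h4 : m • Q.q (γ + z) = Q.q z := by
            rw [Q.q_add, smul_add, smul_add, (hm0 γ hγ).2, (hm1 z hz).2, Q.b_comm,
              ← map_nsmul, (hm0 γ hγ).1, map_zero, zero_add, add_zero]
          rw [mul_nsmul', h4]
        rw [this]; ring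
      · rw [Q.kernel_of_not_mem hA hm0 (by rwa [smul_neg, neg_ne_zero]), zero_mul]
    simp only [h3] at h2
    rw [← Finset.sum_filter, ← Finset.mul_sum] at h2
    exact (mul_eq_zero.mp h2).resolve_left hκ
  -- Fourier inversion over `j` modulo `p²` isolates the level `t`; on `p`-torsion `q` has
  -- denominator dividing `p²`.
  have h4 : ∑ j ∈ Finset.range (p ^ 2), e (-(j • t)) *
      ∑ z with p • z = 0, e (-Q.q z) * e (j • Q.q z) * w (γ + z) = 0 :=
    Finset.sum_eq_zero fun j _ => by rw [h1, mul_zero]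
  by_cases ht : p ^ 2 • t = 0
  swap
  · refine Finset.sum_eq_zero fun z hz => ?_
    obtain ⟨hz1, hz2⟩ := (Finset.mem_filter.mp hz).2
    exact absurd (by rw [← hz2, ← Q.q_nsmul, hz1, Q.q_zero]) ht
  simp only [Finset.mul_sum] at h4
  rw [Finset.sum_comm] at h4
  have h5 : ∀ z, p • z = 0 → ∑ j ∈ Finset.range (p ^ 2), e (-(j • t)) *
      (e (-Q.q z) * e (j • Q.q z) * w (γ + z)) =
      if Q.q z = t then ((p ^ 2 : ℕ) : ℂ) * e (-t) * w (γ + z) else 0 := by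
    intro z hz
    have hz2 : p ^ 2 • (Q.q z - t) = 0 := by
      rw [nsmul_sub, ht, ← Q.q_nsmul, hz, Q.q_zero, sub_zero]
    have h6 := sum_range_e_nsmul hz2
    have h7 : ∀ j : ℕ, e (-(j • t)) * (e (-Q.q z) * e (j • Q.q z) * w (γ + z)) =
        e (j • (Q.q z - t)) * (e (-Q.q z) * w (γ + z)) := fun j => by
      rw [nsmul_sub, sub_eq_add_neg, e_add]; ring
    simp only [h7]
    rw [← Finset.sum_mul, h6]
    by_cases hzt : Q.q z = t
    · rw [if_pos (sub_eq_zero.mpr hzt), if_pos hzt, hzt]; ring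
    · rw [if_neg (sub_ne_zero.mpr hzt), if_neg hzt, zero_mul]
  rw [Finset.sum_congr rfl fun z hz => h5 z (Finset.mem_filter.mp hz).2, ← Finset.sum_filter,
    ← Finset.mul_sum, Finset.filter_filter] at h4
  have hne : ((p ^ 2 : ℕ) : ℂ) * e (-t) ≠ 0 :=
    mul_ne_zero (by exact_mod_cast (pow_pos hp 2).ne') (e_ne_zero _)
  convert (mul_eq_zero.mp h4).resolve_left hne

/-- A characteristic vector of the `2`-part, and the shift by it. -/
theorem exists_characteristic (hA : ∀ x : A, (2 * d) • x = 0)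
    (hm1 : ∀ x : A, 2 • x = 0 → m • x = x ∧ m • Q.q x = Q.q x)
    (hm0 : ∀ x : A, d • x = 0 → m • x = 0 ∧ m • Q.q x = 0) :
    ∃ γ₀ : A, 2 • γ₀ = 0 ∧ (∀ x : A, 2 • x = 0 → Q.b γ₀ x = 2 • Q.q x) ∧
      ∀ (w : A → ℂ) (x : A), ∑ y, Q.kernel (2 * m) (x - y) * w y = w (x + γ₀) := by
  classical
  have h2m : ∀ x : A, (2 * m) • x = 0 := by
    intro x
    rw [mul_comm, mul_nsmul']
    refine (hm0 (2 • x) ?_).1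
    rw [← mul_nsmul', mul_comm, hA]
  -- As `2m` annihilates `A`, the map `(2m) q` is additive and hence represented by some `γ₀`. The
  -- kernel for `2m` is then the delta function at `γ₀`.
  obtain ⟨γ₀, hγ₀⟩ := Q.exists_b_eq (AddMonoidHom.mk' (fun x => (2 * m) • Q.q x) fun x y => by
    rw [Q.q_add, smul_add, smul_add, ← map_nsmul, h2m, map_zero, add_zero])
  simp only [AddMonoidHom.mk'_apply] at hγ₀
  have h2 : 2 • γ₀ = 0 := by
    refine Q.nondeg _ fun y => ?_
    rw [map_nsmul, AddMonoidHom.nsmul_apply, hγ₀, mul_comm, mul_nsmul', ← Q.b_self, ← mul_nsmul',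
      ← map_nsmul, h2m, map_zero]
  refine ⟨γ₀, h2, fun x hx => ?_, fun w x => ?_⟩
  · rw [hγ₀, mul_nsmul', (hm1 x hx).2]
  · have hk : ∀ z, Q.kernel (2 * m) z = if z = γ₀ then 1 else 0 := by
      intro z
      have : ∀ y, (2 * m) • Q.q y + Q.b z y = Q.b (γ₀ + z) y := fun y => by
        rw [map_add, AddMonoidHom.add_apply, hγ₀]
      simp only [kernel, this, Q.sum_e_b]
      have hiff : γ₀ + z = 0 ↔ z = γ₀ := by
        rw [two_nsmul] at h2
        constructor
        · intro h; exact (add_left_cancel (h.trans h2.symm))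
        · rintro rfl; exact h2
      simp only [hiff]
      split_ifs <;> simp
    rw [Finset.sum_eq_single (x + γ₀)]
    · rw [hk, sub_add_cancel_left, if_pos, one_mul]
      rw [two_nsmul] at h2
      exact neg_eq_of_add_eq_zero_left h2
    · intro y _ hy
      rw [hk, if_neg, zero_mul]
      rintro rfl
      rw [two_nsmul] at h2
      apply hy
      have : x - y + (x - y) = 0 := h2
      rw [← sub_eq_zero, show y - (x + (x - y)) = -(x - y + (x - y)) by abel, this, neg_zero]
    · simp

/-- Automorphisms fixing the `d`-torsion fix `γ`, so by transitivity `w (γ + z)` takes one value for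
all `z` in the level set of `δ` other than `0` and `γ₀`, where it vanishes. The sum over the level
set is zero, so that value times a positive count is zero. -/
theorem eq_zero_of_coset [Fact p.Prime] (hd : p.Coprime d) (hA : ∀ x : A, (p * d) • x = 0)
    (hm1 : ∀ x : A, p • x = 0 → m • x = x ∧ m • Q.q x = Q.q x)
    (hm0 : ∀ x : A, d • x = 0 → m • x = 0 ∧ m • Q.q x = 0)
    (hT : ∀ w ∈ K, ∀ n : ℕ, (fun x => e (n • Q.q x) * w x) ∈ K)
    (hX : ∀ w ∈ K, ∀ n : ℕ, (fun x => ∑ y, Q.kernel n (x - y) * w y) ∈ K)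
    (hinv : ∀ w ∈ K, ∀ σ ∈ Q.aut, ∀ x, w (σ x) = w x)
    {γ : A} (hγ : d • γ = 0) (h0 : ∀ w ∈ K, w γ = 0) {δ : A} (hδ : p • δ = 0)
    {w : A → ℂ} (hw : w ∈ K) : w (γ + δ) = 0 := by
  classical
  obtain ⟨γ₀, hw0, hconj⟩ : ∃ γ₀ : A, w (γ + γ₀) = 0 ∧ ∀ x y : A, p • x = 0 → p • y = 0 →
      x ≠ 0 → y ≠ 0 → x ≠ γ₀ → y ≠ γ₀ → Q.q x = Q.q y → Q.Conj d x y := by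
    by_cases hp : p = 2
    · subst hp
      obtain ⟨γ₀, h1, h2, h3⟩ := Q.exists_characteristic hA hm1 hm0
      refine ⟨γ₀, ?_, fun x y hx hy hx0 hy0 hx1 hy1 hq =>
        Q.conj_of_two hd hA h1 h2 hx hy hx0 hy0 hx1 hy1 hq⟩
      rw [← h3 w γ]
      exact h0 _ (hX w hw (2 * m))
    -- For odd `p` there is no exceptional vector besides `0`, and `γ₀ = 0` serves as a dummy.
    · exact ⟨0, by rw [add_zero]; exact h0 w hw, fun x y hx hy hx0 hy0 _ _ hq =>
        Q.conj_of_odd hp hd hA hx hy hx0 hy0 hq⟩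
  by_cases hδ0 : δ = 0
  · rw [hδ0, add_zero]; exact h0 w hw
  by_cases hδ1 : δ = γ₀
  · rw [hδ1]; exact hw0
  have hsum := Q.sum_levelSet_eq_zero hA (Fact.out : p.Prime).pos hm1 hm0 hT hX hγ h0 hw (Q.q δ)
  have hval : ∀ z : A, p • z = 0 ∧ Q.q z = Q.q δ →
      w (γ + z) = if z = 0 ∨ z = γ₀ then 0 else w (γ + δ) := by
    rintro z ⟨hz, hqz⟩
    split_ifs with h
    · rcases h with rfl | rfl
      · rw [add_zero]; exact h0 w hw
      · exact hw0
    · push Not at h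
      obtain ⟨σ, hσ, hσ', rfl⟩ := hconj δ z hδ hz hδ0 h.1 hδ1 h.2 hqz.symm
      rw [← hinv w hw σ hσ (γ + δ), map_add, hσ' γ hγ]
  rw [Finset.sum_congr rfl fun z hz => hval z (Finset.mem_filter.mp hz).2, Finset.sum_ite,
    Finset.sum_const_zero, zero_add, Finset.sum_const, nsmul_eq_mul] at hsum
  refine (mul_eq_zero.mp hsum).resolve_left ?_
  exact Nat.cast_ne_zero.mpr (Finset.card_ne_zero.mpr ⟨δ, by simp [hδ, hδ0, hδ1]⟩)

/-- A set of invariant vectors that is stable under the Weil representation and whose members have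
vanishing coefficient at `0` is trivial, if the module is annihilated by a squarefree integer. -/
theorem eq_zero_of_coeff_zero {n : ℕ} (hn : Squarefree n) (hA : ∀ x : A, n • x = 0)
    (hT : ∀ w ∈ K, ∀ n : ℕ, (fun x => e (n • Q.q x) * w x) ∈ K)
    (hX : ∀ w ∈ K, ∀ n : ℕ, (fun x => ∑ y, Q.kernel n (x - y) * w y) ∈ K)
    (hinv : ∀ w ∈ K, ∀ σ ∈ Q.aut, ∀ x, w (σ x) = w x)
    (h0 : ∀ w ∈ K, w 0 = 0) {w : A → ℂ} (hw : w ∈ K) : w = 0 := by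
  -- Induction on the primes of `c`: vanishing extends from the `a`-torsion to the `pa`-torsion, for
  -- all members of `K` at once.
  have key : ∀ c : ℕ, c ∣ n → ∀ x : A, c • x = 0 → ∀ w ∈ K, w x = 0 := by
    intro c
    induction c using induction_on_primes with
    | zero => intro h; exact absurd (zero_dvd_iff.mp h) hn.ne_zero
    | one => intro _ x hx w hw; rw [one_nsmul] at hx; rw [hx]; exact h0 w hw
    | prime_mul p a hp ih =>
      intro hpa x hx w hw
      have : Fact p.Prime := ⟨hp⟩
      obtain ⟨k, rfl⟩ := hpa
      have hcop : p.Coprime (a * k) := Nat.coprime_of_squarefree_mul (by rwa [← mul_assoc])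
      have hcop2 : (p ^ 2).Coprime ((a * k) ^ 2) := Nat.Coprime.pow 2 2 hcop
      -- The squares are there because `m` must act correctly on the values of `q` as well, whose
      -- denominators divide squares. Then `x = (x - m x) + m x` splits `x` into its parts of order
      -- prime to `p` and of order dividing `p`.
      obtain ⟨m, hm1, hm0⟩ := Nat.chineseRemainder hcop2 1 0
      have hA' : ∀ x : A, (p * (a * k)) • x = 0 := fun x => by rw [← mul_assoc]; exact hA x
      have hm0' : ∀ x : A, (a * k) • x = 0 → m • x = 0 ∧ m • Q.q x = 0 := by
        intro x hx
        obtain ⟨j, rfl⟩ := (Nat.modEq_zero_iff_dvd.mp hm0)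
        constructor
        · rw [show (a * k) ^ 2 * j = (a * k * j) * (a * k) by ring, mul_nsmul', hx, smul_zero]
        · rw [mul_comm, mul_nsmul', ← Q.q_nsmul, hx, Q.q_zero, smul_zero]
      have hmpos : 1 ≤ m ∨ p ^ 2 = 1 := by
        rcases Nat.eq_zero_or_pos m with rfl | h
        · right
          exact Nat.dvd_one.mp ((Nat.modEq_zero_iff_dvd).mp hm1.symm)
        · exact Or.inl h
      have hm : 1 ≤ m := hmpos.resolve_right (by
        have := hp.one_lt; intro h; nlinarith)
      obtain ⟨j, hj⟩ := (Nat.modEq_iff_dvd' hm).mp hm1.symm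
      have hmj : m = p ^ 2 * j + 1 := by omega
      have hm1' : ∀ x : A, p • x = 0 → m • x = x ∧ m • Q.q x = Q.q x := by
        intro x hx
        rw [hmj]
        constructor
        · rw [add_nsmul, one_nsmul, show p ^ 2 * j = (p * j) * p by ring, mul_nsmul', hx,
            smul_zero, zero_add]
        · rw [add_nsmul, one_nsmul, mul_comm, mul_nsmul', ← Q.q_nsmul, hx, Q.q_zero, smul_zero,
            zero_add]
      have hax : a • (x - m • x) = 0 := by
        rw [hmj, add_nsmul, one_nsmul, sub_add_cancel_right, smul_neg, ← mul_nsmul',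
          show a * (p ^ 2 * j) = (p * j) * (p * a) by ring, mul_nsmul', hx, smul_zero, neg_zero]
      have hpx : p • m • x = 0 := by
        rw [← mul_nsmul', mul_comm, mul_nsmul']
        refine (hm0' _ ?_).1
        rw [← mul_nsmul', mul_comm, hA']
      have := Q.eq_zero_of_coset hcop hA' hm1' hm0' hT hX hinv (γ := x - m • x) (δ := m • x)
        (by rw [mul_comm, mul_nsmul', hax, smul_zero])
        (fun w hw => ih (Dvd.intro_left p (by ring) |>.trans (dvd_mul_right (p * a) k)) _ hax w hw)
        hpx hw
      rwa [sub_add_cancel] at this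
  funext x
  exact key n dvd_rfl x (hA x) w hw

end detect

end QuadModule
end

noncomputable section

/-! ### Weil representations of finite quadratic modules -/

open EvenLattice

namespace QuadModule

variable {A : Type*} [AddCommGroup A] [Fintype A] (Q : QuadModule A)

/-- `ρ` is a Weil representation of `Q`, with `S` acting by the Fourier transform times `c`. -/
structure IsWeil (c : ℂ) (ρ : Representation ℂ Mp2Z (A → ℂ)) : Prop where
  T_apply : ∀ w x, ρ Mp2Z.T w x = e (Q.q x) * w x
  S_apply : ∀ w x, ρ Mp2Z.S w x = c * ∑ y, e (-(Q.b x y)) * w y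
  norm_sq : star c * c * Fintype.card A = 1

namespace IsWeil

variable {Q} {c : ℂ} {ρ : Representation ℂ Mp2Z (A → ℂ)}

theorem T_pow_apply (hρ : Q.IsWeil c ρ) (n : ℕ) (w : A → ℂ) (x : A) :
    ρ (Mp2Z.T ^ n) w x = e (n • Q.q x) * w x := by
  induction n generalizing x with
  | zero => simp [e_zero]
  | succ n ih =>
    rw [pow_succ', map_mul, Module.End.mul_apply, hρ.T_apply, ih, succ_nsmul', e_add, mul_assoc]

theorem S_inv_apply (hρ : Q.IsWeil c ρ) (w : A → ℂ) (x : A) :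
    ρ Mp2Z.S⁻¹ w x = star c * ∑ y, e (Q.b x y) * w y := by
  classical
  have key : ρ Mp2Z.S (fun x => star c * ∑ y, e (Q.b x y) * w y) = w := by
    funext x
    rw [hρ.S_apply]
    have h1 : ∀ y, e (-(Q.b x y)) * (star c * ∑ z, e (Q.b y z) * w z) =
        ∑ z, star c * (e (Q.b (z - x) y) * w z) := by
      intro y
      rw [Finset.mul_sum, Finset.mul_sum]
      refine Finset.sum_congr rfl fun z _ => ?_
      rw [map_sub, AddMonoidHom.sub_apply, sub_eq_add_neg, e_add, Q.b_comm z y]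
      ring
    simp only [h1]
    rw [Finset.sum_comm]
    simp only [← Finset.mul_sum, ← Finset.sum_mul, Q.sum_e_b, sub_eq_zero]
    simp only [ite_mul, zero_mul, Finset.sum_ite_eq', Finset.mem_univ, if_true]
    linear_combination (w x) * hρ.norm_sq
  have h2 : ρ Mp2Z.S⁻¹ (ρ Mp2Z.S (fun x => star c * ∑ y, e (Q.b x y) * w y)) =
      (fun x => star c * ∑ y, e (Q.b x y) * w y) := by
    rw [← Module.End.mul_apply, ← map_mul, inv_mul_cancel, map_one, Module.End.one_apply]
  rw [key] at h2
  rw [h2]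

theorem kernel_apply (hρ : Q.IsWeil c ρ) (n : ℕ) (w : A → ℂ) (x : A) :
    ρ (Mp2Z.S⁻¹ * Mp2Z.T ^ n * Mp2Z.S) w x = ∑ y, Q.kernel n (x - y) * w y := by
  have h1 : ∀ y, e (Q.b x y) * (e (n • Q.q y) * (c * ∑ z, e (-(Q.b y z)) * w z)) =
      ∑ z, c * (e (n • Q.q y + Q.b (x - z) y) * w z) := by
    intro y
    rw [Finset.mul_sum, Finset.mul_sum, Finset.mul_sum]
    refine Finset.sum_congr rfl fun z _ => ?_
    rw [map_sub, AddMonoidHom.sub_apply, sub_eq_add_neg, e_add, e_add, Q.b_comm z y]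
    ring
  rw [map_mul, map_mul, Module.End.mul_apply, Module.End.mul_apply, hρ.S_inv_apply]
  simp only [hρ.T_pow_apply, hρ.S_apply, h1]
  rw [Finset.sum_comm, Finset.mul_sum]
  refine Finset.sum_congr rfl fun z _ => ?_
  have hc : (Fintype.card A : ℂ)⁻¹ = star c * c := (eq_inv_of_mul_eq_one_left hρ.norm_sq).symm
  rw [kernel, hc, ← Finset.mul_sum, ← Finset.sum_mul]
  ring

theorem T_inv_apply (hρ : Q.IsWeil c ρ) (w : A → ℂ) (x : A) :
    ρ Mp2Z.T⁻¹ w x = e (-Q.q x) * w x := by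
  have h : w = ρ Mp2Z.T (ρ Mp2Z.T⁻¹ w) := by
    rw [← Module.End.mul_apply, ← map_mul, mul_inv_cancel, map_one, Module.End.one_apply]
  conv_rhs => rw [h]
  rw [hρ.T_apply, ← mul_assoc, ← e_add, neg_add_cancel, e_zero, one_mul]

/-- The Weil representation is unitary. -/
theorem star_dotProduct_apply (hρ : Q.IsWeil c ρ) (g : Mp2Z) (u w : A → ℂ) :
    star (ρ g u) ⬝ᵥ w = star u ⬝ᵥ ρ g⁻¹ w := by
  induction g using Mp2Z.induction_S_T generalizing u w with
  | h1 => simp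
  | hT =>
    simp only [dotProduct, Pi.star_apply, hρ.T_apply, hρ.T_inv_apply, star_mul', star_e]
    exact Finset.sum_congr rfl fun x _ => by ring
  | hS =>
    simp only [dotProduct, Pi.star_apply, hρ.S_apply, hρ.S_inv_apply, star_mul', star_sum, star_e,
      neg_neg, Finset.mul_sum, Finset.sum_mul]
    rw [Finset.sum_comm]
    refine Finset.sum_congr rfl fun x _ => Finset.sum_congr rfl fun y _ => ?_
    rw [Q.b_comm]; ring
  | hmul g h ihg ihh =>
    rw [map_mul, Module.End.mul_apply, ihg, ihh, mul_inv_rev, map_mul, Module.End.mul_apply]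

theorem comp_aut (hρ : Q.IsWeil c ρ) (g : Mp2Z) {w : A → ℂ}
    (hw : ∀ σ ∈ Q.aut, ∀ x, w (σ x) = w x) :
    ∀ σ ∈ Q.aut, ∀ x, ρ g w (σ x) = ρ g w x := by
  induction g using Mp2Z.induction_S_T generalizing w with
  | h1 => simpa using hw
  | hT =>
    intro σ hσ x
    rw [hρ.T_apply, hρ.T_apply, hw σ hσ, hσ x]
  | hS =>
    intro σ hσ x
    rw [hρ.S_apply, hρ.S_apply, ← Equiv.sum_comp σ.toEquiv]
    congr 1
    refine Finset.sum_congr rfl fun y _ => ?_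
    have hb : Q.b (σ x) (σ y) = Q.b x y := by
      have h1 := Q.q_add (σ x) (σ y)
      rw [← map_add, hσ, hσ, hσ, Q.q_add] at h1
      exact (add_left_cancel h1).symm
    change e (-(Q.b (σ x) (σ y))) * w (σ y) = _
    rw [hb, hw σ hσ]
  | hmul g h ihg ihh =>
    rw [map_mul, Module.End.mul_apply]
    exact ihg (ihh hw)

/-! ### Induction from a subgroup acting on `𝔢₀` by a character -/

section induction

variable [DecidableEq A] {Γ : Subgroup Mp2Z} {χ : Mp2Z → ℂ}

/-- Unitarity turns the eigenfunctional `w ↦ w 0` into the eigenvector `𝔢₀`. -/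
theorem inv_single (hρ : Q.IsWeil c ρ)
    (hrow : ∀ h ∈ Γ, ∀ w, ρ h w 0 = χ h * w 0) {h : Mp2Z} (hh : h ∈ Γ) :
    ρ h⁻¹ (Pi.single 0 1) = star (χ h) • Pi.single 0 1 := by
  refine star_injective (funext fun x => ?_)
  have h1 := hρ.star_dotProduct_apply h⁻¹ (Pi.single 0 1) (Pi.single x 1)
  rw [inv_inv, dotProduct_single, mul_one, Pi.star_single, star_one, single_dotProduct, one_mul,
    hrow h hh] at h1
  rw [h1]
  by_cases hx : x = 0
  · simp [hx]
  · simp [hx, Ne.symm hx]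

theorem star_char_mul (hρ : Q.IsWeil c ρ)
    (hrow : ∀ h ∈ Γ, ∀ w, ρ h w 0 = χ h * w 0) {h : Mp2Z} (hh : h ∈ Γ) : star (χ h) * χ h = 1 := by
  have h1 := hrow h hh (ρ h⁻¹ (Pi.single 0 1))
  rw [← Module.End.mul_apply, ← map_mul, mul_inv_cancel, map_one, Module.End.one_apply,
    hρ.inv_single hrow hh] at h1
  simpa [mul_comm] using h1.symm

/-- The factors `χ(h)` and its conjugate cancel, so the summand depends only on the coset `Γ g`. -/
theorem summand_eq (hρ : Q.IsWeil c ρ)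
    (hrow : ∀ h ∈ Γ, ∀ w, ρ h w 0 = χ h * w 0) {h : Mp2Z} (hh : h ∈ Γ) (g : Mp2Z)
    (w : A → ℂ) : ρ (h * g) w 0 • ρ (h * g)⁻¹ (Pi.single 0 1) =
      ρ g w 0 • ρ g⁻¹ (Pi.single 0 1) := by
  rw [mul_inv_rev, map_mul, map_mul, Module.End.mul_apply, Module.End.mul_apply, hrow h hh,
    hρ.inv_single hrow hh, map_smul, smul_smul]
  congr 1
  linear_combination ρ g w 0 * hρ.star_char_mul hrow hh

/-- The sum over right cosets of the projections to `ρ(g⁻¹) 𝔢₀` commutes with the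
representation. -/
theorem sum_summand_comm (hρ : Q.IsWeil c ρ)
    (hrow : ∀ h ∈ Γ, ∀ w, ρ h w 0 = χ h * w 0)
    [Fintype (Quotient (QuotientGroup.rightRel Γ))] (g : Mp2Z) (w : A → ℂ) :
    ∑ x : Quotient (QuotientGroup.rightRel Γ),
      ρ x.out (ρ g w) 0 • ρ x.out⁻¹ (Pi.single 0 1) =
    ρ g (∑ x : Quotient (QuotientGroup.rightRel Γ),
      ρ x.out w 0 • ρ x.out⁻¹ (Pi.single 0 1)) := by
  let t : Quotient (QuotientGroup.rightRel Γ) → A → ℂ :=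
    Quotient.lift (fun k : Mp2Z => ρ k w 0 • ρ k⁻¹ (Pi.single 0 1)) fun k k' hk => by
      have hk' : k' * k⁻¹ ∈ Γ := QuotientGroup.rightRel_apply.mp hk
      have := hρ.summand_eq hrow hk' k w
      rw [inv_mul_cancel_right] at this
      exact this.symm
  have ht : ∀ k, t (Quotient.mk _ k) = ρ k w 0 • ρ k⁻¹ (Pi.single 0 1) := fun k => rfl
  -- Right multiplication by `g` permutes the right cosets, which reindexes the sum.
  let E : Quotient (QuotientGroup.rightRel Γ) ≃ Quotient (QuotientGroup.rightRel Γ) :=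
    Quotient.congr (Equiv.mulRight g) fun k k' => by
      rw [QuotientGroup.rightRel_apply, QuotientGroup.rightRel_apply]
      simp
  have hE : ∀ k, E (Quotient.mk _ k) = Quotient.mk _ (k * g) := fun k => rfl
  have h1 : ∀ x : Quotient (QuotientGroup.rightRel Γ),
      ρ x.out w 0 • ρ x.out⁻¹ (Pi.single 0 1) = t x := fun x => by
    rw [← ht, Quotient.out_eq]
  have h2 : ∀ x : Quotient (QuotientGroup.rightRel Γ),
      ρ x.out (ρ g w) 0 • ρ x.out⁻¹ (Pi.single 0 1) = ρ g (t (E x)) := fun x => by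
    conv_rhs => rw [← Quotient.out_eq x, hE, ht]
    rw [map_smul, mul_inv_rev, map_mul, map_mul, Module.End.mul_apply, Module.End.mul_apply,
      ← Module.End.mul_apply (ρ g), ← map_mul, mul_inv_cancel, map_one, Module.End.one_apply]
  simp only [h1, h2]
  rw [← map_sum, Equiv.sum_comp E]

/-- If `Γ` has finite index, and the coefficients at `0` of the translates of an invariant vector
detect it, then the invariant vectors are induced from `Γ`. -/
theorem exists_induction (hρ : Q.IsWeil c ρ)
    (hrow : ∀ h ∈ Γ, ∀ w, ρ h w 0 = χ h * w 0) [Fintype (Quotient (QuotientGroup.rightRel Γ))]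
    (hinj : ∀ w : A → ℂ, (∀ σ ∈ Q.aut, ∀ x, w (σ x) = w x) → (∀ g, ρ g w 0 = 0) → w = 0) :
    ∃ u : A → ℂ, (∀ x, Q.q x ≠ 0 → u x = 0) ∧
      ∀ w : A → ℂ, (∀ σ ∈ Q.aut, ∀ x, w (σ x) = w x) →
        (∀ h ∈ Γ, u ⬝ᵥ ρ h w = χ h * (u ⬝ᵥ w)) ∧
        w = ∑ x : Quotient (QuotientGroup.rightRel Γ),
          (u ⬝ᵥ ρ x.out w) • ρ x.out⁻¹ (Pi.single 0 1) := by
  let W : Submodule ℂ (A → ℂ) :=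
    { carrier := {w | ∀ σ ∈ Q.aut, ∀ x, w (σ x) = w x}
      add_mem' := fun {v w} hv hw σ hσ x => by
        rw [Pi.add_apply, Pi.add_apply, hv σ hσ, hw σ hσ]
      zero_mem' := fun σ _ x => rfl
      smul_mem' := fun a w hw σ hσ x => by rw [Pi.smul_apply, Pi.smul_apply, hw σ hσ] }
  let P : (A → ℂ) →ₗ[ℂ] (A → ℂ) :=
    ∑ x : Quotient (QuotientGroup.rightRel Γ),
      ((LinearMap.proj (0 : A)).comp (ρ x.out)).smulRight (ρ x.out⁻¹ (Pi.single 0 1))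
  have hP : ∀ w, P w = ∑ x : Quotient (QuotientGroup.rightRel Γ),
      ρ x.out w 0 • ρ x.out⁻¹ (Pi.single 0 1) := fun w => by
    simp [P, LinearMap.sum_apply]
  have hPcomm : ∀ g w, P (ρ g w) = ρ g (P w) := fun g w => by
    rw [hP, hP]; exact hρ.sum_summand_comm hrow g w
  have he0 : (Pi.single 0 1 : A → ℂ) ∈ W := fun σ _ x => by
    by_cases hx : x = 0
    · simp [hx]
    · simp [hx]
  have hρW : ∀ g, ∀ w ∈ W, ρ g w ∈ W := fun g w hw => hρ.comp_aut g hw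
  have hPW : ∀ w ∈ W, P w ∈ W := fun w hw => by
    rw [hP]
    exact Submodule.sum_mem _ fun x _ => W.smul_mem _ (hρW _ _ he0)
  -- This Hermitian form makes `P` self-adjoint, and `⟨w, P w⟩ = 0` forces every translate of `w` to
  -- have vanishing coefficient at `0`.
  have hip : ∀ v w, star v ⬝ᵥ P w =
      ∑ x : Quotient (QuotientGroup.rightRel Γ), star (ρ x.out v 0) * ρ x.out w 0 := fun v w => by
    rw [hP, dotProduct_sum]
    refine Finset.sum_congr rfl fun x _ => ?_
    rw [dotProduct_smul, ← hρ.star_dotProduct_apply, dotProduct_single, mul_one, smul_eq_mul,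
      mul_comm, Pi.star_apply]
  have hsymm : ∀ v w, star (P v) ⬝ᵥ w = star v ⬝ᵥ P w := fun v w => by
    rw [hip, Matrix.star_dotProduct, hip, star_sum]
    refine Finset.sum_congr rfl fun x _ => ?_
    rw [star_mul', star_star, mul_comm]
  have hPinj : ∀ w ∈ W, P w = 0 → w = 0 := fun w hw h0 => by
    refine hinj w hw fun g => ?_
    have h1 := hip w w
    rw [h0, dotProduct_zero] at h1
    have h2 : ∑ x : Quotient (QuotientGroup.rightRel Γ), Complex.normSq (ρ x.out w 0) = 0 := by
      have : ((∑ x : Quotient (QuotientGroup.rightRel Γ),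
          Complex.normSq (ρ x.out w 0) : ℝ) : ℂ) = 0 := by
        rw [h1]
        push_cast
        refine Finset.sum_congr rfl fun x _ => ?_
        rw [Complex.normSq_eq_conj_mul_self]; rfl
      exact_mod_cast this
    have h3 := (Finset.sum_eq_zero_iff_of_nonneg fun x _ => Complex.normSq_nonneg _).mp h2
      (Quotient.mk _ g) (Finset.mem_univ _)
    have h4 : g * (Quotient.mk (QuotientGroup.rightRel Γ) g).out⁻¹ ∈ Γ :=
      QuotientGroup.rightRel_apply.mp (Quotient.mk_out g)
    rw [Complex.normSq_eq_zero] at h3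
    rw [← inv_mul_cancel_right g (Quotient.mk (QuotientGroup.rightRel Γ) g).out, map_mul,
      Module.End.mul_apply, hrow _ h4, h3, mul_zero]
  have hsurj : ∀ v ∈ W, ∃ w ∈ W, P w = v := by
    let PW : W →ₗ[ℂ] W := P.restrict hPW
    have hPWinj : Function.Injective PW := by
      refine (injective_iff_map_eq_zero PW).mpr fun w hw => ?_
      exact Subtype.ext (hPinj w w.2 (congrArg Subtype.val hw))
    intro v hv
    obtain ⟨w, hw⟩ := (LinearMap.injective_iff_surjective.mp hPWinj) ⟨v, hv⟩
    exact ⟨w, w.2, congrArg Subtype.val hw⟩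
  -- The preimage of `𝔢₀` under `P`; the dot product is bilinear, so the coefficients sought are its
  -- complex conjugates.
  obtain ⟨u, huW, hu⟩ := hsurj _ he0
  refine ⟨star u, fun x hx => ?_, fun w hw => ?_⟩
  -- `T` fixes `𝔢₀` and commutes with `P`, so by injectivity it fixes `u`, which is therefore
  -- supported where `q` vanishes.
  · have h1 : ρ Mp2Z.T u = u := by
      rw [← sub_eq_zero]
      refine hPinj _ (W.sub_mem (hρW _ _ huW) huW) ?_
      rw [map_sub, hPcomm, hu, sub_eq_zero]
      funext y
      rw [hρ.T_apply]
      by_cases hy : y = 0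
      · simp [hy, Q.q_zero, e_zero]
      · simp [hy]
    have h2 := congrFun h1 x
    rw [hρ.T_apply] at h2
    have h3 : (e (Q.q x) - 1) * u x = 0 := by rw [sub_mul, h2]; ring
    rw [Pi.star_apply, (mul_eq_zero.mp h3).resolve_left fun h =>
      hx (e_eq_one_iff.mp (sub_eq_zero.mp h)), star_zero]
  · obtain ⟨w', -, rfl⟩ := hsurj w hw
    -- Moving `P` to the other side gives `⟨u, P ρ(g) w'⟩ = ⟨𝔢₀, ρ(g) w'⟩`; both claims follow from
    -- this identity.
    have h1 : ∀ g, star u ⬝ᵥ ρ g (P w') = ρ g w' 0 := fun g => by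
      rw [← hPcomm, ← hsymm, hu, Pi.star_single, star_one, single_dotProduct, one_mul]
    refine ⟨fun h hh => ?_, ?_⟩
    · have h2 := h1 1
      simp only [map_one, Module.End.one_apply] at h2
      rw [h1, hrow h hh, h2]
    · simp only [h1]
      exact hP w'

end induction

/-- The coefficients at `0` of the translates of an invariant vector determine it. -/
theorem eq_zero_of_coeff_zero (hρ : Q.IsWeil c ρ) {n : ℕ} (hn : Squarefree n)
    (hA : ∀ x : A, n • x = 0) {w : A → ℂ}
    (hw : ∀ σ ∈ Q.aut, ∀ x, w (σ x) = w x) (h0 : ∀ g, ρ g w 0 = 0) : w = 0 := by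
  refine Q.eq_zero_of_coeff_zero (K := {w | (∀ σ ∈ Q.aut, ∀ x, w (σ x) = w x) ∧ ∀ g, ρ g w 0 = 0})
    hn hA ?_ ?_ (fun w hw => hw.1) (fun w hw => by simpa using hw.2 1) ⟨hw, h0⟩
  · rintro w ⟨h1, h2⟩ n
    rw [show (fun x => e (n • Q.q x) * w x) = ρ (Mp2Z.T ^ n) w from
      funext fun x => (hρ.T_pow_apply n w x).symm]
    refine ⟨hρ.comp_aut _ h1, fun g => ?_⟩
    rw [← Module.End.mul_apply, ← map_mul, h2]
  · rintro w ⟨h1, h2⟩ n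
    rw [show (fun x => ∑ y, Q.kernel n (x - y) * w y) = ρ (Mp2Z.S⁻¹ * Mp2Z.T ^ n * Mp2Z.S) w from
      funext fun x => (hρ.kernel_apply n w x).symm]
    refine ⟨hρ.comp_aut _ h1, fun g => ?_⟩
    rw [← Module.End.mul_apply, ← map_mul, h2]

end IsWeil

end QuadModule
end

noncomputable section

open EvenLattice
open scoped NumberTheorySymbols

/-! ### Descent of Weil representations to isotropic quotients -/

namespace QuadModule

variable {A D P : Type*} [AddCommGroup A] [AddCommGroup D] [AddCommGroup P]
  {Q : QuadModule A} {R : QuadModule D} {π : P →+ A} {r : P →+ D}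

theorem b_map_eq (hq : ∀ ξ, R.q (r ξ) = Q.q (π ξ)) (ξ η : P) :
    R.b (r ξ) (r η) = Q.b (π ξ) (π η) := by
  have h := R.q_add (r ξ) (r η)
  rw [← map_add, hq, hq, hq, map_add, Q.q_add] at h
  exact (add_left_cancel h).symm

/-- The order of the isotropic subgroup `π (ker r)`. -/
def isotropicCard (π : P →+ A) (r : P →+ D) : ℕ := Nat.card ((r.ker).map π)

open Classical in
-- The span `A ← P → D` encodes `D = H^⊥ / H` for the isotropic subgroup `H = π (ker r)`, with
-- `horth` saying that `π(P) = H^⊥`. The sum over `H` is then character orthogonality.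
theorem sum_isotropic [Fintype A]
    (horth : ∀ x, (∃ ξ, π ξ = x) ↔ ∀ ξ, r ξ = 0 → Q.b x (π ξ) = 0) (x : A) :
    ∑ z, (if ∃ ξ, π ξ = z ∧ r ξ = 0 then e (-(Q.b x z)) else 0) =
      if ∃ ξ, π ξ = x then (isotropicCard π r : ℂ) else 0 := by
  have h1 : ∑ z, (if ∃ ξ, π ξ = z ∧ r ξ = 0 then e (-(Q.b x z)) else 0) =
      ∑ h : (r.ker).map π, e ((-((Q.b x).comp ((r.ker).map π).subtype)) h) := by
    rw [← Finset.sum_filter]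
    refine (Finset.sum_subtype _ (fun z => ?_) fun z => e (-(Q.b x z))).trans rfl
    simp [AddSubgroup.mem_map, AddMonoidHom.mem_ker, and_comm]
  rw [h1]
  split_ifs with hx
  · rw [horth] at hx
    rw [Finset.sum_congr rfl fun h _ => ?_, Finset.sum_const, nsmul_eq_mul, mul_one,
      Finset.card_univ, ← Nat.card_eq_fintype_card]; · rfl
    obtain ⟨h, ξ, hξ, rfl⟩ := h
    simp [hx ξ hξ, e_zero]
  · refine sum_e_hom _ fun h => hx ((horth x).mpr fun ξ hξ => ?_)
    have := DFunLike.congr_fun h ⟨π ξ, ξ, hξ, rfl⟩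
    simpa using this

variable [Fintype D]

open Classical in
/-- The map `ℂ[D] → ℂ[A]` sending `𝔢_δ` to the sum of the `𝔢_x` with `x ∈ π (r⁻¹ δ)`. -/
def pullback (π : P →+ A) (r : P →+ D) : (D → ℂ) →ₗ[ℂ] (A → ℂ) where
  toFun w x := ∑ δ, if ∃ ξ, π ξ = x ∧ r ξ = δ then w δ else 0
  map_add' v w := by
    funext x
    rw [Pi.add_apply, ← Finset.sum_add_distrib]
    exact Finset.sum_congr rfl fun δ _ => by split_ifs <;> simp
  map_smul' a w := by
    funext x
    rw [Pi.smul_apply, smul_eq_mul, Finset.mul_sum]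
    exact Finset.sum_congr rfl fun δ _ => by split_ifs <;> simp

theorem pullback_apply_map (hker : ∀ ξ η, π ξ = π η → r ξ = r η) (w : D → ℂ) (ξ : P) :
    pullback π r w (π ξ) = w (r ξ) := by
  classical
  change ∑ δ, (if ∃ η, π η = π ξ ∧ r η = δ then w δ else 0) = _
  rw [Finset.sum_eq_single (r ξ), if_pos ⟨ξ, rfl, rfl⟩]
  · intro δ _ hδ
    rw [if_neg]
    rintro ⟨η, h1, rfl⟩
    exact hδ (hker _ _ h1)
  · simp

theorem pullback_apply_of_notMem {x : A} (hx : ∀ ξ, π ξ ≠ x) (w : D → ℂ) :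
    pullback π r w x = 0 :=
  Finset.sum_eq_zero fun _ _ => if_neg fun ⟨ξ, h, _⟩ => hx ξ h

section

variable [Fintype A]

open Classical in
-- The support of the pullback is a union of `H`-cosets with representatives `π (s δ)`, on each of
-- which it is constant; the sum over `H` factors out.
theorem sum_pullback (w : D → ℂ) (φ : A →+ UnitAddCircle) (s : D → P) (hs : ∀ δ, r (s δ) = δ) :
    ∑ y, e (-(φ y)) * pullback π r w y =
      (∑ δ, e (-(φ (π (s δ)))) * w δ) *
        ∑ z, if ∃ ξ, π ξ = z ∧ r ξ = 0 then e (-(φ z)) else 0 := by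
  have h1 : ∀ y, e (-(φ y)) * pullback π r w y =
      ∑ δ, if ∃ ξ, π ξ = y ∧ r ξ = δ then e (-(φ y)) * w δ else 0 := fun y => by
    change e (-(φ y)) * ∑ δ, (if ∃ ξ, π ξ = y ∧ r ξ = δ then w δ else 0) = _
    rw [Finset.mul_sum]
    exact Finset.sum_congr rfl fun δ _ => by split_ifs <;> simp
  simp only [h1]
  rw [Finset.sum_comm, Finset.sum_mul]
  refine Finset.sum_congr rfl fun δ _ => ?_
  rw [← Equiv.sum_comp (Equiv.addRight (π (s δ))), Finset.mul_sum]
  refine Finset.sum_congr rfl fun z _ => ?_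
  have hiff : (∃ ξ, π ξ = z + π (s δ) ∧ r ξ = δ) ↔ ∃ ξ, π ξ = z ∧ r ξ = 0 := by
    constructor
    · rintro ⟨ξ, h1, h2⟩
      exact ⟨ξ - s δ, by rw [map_sub, h1, add_sub_cancel_right], by rw [map_sub, h2, hs, sub_self]⟩
    · rintro ⟨ξ, rfl, h2⟩
      exact ⟨ξ + s δ, map_add .., by rw [map_add, h2, hs, zero_add]⟩
  simp only [Equiv.coe_addRight, hiff]
  split_ifs
  · rw [map_add, neg_add, e_add]; ring
  · simp

/-- The double sum of `e(-b(x, h))` over `x ∈ A` and `h ∈ H` is `|A|` when summed first over `x`,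
and `|H| |H^⊥| = |H|² |D|` when summed first over `h`. -/
theorem card_eq_isotropicCard_sq_mul (hr : Function.Surjective r)
    (hker : ∀ ξ η, π ξ = π η → r ξ = r η)
    (horth : ∀ x, (∃ ξ, π ξ = x) ↔ ∀ ξ, r ξ = 0 → Q.b x (π ξ) = 0) :
    Fintype.card A = isotropicCard π r ^ 2 * Fintype.card D := by
  classical
  choose s hs using hr
  have h1 := sum_pullback (π := π) (fun _ => 1) 0 s hs
  have h2 := sum_isotropic horth (0 : A)
  simp only [map_zero, AddMonoidHom.zero_apply] at h2
  simp only [AddMonoidHom.zero_apply] at h1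
  rw [h2, if_pos ⟨0, map_zero π⟩] at h1
  simp only [neg_zero, e_zero, one_mul, mul_one, Finset.sum_const, nsmul_eq_mul,
    Finset.card_univ] at h1
  have h3 : ∀ x, pullback π r (fun _ => 1) x = if ∃ ξ, π ξ = x then (1 : ℂ) else 0 := by
    intro x
    split_ifs with hx
    · obtain ⟨ξ, rfl⟩ := hx
      rw [pullback_apply_map hker]
    · push Not at hx
      exact pullback_apply_of_notMem hx _
  have h4 : ∑ x : A, ∑ z, (if ∃ ξ, π ξ = z ∧ r ξ = 0 then e (-(Q.b x z)) else 0) =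
      Fintype.card A := by
    rw [Finset.sum_comm, Finset.sum_eq_single 0]
    · rw [Finset.sum_congr rfl fun x _ => if_pos ⟨0, map_zero π, map_zero r⟩]
      simp [e_zero]
    · intro z _ hz
      split_ifs
      · have := Q.sum_e_b (-z)
        rw [if_neg (neg_ne_zero.mpr hz)] at this
        rw [← this]
        refine Finset.sum_congr rfl fun x _ => ?_
        rw [map_neg, AddMonoidHom.neg_apply, Q.b_comm]
      · simp
    · simp
  simp only [sum_isotropic horth] at h4
  simp only [h3] at h1
  have h5 : ∑ x : A, (if ∃ ξ, π ξ = x then (isotropicCard π r : ℂ) else 0) =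
      (isotropicCard π r : ℂ) * ∑ x : A, if ∃ ξ, π ξ = x then (1 : ℂ) else 0 := by
    rw [Finset.mul_sum]
    exact Finset.sum_congr rfl fun x _ => by split_ifs <;> simp
  rw [h5, h1] at h4
  have : ((Fintype.card A : ℕ) : ℂ) = ((isotropicCard π r ^ 2 * Fintype.card D : ℕ) : ℂ) := by
    rw [← h4]; push_cast; ring
  exact_mod_cast this

/-- A Weil representation of `Q` induces one of its subquotient `R`. -/
theorem IsWeil.exists_descent (hr : Function.Surjective r)
    (hq : ∀ ξ, R.q (r ξ) = Q.q (π ξ))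
    (hker : ∀ ξ η, π ξ = π η → r ξ = r η)
    (horth : ∀ x, (∃ ξ, π ξ = x) ↔ ∀ ξ, r ξ = 0 → Q.b x (π ξ) = 0)
     {c : ℂ} {ρ : Representation ℂ Mp2Z (A → ℂ)} (hρ : Q.IsWeil c ρ) :
    ∃ ρ' : Representation ℂ Mp2Z (D → ℂ), R.IsWeil (c * isotropicCard π r) ρ' ∧
      ∀ g w, ρ g (pullback π r w) = pullback π r (ρ' g w) := by
  classical
  have hr' := hr
  choose s hs using hr
  have hT : ∀ w, ρ Mp2Z.T (pullback π r w) = pullback π r fun δ => e (R.q δ) * w δ := by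
    intro w
    funext x
    rw [hρ.T_apply]
    by_cases hx : ∃ ξ, π ξ = x
    · obtain ⟨ξ, rfl⟩ := hx
      rw [pullback_apply_map hker, pullback_apply_map hker, hq]
    · push Not at hx
      rw [pullback_apply_of_notMem hx, pullback_apply_of_notMem hx, mul_zero]
  have hS : ∀ w, ρ Mp2Z.S (pullback π r w) = pullback π r fun γ =>
      c * isotropicCard π r * ∑ δ, e (-(R.b γ δ)) * w δ := by
    intro w
    funext x
    rw [hρ.S_apply, sum_pullback w (Q.b x) s hs, sum_isotropic horth]
    by_cases hx : ∃ ξ, π ξ = x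
    · rw [if_pos hx]
      obtain ⟨ξ, rfl⟩ := hx
      rw [pullback_apply_map hker]
      have : ∀ δ, Q.b (π ξ) (π (s δ)) = R.b (r ξ) δ := fun δ => by
        rw [← b_map_eq hq, hs]
      simp only [this]
      ring
    · rw [if_neg hx]
      push Not at hx
      rw [pullback_apply_of_notMem hx, mul_zero, mul_zero]
  have hinj : Function.Injective (pullback π r) := fun v w h => by
    funext δ
    rw [← hs δ, ← pullback_apply_map hker v, h, pullback_apply_map hker]
  -- The image of the pullback is stable under `S` and `T`, hence under the whole group. As the
  -- pullback is injective, the action transports to `ℂ[D]`.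
  have hstable : ∀ g w, ∃ v, ρ g (pullback π r w) = pullback π r v := by
    intro g
    induction g using Mp2Z.induction_S_T with
    | h1 => exact fun w => ⟨w, by simp⟩
    | hT => exact fun w => ⟨_, hT w⟩
    | hS => exact fun w => ⟨_, hS w⟩
    | hmul g h ihg ihh =>
      intro w
      obtain ⟨v, hv⟩ := ihh w
      rw [map_mul, Module.End.mul_apply, hv]
      exact ihg v
  choose F hF using hstable
  let ρ' : Representation ℂ Mp2Z (D → ℂ) :=
    { toFun := fun g =>
        { toFun := F g
          map_add' := fun v w => hinj (by rw [← hF, map_add, map_add, hF, hF, map_add])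
          map_smul' := fun a w => hinj (by
            rw [← hF, map_smul, map_smul, hF, RingHom.id_apply, map_smul]) }
      map_one' := LinearMap.ext fun w => hinj (by
        change pullback π r (F 1 w) = _
        rw [← hF, map_one, Module.End.one_apply, Module.End.one_apply])
      map_mul' := fun g h => LinearMap.ext fun w => hinj (by
        change pullback π r (F (g * h) w) = pullback π r (F g (F h w))
        rw [← hF, ← hF, map_mul, Module.End.mul_apply, hF h w]) }
  have hρ' : ∀ g w, ρ g (pullback π r w) = pullback π r (ρ' g w) := hF
  refine ⟨ρ', ⟨fun w x => ?_, fun w x => ?_, ?_⟩, hρ'⟩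
  · exact congrFun (hinj ((hρ' _ _).symm.trans (hT w))) x
  · exact congrFun (hinj ((hρ' _ _).symm.trans (hS w))) x
  · have h1 := hρ.norm_sq
    rw [card_eq_isotropicCard_sq_mul (Q := Q) hr' hker horth] at h1
    push_cast at h1
    rw [← h1, star_mul', star_natCast]
    ring

end

end QuadModule
end

noncomputable section

open EvenLattice
open scoped NumberTheorySymbols

/-! ### Weil representations of diagonal lattices -/

theorem EvenLattice.e_sum {ι : Type*} (s : Finset ι) (f : ι → UnitAddCircle) :
    e (∑ i ∈ s, f i) = ∏ i ∈ s, e (f i) := by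
  classical
  induction s using Finset.induction_on with
  | empty => simp [e_zero]
  | insert i s hi ih => rw [Finset.sum_insert hi, Finset.prod_insert hi, e_add, ih]

section signed

variable (a : ℤ) [NeZero a]

instance : NeZero a.natAbs := ⟨Int.natAbs_ne_zero.mpr (NeZero.ne a)⟩

/-- The quadratic form `x² / 4a` on `ℤ / 2a`, for `a` of any sign. -/
def signedQ (x : ZMod (2 * a.natAbs)) : UnitAddCircle :=
  if 0 < a then cyclicQ x else -cyclicQ x

/-- The bilinear form `x y / 2a` on `ℤ / 2a`, for `a` of any sign. -/
def signedB (x y : ZMod (2 * a.natAbs)) : UnitAddCircle :=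
  if 0 < a then ZMod.toAddCircle (x * y) else -ZMod.toAddCircle (x * y)

theorem signedQ_intCast (k : ℤ) :
    signedQ a (k : ZMod (2 * a.natAbs)) = ((k ^ 2 / (4 * a) : ℝ) : UnitAddCircle) := by
  have ha : (((a.natAbs : ℕ) : ℤ) : ℝ) = ((a.natAbs : ℕ) : ℝ) := rfl
  rw [signedQ, cyclicQ_intCast]
  split_ifs with h
  · rw [← ha, Int.natAbs_of_nonneg h.le]
  · rw [← ha, Int.ofNat_natAbs_of_nonpos (not_lt.mp h), ← AddCircle.coe_neg]
    congr 1
    push_cast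
    rw [mul_neg, div_neg, neg_neg]

theorem signedB_intCast (k l : ℤ) :
    signedB a (k : ZMod (2 * a.natAbs)) l = ((k * l / (2 * a) : ℝ) : UnitAddCircle) := by
  have ha : (((a.natAbs : ℕ) : ℤ) : ℝ) = ((a.natAbs : ℕ) : ℝ) := rfl
  rw [signedB, ← Int.cast_mul, ZMod.toAddCircle_intCast, Nat.cast_mul]
  split_ifs with h
  · rw [← ha, Int.natAbs_of_nonneg h.le]; push_cast; rfl
  · rw [← ha, Int.ofNat_natAbs_of_nonpos (not_lt.mp h), ← AddCircle.coe_neg]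
    congr 1
    push_cast
    rw [mul_neg, div_neg, neg_neg]

/-- The Weil representation of the rank one lattice with form `2a x y`, for `a` of any sign. -/
def signedRep : Mp2Z →* Matrix (ZMod (2 * a.natAbs)) (ZMod (2 * a.natAbs)) ℂ :=
  if 0 < a then thetaRep a.natAbs
  else ((starRingEnd ℂ).mapMatrix : _ →+* _).toMonoidHom.comp (thetaRep a.natAbs)

theorem signedRep_of_not_pos (h : ¬0 < a) (g : Mp2Z) (x y : ZMod (2 * a.natAbs)) :
    signedRep a g x y = star (thetaRep a.natAbs g x y) := by
  rw [signedRep, if_neg h]; rfl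

theorem signedRep_T (x y : ZMod (2 * a.natAbs)) :
    signedRep a Mp2Z.T x y = if x = y then e (signedQ a x) else 0 := by
  by_cases h : 0 < a
  · rw [signedRep, if_pos h, thetaRep_T, signedQ, if_pos h]
  · rw [signedRep_of_not_pos a h, thetaRep_T, signedQ, if_neg h]
    split_ifs
    · rw [star_e]
    · simp

theorem signedRep_S (x y : ZMod (2 * a.natAbs)) :
    signedRep a Mp2Z.S x y =
      Complex.exp (-(2 * Real.pi * Complex.I * (a.sign : ℂ) / 8)) /
        (Real.sqrt (2 * a.natAbs) : ℂ) * e (-signedB a x y) := by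
  by_cases h : 0 < a
  · rw [signedRep, if_pos h, thetaRep_S, signedB, if_pos h, ← map_neg, e_toAddCircle,
      Int.sign_eq_one_of_pos h, Int.cast_one, mul_one]
  · have h' : a < 0 := lt_of_le_of_ne (not_lt.mp h) (NeZero.ne a)
    rw [signedRep_of_not_pos a h, thetaRep_S, signedB, if_neg h, neg_neg, star_mul', star_div₀,
      ← e_toAddCircle, star_e, map_neg, neg_neg, Int.sign_eq_neg_one_of_neg h']
    congr 2
    · rw [Complex.star_def, ← Complex.exp_conj]
      congr 1
      simp [Complex.conj_ofNat, neg_div]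
    · exact Complex.conj_ofReal _

theorem star_chiTheta {g : Mp2Z} (hd : Odd (g.mat 1 1)) : star (chiTheta g) = (chiTheta g)⁻¹ := by
  have h := Complex.norm_eq_one_of_pow_eq_one (g.chiTheta_pow_four hd) (by norm_num)
  rw [Complex.inv_def, Complex.normSq_eq_norm_sq, h]
  simp

theorem signedRep_zero_row {g : Mp2Z} (hc : (4 * a : ℤ) ∣ g.mat 1 0) (y : ZMod (2 * a.natAbs)) :
    signedRep a g 0 y =
      if y = 0 then chiTheta g ^ a.sign * (J(a.natAbs | (g.mat 1 1).natAbs) : ℂ) else 0 := by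
  have hc' : (4 * a.natAbs : ℤ) ∣ g.mat 1 0 :=
    (mul_dvd_mul_left 4 (Int.natAbs_dvd.mpr dvd_rfl)).trans hc
  by_cases h : 0 < a
  · rw [signedRep, if_pos h, thetaRep_zero_row _ hc', Int.sign_eq_one_of_pos h, zpow_one]
  · have h' : a < 0 := lt_of_le_of_ne (not_lt.mp h) (NeZero.ne a)
    have hd : Odd (g.mat 1 1) := g.odd_of_dvd ((Dvd.intro _ (by ring : 2 * (2 * a) = _)).trans hc)
    rw [signedRep_of_not_pos a h, thetaRep_zero_row _ hc', Int.sign_eq_neg_one_of_neg h',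
      zpow_neg_one]
    split_ifs
    · rw [star_mul', star_chiTheta hd, star_intCast]
    · simp

end signed

section diagonal

/-- The constant of the Fourier transform of the diagonal lattice. -/
def diagonalConst {ι : Type*} [Fintype ι] (a : ι → ℤ) : ℂ := ∏ i, (Complex.exp (-(2 * Real.pi * Complex.I * ((a i).sign : ℂ) / 8)) /
        (Real.sqrt (2 * (a i).natAbs) : ℂ))

theorem diagonalConst_eq {ι : Type*} [Fintype ι] (a : ι → ℤ) :
    diagonalConst a =
      Complex.exp (-(2 * Real.pi * Complex.I * ((∑ i, (a i).sign : ℤ) : ℂ) / 8)) /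
        (Real.sqrt ((∏ i, 2 * (a i).natAbs : ℕ)) : ℂ) := by
  rw [diagonalConst, Finset.prod_div_distrib, ← Complex.exp_sum]
  congr 1
  · congr 1
    push_cast
    rw [Finset.sum_neg_distrib, Finset.mul_sum, Finset.sum_div]
  · push_cast
    rw [← Complex.ofReal_prod, Real.sqrt_prod _ fun i _ => by positivity]

variable {ι : Type*} [Fintype ι] (a : ι → ℤ) [∀ i, NeZero (a i)]

/-- The discriminant form of the diagonal lattice with entries `2 a i`. -/
def diagonalModule : QuadModule (∀ i, ZMod (2 * (a i).natAbs)) where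
  b := AddMonoidHom.mk' (fun x => AddMonoidHom.mk' (fun y => ∑ i, signedB (a i) (x i) (y i))
      fun y z => by
        rw [← Finset.sum_add_distrib]
        refine Finset.sum_congr rfl fun i _ => ?_
        simp only [signedB, Pi.add_apply, mul_add, map_add]
        split_ifs
        · rfl
        · rw [neg_add]) fun x y => by
      ext z
      simp only [AddMonoidHom.mk'_apply, AddMonoidHom.add_apply]
      rw [← Finset.sum_add_distrib]
      refine Finset.sum_congr rfl fun i _ => ?_
      simp only [signedB, Pi.add_apply, add_mul, map_add]
      split_ifs
      · rfl
      · rw [neg_add]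
  q x := ∑ i, signedQ (a i) (x i)
  b_comm x y := by simp [signedB, mul_comm]
  nondeg x hx := by
    classical
    funext i
    have h := hx (Pi.single i 1)
    simp only [AddMonoidHom.mk'_apply] at h
    rw [Finset.sum_eq_single i] at h
    · simp only [signedB, Pi.single_eq_same, mul_one] at h
      refine ZMod.toAddCircle_injective _ ?_
      rw [Pi.zero_apply, map_zero]
      split_ifs at h
      · exact h
      · exact neg_eq_zero.mp h
    · intro j _ hj
      simp [signedB, hj]
    · simp
  q_add x y := by
    simp only [AddMonoidHom.mk'_apply]
    rw [← Finset.sum_add_distrib, ← Finset.sum_add_distrib]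
    refine Finset.sum_congr rfl fun i _ => ?_
    obtain ⟨k, hk⟩ := ZMod.intCast_surjective (x i)
    obtain ⟨l, hl⟩ := ZMod.intCast_surjective (y i)
    have ha : (a i : ℝ) ≠ 0 := by exact_mod_cast NeZero.ne (a i)
    rw [Pi.add_apply, ← hk, ← hl, ← Int.cast_add, signedQ_intCast, signedQ_intCast, signedQ_intCast,
      signedB_intCast, ← AddCircle.coe_add, ← AddCircle.coe_add]
    congr 1
    push_cast
    field_simp
    ring
  q_neg x := by
    refine Finset.sum_congr rfl fun i _ => ?_
    obtain ⟨k, hk⟩ := ZMod.intCast_surjective (x i)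
    rw [Pi.neg_apply, ← hk, ← Int.cast_neg, signedQ_intCast, signedQ_intCast]
    simp

variable [DecidableEq ι]

/-- The Weil representation of the diagonal lattice with entries `2 a i`. -/
def diagonalRep : Representation ℂ Mp2Z ((∀ i, ZMod (2 * (a i).natAbs)) → ℂ) where
  toFun g := Matrix.toLin' (Matrix.of fun x y => ∏ i, signedRep (a i) g (x i) (y i))
  map_one' := by
    rw [Module.End.one_eq_id, ← Matrix.toLin'_one]
    congr 1
    ext x y
    simp only [map_one, Matrix.of_apply, Matrix.one_apply]
    by_cases h : x = y
    · simp [h]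
    · obtain ⟨i, hi⟩ := Function.ne_iff.mp h
      rw [if_neg h, Finset.prod_eq_zero (Finset.mem_univ i) (if_neg hi)]
  map_mul' g h := by
    rw [Module.End.mul_eq_comp, ← Matrix.toLin'_mul]
    congr 1
    ext x y
    simp only [map_mul, Matrix.of_apply, Matrix.mul_apply, Finset.prod_univ_sum,
      Finset.prod_mul_distrib]
    rw [Fintype.piFinset_univ]

theorem diagonalRep_apply (g : Mp2Z) (w) (x) :
    diagonalRep a g w x = ∑ y, (∏ i, signedRep (a i) g (x i) (y i)) * w y := rfl

theorem isWeil_diagonalRep : (diagonalModule a).IsWeil (diagonalConst a) (diagonalRep a) where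
  T_apply w x := by
    rw [diagonalRep_apply, Finset.sum_eq_single x]
    · congr 1
      simp only [signedRep_T, if_true]
      exact (e_sum _ _).symm
    · intro y _ hy
      obtain ⟨i, hi⟩ := Function.ne_iff.mp hy
      rw [Finset.prod_eq_zero (Finset.mem_univ i), zero_mul]
      rw [signedRep_T, if_neg (Ne.symm hi)]
    · simp
  S_apply w x := by
    rw [diagonalRep_apply, Finset.mul_sum]
    refine Finset.sum_congr rfl fun y _ => ?_
    simp only [signedRep_S, Finset.prod_mul_distrib]
    rw [← mul_assoc]
    congr 2
    rw [← e_sum, Finset.sum_neg_distrib]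
    rfl
  norm_sq := by
    have hpos : 0 < ((∏ i, 2 * (a i).natAbs : ℕ) : ℝ) := by
      have : 0 < ∏ i, 2 * (a i).natAbs := Finset.prod_pos fun i _ =>
        Nat.mul_pos two_pos (Int.natAbs_pos.mpr (NeZero.ne (a i)))
      exact_mod_cast this
    rw [diagonalConst_eq, star_div₀, Complex.star_def, Complex.conj_ofReal,
      ← Complex.exp_conj]
    have h1 : (Fintype.card (∀ i, ZMod (2 * (a i).natAbs)) : ℂ) =
        ((∏ i, 2 * (a i).natAbs : ℕ) : ℝ) := by
      simp only [Fintype.card_pi, ZMod.card, Complex.ofReal_natCast]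
    rw [h1]
    set p := ((∏ i, 2 * (a i).natAbs : ℕ) : ℝ)
    have h2 : (Real.sqrt p : ℂ) * Real.sqrt p = p := by
      rw [← Complex.ofReal_mul, Real.mul_self_sqrt hpos.le]
    have h3 : (p : ℂ) ≠ 0 := by exact_mod_cast hpos.ne'
    rw [div_mul_div_comm, ← Complex.exp_add, h2, div_mul_cancel₀ _ h3, Complex.exp_eq_one_iff]
    refine ⟨0, ?_⟩
    simp [Complex.conj_ofNat]
    ring

theorem diagonalRep_zero_row {g : Mp2Z} (hc : ∀ i, 4 * a i ∣ g.mat 1 0) (w) :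
    diagonalRep a g w 0 = (∏ i, chiTheta g ^ (a i).sign *
      (J((a i).natAbs | (g.mat 1 1).natAbs) : ℂ)) * w 0 := by
  rw [diagonalRep_apply, Finset.sum_eq_single 0]
  · congr 1
    refine Finset.prod_congr rfl fun i _ => ?_
    rw [Pi.zero_apply, signedRep_zero_row _ (hc i), if_pos rfl]
  · intro y _ hy
    obtain ⟨i, hi⟩ := Function.ne_iff.mp hy
    rw [Finset.prod_eq_zero (Finset.mem_univ i), zero_mul]
    rw [Pi.zero_apply, signedRep_zero_row _ (hc i)]
    exact if_neg hi
  · simp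

end diagonal
end

noncomputable section

/-! ### The discriminant form of a lattice -/

namespace EvenLattice

variable {L : Type*} [AddCommGroup L] [Module.Free ℤ L] [Module.Finite ℤ L] (Λ : EvenLattice L)

theorem formQ_nondegenerate : Λ.formQ.Nondegenerate := by
  refine ⟨fun x h => Λ.formQ_eq_zero fun z => h _, fun x h => Λ.formQ_eq_zero fun z => ?_⟩
  rw [formQ_comm]; exact h _

theorem formQ_isSymm : Λ.formQ.IsSymm := ⟨fun x y => Λ.formQ_comm x y⟩

theorem base_eq_span : base L =
    Submodule.span ℤ (Set.range ((Module.Free.chooseBasis ℤ L).baseChange ℚ)) := by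
  set b := Module.Free.chooseBasis ℤ L
  refine le_antisymm ?_ (Submodule.span_le.mpr ?_)
  · rintro _ ⟨y, rfl⟩
    change (1 : ℚ) ⊗ₜ[ℤ] y ∈ _
    rw [← b.sum_repr y, TensorProduct.tmul_sum]
    refine Submodule.sum_mem _ fun i _ => ?_
    have h : (1 : ℚ) ⊗ₜ[ℤ] (b.repr y i • b i) = b.repr y i • b.baseChange ℚ i := by
      rw [Module.Basis.baseChange_apply]
      exact map_zsmul (TensorProduct.mk ℤ ℚ L 1) _ _
    rw [h]
    exact Submodule.smul_mem _ _ (Submodule.subset_span ⟨i, rfl⟩)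
  · rintro _ ⟨i, rfl⟩
    exact ⟨b i, (Module.Basis.baseChange_apply ..).symm⟩

/-- Biduality `(L*)* = L`, the source of nondegeneracy of the discriminant form. -/
theorem mem_base_of_forall {x : ℚ ⊗[ℤ] L} (hx : ∀ y ∈ Λ.dual, ∃ n : ℤ, Λ.formQ x y = n) :
    x ∈ base L := by
  have h := LinearMap.BilinForm.dualSubmodule_dualSubmodule_of_basis (R := ℤ) Λ.formQ
    Λ.formQ_nondegenerate Λ.formQ_isSymm ((Module.Free.chooseBasis ℤ L).baseChange ℚ)
  rw [← base_eq_span] at h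
  rw [← h, LinearMap.BilinForm.mem_dualSubmodule]
  intro y hy
  obtain ⟨n, hn⟩ := hx y hy
  rw [hn, Submodule.mem_one]
  exact ⟨n, by simp⟩

theorem coe_eq_zero_iff_exists_int (r : ℚ) :
    (((r : ℚ) : ℝ) : UnitAddCircle) = 0 ↔ ∃ n : ℤ, r = n := by
  rw [AddCircle.coe_eq_zero_iff]
  constructor
  · rintro ⟨n, hn⟩
    refine ⟨n, ?_⟩
    have : ((n : ℤ) : ℝ) = r := by simpa using hn
    exact_mod_cast this.symm
  · rintro ⟨n, rfl⟩
    exact ⟨n, by simp⟩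

theorem b_mk (x y : Λ.dual) : Λ.b (Submodule.Quotient.mk x) (Submodule.Quotient.mk y) =
    (((Λ.formQ x y : ℚ) : ℝ) : UnitAddCircle) := rfl

theorem q_mk (x : Λ.dual) : Λ.q (Submodule.Quotient.mk x) =
    (((Λ.formQ x x / 2 : ℚ) : ℝ) : UnitAddCircle) := rfl

theorem b_comm (γ δ : Λ.Disc) : Λ.b γ δ = Λ.b δ γ := by
  obtain ⟨x, rfl⟩ := Submodule.Quotient.mk_surjective _ γ
  obtain ⟨y, rfl⟩ := Submodule.Quotient.mk_surjective _ δ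
  rw [b_mk, b_mk, formQ_comm]

theorem b_add (γ δ ε : Λ.Disc) : Λ.b γ (δ + ε) = Λ.b γ δ + Λ.b γ ε := by
  obtain ⟨x, rfl⟩ := Submodule.Quotient.mk_surjective _ γ
  obtain ⟨y, rfl⟩ := Submodule.Quotient.mk_surjective _ δ
  obtain ⟨z, rfl⟩ := Submodule.Quotient.mk_surjective _ ε
  rw [← Submodule.Quotient.mk_add, b_mk, b_mk, b_mk, Submodule.coe_add, map_add, Rat.cast_add,
    AddCircle.coe_add]

theorem q_add (γ δ : Λ.Disc) : Λ.q (γ + δ) = Λ.q γ + Λ.q δ + Λ.b γ δ := by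
  obtain ⟨x, rfl⟩ := Submodule.Quotient.mk_surjective _ γ
  obtain ⟨y, rfl⟩ := Submodule.Quotient.mk_surjective _ δ
  rw [← Submodule.Quotient.mk_add, q_mk, q_mk, q_mk, b_mk, ← AddCircle.coe_add, ← AddCircle.coe_add,
    ← Rat.cast_add, ← Rat.cast_add]
  congr 2
  rw [Submodule.coe_add, map_add, map_add, LinearMap.add_apply, LinearMap.add_apply,
    Λ.formQ_comm y x]
  ring

theorem q_neg (γ : Λ.Disc) : Λ.q (-γ) = Λ.q γ := by
  obtain ⟨x, rfl⟩ := Submodule.Quotient.mk_surjective _ γ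
  rw [← Submodule.Quotient.mk_neg, q_mk, q_mk, Submodule.coe_neg, map_neg, map_neg,
    LinearMap.neg_apply, neg_neg]

theorem eq_zero_of_b_eq_zero (γ : Λ.Disc) (h : ∀ δ, Λ.b γ δ = 0) : γ = 0 := by
  obtain ⟨x, rfl⟩ := Submodule.Quotient.mk_surjective _ γ
  rw [Submodule.Quotient.mk_eq_zero]
  exact Λ.mem_base_of_forall fun y hy =>
    (coe_eq_zero_iff_exists_int _).mp (h (Submodule.Quotient.mk ⟨y, hy⟩))

/-- The discriminant form of `Λ`. -/
def quadModule : QuadModule Λ.Disc where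
  b := AddMonoidHom.mk' (fun γ => AddMonoidHom.mk' (Λ.b γ) (Λ.b_add γ)) fun γ δ => by
    ext ε
    change Λ.b (γ + δ) ε = Λ.b γ ε + Λ.b δ ε
    rw [b_comm, b_add, Λ.b_comm ε, Λ.b_comm ε]
  q := Λ.q
  b_comm := Λ.b_comm
  nondeg := Λ.eq_zero_of_b_eq_zero
  q_add := Λ.q_add
  q_neg := Λ.q_neg

theorem quadModule_b (γ δ : Λ.Disc) : Λ.quadModule.b γ δ = Λ.b γ δ := rfl

theorem quadModule_q (γ : Λ.Disc) : Λ.quadModule.q γ = Λ.q γ := rfl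

/-! ### Orthogonal vectors -/

/-- A maximal system of orthogonal vectors in the lattice, of norms `2 a i`. -/
structure OrthogonalSystem where
  vec : Fin (Module.finrank ℤ L) → L
  a : Fin (Module.finrank ℤ L) → ℤ
  a_ne_zero : ∀ i, a i ≠ 0
  form_vec : ∀ i j, Λ.form (vec i) (vec j) = if i = j then 2 * a i else 0

/-- An orthogonal basis over `ℚ` with denominators cleared; evenness of the lattice makes the norms
even. -/
theorem exists_orthogonalSystem : Nonempty Λ.OrthogonalSystem := by
  have hfr : Module.finrank ℚ (ℚ ⊗[ℤ] L) = Module.finrank ℤ L := Module.finrank_baseChange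
  have : Invertible (2 : ℚ) := invertibleOfNonzero two_ne_zero
  obtain ⟨v, hv⟩ : ∃ v : Module.Basis (Fin (Module.finrank ℤ L)) ℚ (ℚ ⊗[ℤ] L),
      Λ.formQ.IsOrthoᵢ v := by
    rw [← hfr]
    exact LinearMap.BilinForm.exists_orthogonal_basis ⟨fun x y => Λ.formQ_comm x y⟩
  choose n hn y hy using fun i => exists_smul_eq (v i)
  choose a ha using fun i => Λ.even (y i)
  have hform : ∀ i j, (Λ.form (y i) (y j) : ℚ) = n i * n j * Λ.formQ (v i) (v j) := fun i j => by
    rw [← formQ_tmul_one, ← hy, ← hy, ← Int.cast_smul_eq_zsmul ℚ, ← Int.cast_smul_eq_zsmul ℚ,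
      map_smul, map_smul, LinearMap.smul_apply, smul_eq_mul, smul_eq_mul]
    ring
  refine ⟨⟨y, a, fun i h0 => ?_, fun i j => ?_⟩⟩
  · have h1 : Λ.formQ (v i) (v i) = 0 := by
      have := hform i i
      rw [ha, h0] at this
      have hni : (n i : ℚ) ≠ 0 := by exact_mod_cast hn i
      simpa [hni] using this
    refine v.ne_zero i (Λ.formQ_nondegenerate.1 _ fun z => ?_)
    rw [← v.sum_repr z, map_sum]
    refine Finset.sum_eq_zero fun j _ => ?_
    rw [map_smul]
    by_cases hij : i = j
    · rw [← hij, h1, smul_zero]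
    · have h2 : Λ.formQ (v i) (v j) = 0 := hv hij
      rw [h2, smul_zero]
  · split_ifs with hij
    · rw [← hij, ha, two_mul]
    · have := hform i j
      have h2 : Λ.formQ (v i) (v j) = 0 := hv hij
      rw [h2, mul_zero] at this
      exact_mod_cast this

namespace OrthogonalSystem

variable {Λ} (s : Λ.OrthogonalSystem)

instance (i) : NeZero (s.a i) := ⟨s.a_ne_zero i⟩

theorem exists_basis (K : Type*) [Field K] [CharZero K] :
    ∃ v : Module.Basis (Fin (Module.finrank ℤ L)) K (K ⊗[ℤ] L), ∀ i, v i = 1 ⊗ₜ s.vec i := by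
  have hli : LinearIndependent K fun i => (1 : K) ⊗ₜ[ℤ] s.vec i := by
    refine LinearMap.linearIndependent_of_isOrthoᵢ
      (B := LinearMap.BilinForm.baseChange K Λ.form) ?_ ?_
    · intro i j hij
      change LinearMap.BilinForm.baseChange K Λ.form (1 ⊗ₜ s.vec i) (1 ⊗ₜ s.vec j) = 0
      simp [LinearMap.BilinForm.baseChange_tmul, s.form_vec, hij]
    · intro i h
      change LinearMap.BilinForm.baseChange K Λ.form (1 ⊗ₜ s.vec i) (1 ⊗ₜ s.vec i) = 0 at h
      simp [LinearMap.BilinForm.baseChange_tmul, s.form_vec, s.a_ne_zero] at h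
  exact ⟨basisOfLinearIndependentOfCardEqFinrank' _ hli (by
    rw [Fintype.card_fin, Module.finrank_baseChange]), fun i => by simp⟩

theorem eq_sum (x : ℚ ⊗[ℤ] L) :
    x = ∑ i, (Λ.formQ x (1 ⊗ₜ s.vec i) / (2 * s.a i)) • ((1 : ℚ) ⊗ₜ[ℤ] s.vec i) := by
  obtain ⟨v, hv⟩ := s.exists_basis ℚ
  conv_lhs => rw [← v.sum_repr x]
  refine Finset.sum_congr rfl fun i _ => ?_
  have ha : (s.a i : ℚ) ≠ 0 := by exact_mod_cast s.a_ne_zero i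
  have h : Λ.formQ x (1 ⊗ₜ s.vec i) = v.repr x i * (2 * s.a i) := by
    conv_lhs => rw [← v.sum_repr x]
    rw [map_sum, LinearMap.sum_apply, Finset.sum_eq_single i]
    · rw [map_smul, LinearMap.smul_apply, hv, formQ_tmul_one, s.form_vec, if_pos rfl]
      push_cast; rfl
    · intro j _ hj
      rw [map_smul, LinearMap.smul_apply, hv, formQ_tmul_one, s.form_vec, if_neg hj]
      simp
    · simp
  rw [h, hv]
  congr 1
  field_simp

theorem formQ_eq_sum (x z : ℚ ⊗[ℤ] L) : Λ.formQ x z =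
    ∑ i, Λ.formQ x (1 ⊗ₜ s.vec i) * Λ.formQ z (1 ⊗ₜ s.vec i) / (2 * s.a i) := by
  conv_lhs => rw [s.eq_sum z]
  rw [map_sum]
  refine Finset.sum_congr rfl fun i _ => ?_
  rw [map_smul, smul_eq_mul]
  ring

theorem sgn_eq : Λ.sgn = ∑ i, (s.a i).sign := by
  obtain ⟨v, hv⟩ := s.exists_basis ℝ
  have hq : ∀ x, Λ.quadR x = (1 / 2 : ℝ) * LinearMap.BilinForm.baseChange ℝ Λ.form x x :=
    fun x => rfl
  have hsymm : ∀ x y, LinearMap.BilinForm.baseChange ℝ Λ.form x y =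
      LinearMap.BilinForm.baseChange ℝ Λ.form y x := fun x y =>
    ((LinearMap.BilinForm.IsSymm.baseChange ℝ ⟨Λ.symm.eq⟩).eq x y : _)
  have hrepr : Λ.quadR.basisRepr v =
      QuadraticMap.weightedSumSquares ℝ fun i => (s.a i : ℝ) := by
    have h0 := QuadraticMap.basisRepr_eq_of_iIsOrtho Λ.quadR v (by
      intro i j hij
      change QuadraticMap.associated Λ.quadR (v i) (v j) = 0
      have h1 : LinearMap.BilinForm.baseChange ℝ Λ.form (v i) (v j) = 0 := by
        rw [hv, hv]
        simp [LinearMap.BilinForm.baseChange_tmul, s.form_vec, hij]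
      rw [QuadraticMap.associated_apply, hq, hq, hq]
      simp only [map_add, LinearMap.add_apply, hsymm (v j) (v i), h1]
      simp
      ring)
    rw [h0]
    congr 1
    funext i
    rw [hq, hv]
    simp [LinearMap.BilinForm.baseChange_tmul, s.form_vec]
  have heq : QuadraticMap.Equivalent Λ.quadR
      (QuadraticMap.weightedSumSquares ℝ fun i => (s.a i : ℝ)) := by
    rw [← hrepr]
    exact ⟨QuadraticMap.isometryEquivBasisRepr Λ.quadR v⟩
  rw [sgn, QuadraticForm.sigPos_of_equiv_weightedSumSquares heq,
    QuadraticForm.sigNeg_of_equiv_weightedSumSquares heq]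
  have hset : ∀ p : Fin (Module.finrank ℤ L) → Prop, ∀ [DecidablePred p],
      (({i | p i} : Set (Fin (Module.finrank ℤ L))).ncard : ℤ) = ∑ i, if p i then 1 else 0 := by
    intro p _
    rw [Finset.sum_boole, Set.ncard_eq_toFinset_card']
    congr 2
    ext; simp
  rw [hset, hset, ← Finset.sum_sub_distrib]
  refine Finset.sum_congr rfl fun i _ => ?_
  simp only [Int.cast_pos, Int.cast_lt_zero]
  rcases lt_trichotomy (s.a i) 0 with h | h | h
  · simp [h, h.not_gt, Int.sign_eq_neg_one_of_neg h]
  · exact absurd h (s.a_ne_zero i)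
  · simp [h, h.not_gt, Int.sign_eq_one_of_pos h]

end OrthogonalSystem

end EvenLattice
end

noncomputable section

/-! ### The Weil representation of a lattice -/

open scoped NumberTheorySymbols
open ZMod (χ₈)

theorem zpow_sum_of_ne_zero {ι K : Type*} [Field K] {x : K} (hx : x ≠ 0) (s : Finset ι)
    (f : ι → ℤ) : x ^ (∑ i ∈ s, f i) = ∏ i ∈ s, x ^ f i := by
  classical
  induction s using Finset.induction_on with
  | empty => simp
  | insert i s hi ih => rw [Finset.sum_insert hi, Finset.prod_insert hi, zpow_add₀ hx, ih]

theorem jacobiSym_prod {ι : Type*} (s : Finset ι) (f : ι → ℕ) (n : ℕ) :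
    J((∏ i ∈ s, f i : ℕ) | n) = ∏ i ∈ s, J(f i | n) := by
  classical
  induction s using Finset.induction_on with
  | empty => simp
  | insert i s hi ih =>
    rw [Finset.prod_insert hi, Finset.prod_insert hi, Nat.cast_mul, jacobiSym.mul_left, ih]

theorem jacobiSym_two_natAbs {d : ℤ} (hd : Odd d) : J(2 | d.natAbs) = χ₈ d := by
  rw [jacobiSym.at_two (Int.natAbs_odd.mpr hd)]
  rcases Int.natAbs_eq d with h | h
  · conv_rhs => rw [h]
    simp
  · conv_rhs => rw [h]
    rw [Int.cast_neg, chi₈_neg]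
    simp

namespace EvenLattice

variable {L : Type*} [AddCommGroup L] [Module.Free ℤ L] [Module.Finite ℤ L] {Λ : EvenLattice L}

theorem coe_sum {ι : Type*} (s : Finset ι) (f : ι → ℝ) :
    ((∑ i ∈ s, f i : ℝ) : UnitAddCircle) = ∑ i ∈ s, (f i : UnitAddCircle) := by
  classical
  induction s using Finset.induction_on with
  | empty => simp
  | insert i s hi ih => rw [Finset.sum_insert hi, Finset.sum_insert hi, AddCircle.coe_add, ih]

/-! ### The discriminant form as a subquotient of that of a diagonal sublattice. -/

namespace OrthogonalSystem

variable (s : Λ.OrthogonalSystem)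

/-- The integers `(ξ, v i)` for `ξ` in the dual lattice. -/
def coord (ξ : Λ.dual) (i : Fin (Module.finrank ℤ L)) : ℤ :=
  (Λ.formQ_mem (y := 1 ⊗ₜ s.vec i) ξ.2 ⟨s.vec i, rfl⟩).choose

theorem formQ_vec (ξ : Λ.dual) (i) : Λ.formQ ξ (1 ⊗ₜ s.vec i) = s.coord ξ i :=
  (Λ.formQ_mem (y := 1 ⊗ₜ s.vec i) ξ.2 ⟨s.vec i, rfl⟩).choose_spec

/-- The reduction of the dual lattice to the discriminant group of the diagonal sublattice. -/
def toDiagonal : Λ.dual →+ ∀ i, ZMod (2 * (s.a i).natAbs) :=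
  AddMonoidHom.mk' (fun ξ i => (s.coord ξ i : ZMod (2 * (s.a i).natAbs))) fun ξ η => by
    funext i
    have : s.coord (ξ + η) i = s.coord ξ i + s.coord η i := by
      have h : ((s.coord (ξ + η) i : ℤ) : ℚ) = ((s.coord ξ i + s.coord η i : ℤ) : ℚ) := by
        rw [Int.cast_add, ← formQ_vec, ← formQ_vec, ← formQ_vec, Submodule.coe_add, map_add,
          LinearMap.add_apply]
      exact_mod_cast h
    rw [this, Int.cast_add, Pi.add_apply]

theorem toDiagonal_apply (ξ : Λ.dual) (i) :
    s.toDiagonal ξ i = (s.coord ξ i : ZMod (2 * (s.a i).natAbs)) := rfl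

variable (Λ) in
/-- The projection to the discriminant group. -/
def toDisc : Λ.dual →+ Λ.Disc := (Submodule.mkQ ((base L).submoduleOf Λ.dual)).toAddMonoidHom

theorem toDisc_surjective : Function.Surjective (toDisc Λ) := Submodule.mkQ_surjective _

theorem toDisc_eq_iff {ξ η : Λ.dual} :
    toDisc Λ ξ = toDisc Λ η ↔ (ξ : ℚ ⊗[ℤ] L) - η ∈ base L := by
  change (Submodule.Quotient.mk ξ : Λ.Disc) = Submodule.Quotient.mk η ↔ _
  rw [Submodule.Quotient.eq]
  rfl

theorem q_toDisc (ξ : Λ.dual) :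
    Λ.quadModule.q (toDisc Λ ξ) = (diagonalModule s.a).q (s.toDiagonal ξ) := by
  change (((Λ.formQ ξ ξ / 2 : ℚ) : ℝ) : UnitAddCircle) =
    ∑ i, signedQ (s.a i) (s.coord ξ i : ZMod (2 * (s.a i).natAbs))
  simp only [signedQ_intCast]
  rw [s.formQ_eq_sum, Finset.sum_div]
  push_cast
  rw [coe_sum]
  refine Finset.sum_congr rfl fun i _ => ?_
  rw [s.formQ_vec]
  congr 1
  push_cast
  have ha : (s.a i : ℝ) ≠ 0 := by exact_mod_cast s.a_ne_zero i
  field_simp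
  ring

/-- With `M` the sublattice spanned by the `s.vec i`, one has `M ⊆ L ⊆ L* ⊆ M*`. Coordinates
congruent modulo `2 aᵢ` mean that the difference lies in `M`, hence in `L`. -/
theorem toDisc_eq_of_toDiagonal_eq (ξ η : Λ.dual) (h : s.toDiagonal ξ = s.toDiagonal η) :
    toDisc Λ ξ = toDisc Λ η := by
  rw [toDisc_eq_iff, s.eq_sum (ξ - η : ℚ ⊗[ℤ] L)]
  refine Submodule.sum_mem _ fun i _ => ?_
  have h1 := congrFun h i
  rw [toDiagonal_apply, toDiagonal_apply, eq_comm, ZMod.intCast_eq_intCast_iff_dvd_sub] at h1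
  have h2 : 2 * s.a i ∣ s.coord ξ i - s.coord η i := by
    refine dvd_trans ?_ h1
    push_cast
    exact mul_dvd_mul_left 2 (self_dvd_abs _)
  obtain ⟨m, hm⟩ := h2
  have ha : (s.a i : ℚ) ≠ 0 := by exact_mod_cast s.a_ne_zero i
  rw [map_sub, LinearMap.sub_apply, s.formQ_vec, s.formQ_vec, ← Int.cast_sub, hm]
  have h3 : ((2 * s.a i * m : ℤ) : ℚ) / (2 * s.a i) = m := by push_cast; field_simp
  rw [h3, Int.cast_smul_eq_zsmul]
  exact Submodule.smul_mem _ _ ⟨s.vec i, rfl⟩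

/-- Inside `M*/M`, the subgroup `L*/M` is the annihilator of the isotropic subgroup `L/M`. A class
orthogonal to `L/M` lifts to a rational vector that pairs integrally with `L`. -/
theorem mem_range_toDiagonal_iff (x : ∀ i, ZMod (2 * (s.a i).natAbs)) :
    (∃ ξ, s.toDiagonal ξ = x) ↔
      ∀ ξ, toDisc Λ ξ = 0 → (diagonalModule s.a).b x (s.toDiagonal ξ) = 0 := by
  constructor
  · rintro ⟨η, rfl⟩ ξ hξ
    rw [← QuadModule.b_map_eq s.q_toDisc, hξ, map_zero]
  · intro h
    choose k hk using fun i => ZMod.intCast_surjective (x i)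
    let ξ : ℚ ⊗[ℤ] L := ∑ i, ((k i : ℚ) / (2 * s.a i)) • ((1 : ℚ) ⊗ₜ[ℤ] s.vec i)
    have hvec : ∀ i, Λ.formQ ξ (1 ⊗ₜ s.vec i) = k i := by
      intro i
      have ha : (s.a i : ℚ) ≠ 0 := by exact_mod_cast s.a_ne_zero i
      rw [map_sum, LinearMap.sum_apply, Finset.sum_eq_single i]
      · rw [map_smul, LinearMap.smul_apply, formQ_tmul_one, s.form_vec, if_pos rfl, smul_eq_mul]
        push_cast
        field_simp
      · intro j _ hj
        rw [map_smul, LinearMap.smul_apply, formQ_tmul_one, s.form_vec, if_neg hj]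
        simp
      · simp
    have hmem : ξ ∈ Λ.dual := by
      rw [dual, LinearMap.BilinForm.mem_dualSubmodule]
      intro y hy
      have hy' : y ∈ Λ.dual := by
        obtain ⟨l, rfl⟩ := hy
        rw [dual, LinearMap.BilinForm.mem_dualSubmodule]
        rintro _ ⟨m, rfl⟩
        refine Submodule.mem_one.mpr ⟨Λ.form l m, ?_⟩
        exact (Λ.formQ_tmul_one l m).symm
      have h0 := h ⟨y, hy'⟩ ((toDisc_eq_iff (η := 0)).mpr (by simpa using hy))
      have h1 : (((Λ.formQ ξ y : ℚ) : ℝ) : UnitAddCircle) = 0 := by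
        rw [← h0]
        change _ = ∑ i, signedB (s.a i) (x i) (s.coord ⟨y, hy'⟩ i : ZMod (2 * (s.a i).natAbs))
        rw [s.formQ_eq_sum]
        push_cast
        rw [coe_sum]
        refine Finset.sum_congr rfl fun i _ => ?_
        have h2 : Λ.formQ y (1 ⊗ₜ s.vec i) = s.coord ⟨y, hy'⟩ i := s.formQ_vec ⟨y, hy'⟩ i
        rw [← hk, signedB_intCast, h2, hvec]
        push_cast
        rfl
      obtain ⟨n, hn⟩ := (coe_eq_zero_iff_exists_int _).mp h1
      rw [hn]
      exact Submodule.mem_one.mpr ⟨n, by simp⟩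
    refine ⟨⟨ξ, hmem⟩, funext fun i => ?_⟩
    rw [toDiagonal_apply, ← hk]
    congr 1
    have := s.formQ_vec ⟨ξ, hmem⟩ i
    have h3 := this.symm.trans (hvec i)
    exact_mod_cast h3

end OrthogonalSystem

variable (Λ)

/-- The constant of the Fourier transform in the Weil representation. -/
def fourierConst : ℂ := Complex.exp (-(2 * Real.pi * Complex.I * (Λ.sgn : ℂ) / 8)) /
      ((Real.sqrt (Nat.card Λ.Disc) : ℝ) : ℂ)

/-- The Weil representation exists, and a subgroup `Γ̃₀(M)` acts on `𝔢₀` by an explicit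
character. -/
theorem exists_isWeil : ∃ (ρ : Representation ℂ Mp2Z (Λ.Disc → ℂ)) (M : ℕ),
    Λ.quadModule.IsWeil Λ.fourierConst ρ ∧ 0 < M ∧ 4 ∣ M ∧ Nat.card Λ.Disc ∣ M ∧
      ∀ g ∈ Mp2Z.Gamma0 M, ∀ w, ρ g w 0 =
        (chiTheta g * (χ₈ (g.mat 1 1) : ℤ)) ^ Λ.sgn *
          (J(Nat.card Λ.Disc | (g.mat 1 1).natAbs) : ℂ) * w 0 := by
  obtain ⟨s⟩ := Λ.exists_orthogonalSystem
  have hcard := QuadModule.card_eq_isotropicCard_sq_mul OrthogonalSystem.toDisc_surjective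
    s.toDisc_eq_of_toDiagonal_eq s.mem_range_toDiagonal_iff
  obtain ⟨ρ, hρ, hintertwine⟩ := QuadModule.IsWeil.exists_descent OrthogonalSystem.toDisc_surjective
    s.q_toDisc s.toDisc_eq_of_toDiagonal_eq s.mem_range_toDiagonal_iff (isWeil_diagonalRep s.a)
  set h := QuadModule.isotropicCard s.toDiagonal (OrthogonalSystem.toDisc Λ)
  have hcard' : ∏ i, 2 * (s.a i).natAbs = h ^ 2 * Nat.card Λ.Disc := by
    rw [Nat.card_eq_fintype_card, ← hcard]
    simp only [Fintype.card_pi, ZMod.card]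
  have hprod : 0 < ∏ i, 2 * (s.a i).natAbs := Finset.prod_pos fun i _ =>
    Nat.mul_pos two_pos (Int.natAbs_pos.mpr (s.a_ne_zero i))
  have hh : 0 < h := by
    rw [hcard'] at hprod
    exact Nat.pos_of_ne_zero fun h0 => by simp [h0] at hprod
  -- This `M` is divisible by every `4 aᵢ`, as the diagonal row formula requires, and by `|A|` and
  -- the index `h`, since the product is `h² |A|`.
  refine ⟨ρ, 4 * ∏ i, 2 * (s.a i).natAbs, ?_, by omega, dvd_mul_right .., ?_, ?_⟩
  · have : Λ.fourierConst = diagonalConst s.a * h := by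
      rw [diagonalConst_eq, hcard', ← s.sgn_eq, fourierConst]
      push_cast
      rw [Real.sqrt_mul (by positivity), Real.sqrt_sq (by positivity)]
      have hh' : (h : ℂ) ≠ 0 := by exact_mod_cast hh.ne'
      have hd : ((Real.sqrt (Nat.card Λ.Disc) : ℝ) : ℂ) ≠ 0 := by
        rw [Complex.ofReal_ne_zero, Real.sqrt_ne_zero']
        exact_mod_cast Nat.card_pos
      push_cast
      field_simp
    rw [this]
    exact hρ
  · rw [hcard']
    exact (dvd_mul_left ..).trans (dvd_mul_left ..)
  · intro g hg w
    have hg' : ((4 * ∏ i, 2 * (s.a i).natAbs : ℕ) : ℤ) ∣ g.mat 1 0 := by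
      have := CongruenceSubgroup.Gamma0_mem.mp (Subgroup.mem_comap.mp hg)
      exact (ZMod.intCast_zmod_eq_zero_iff_dvd _ _).mp this
    have hd : Odd (g.mat 1 1) := g.odd_of_dvd (dvd_trans (by
      push_cast
      exact Dvd.intro _ (by ring : 2 * (2 * ∏ i, 2 * |s.a i|) = _)) hg')
    have hc : ∀ i, 4 * s.a i ∣ g.mat 1 0 := fun i => by
      refine dvd_trans ?_ hg'
      rw [← Int.dvd_natAbs.trans (Iff.rfl), Int.natAbs_natCast, Nat.cast_mul]
      refine mul_dvd_mul_left 4 ?_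
      rw [← Int.natAbs_dvd, Int.natCast_dvd_natCast]
      exact (dvd_mul_left _ 2).trans (Finset.dvd_prod_of_mem _ (Finset.mem_univ i))
    have hzero : ∀ w, QuadModule.pullback s.toDiagonal (OrthogonalSystem.toDisc Λ) w 0 = w 0 :=
      fun w => by
        have := QuadModule.pullback_apply_map s.toDisc_eq_of_toDiagonal_eq w 0
        rwa [map_zero, map_zero] at this
    rw [← hzero (ρ g w), ← hintertwine, diagonalRep_zero_row s.a hc, hzero]
    congr 1
    have hχ : χ₈ (g.mat 1 1) = 1 ∨ χ₈ (g.mat 1 1) = -1 := by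
      rw [← jacobiSym_two_natAbs hd]
      refine jacobiSym.eq_one_or_neg_one ?_
      have := isCoprime_natAbs (a := 2) (g := g) (dvd_trans (by
        push_cast
        exact Dvd.intro _ (by ring : 2 * (2 * ∏ i, 2 * |s.a i|) = _)) hg')
      exact this
    -- Two factors `(2 / |d|) = χ₈(d)` are inserted, one into the base of the power and one into the
    -- Jacobi symbol, so that the symbols multiply to that of `∏ 2|aᵢ| = h² |A|`, where the square
    -- drops out.
    have hfac : ∀ i, chiTheta g ^ (s.a i).sign * (J((s.a i).natAbs | (g.mat 1 1).natAbs) : ℂ) =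
        (chiTheta g * (χ₈ (g.mat 1 1) : ℤ)) ^ (s.a i).sign *
          (J((2 * (s.a i).natAbs : ℕ) | (g.mat 1 1).natAbs) : ℂ) := by
      intro i
      rw [Nat.cast_mul, jacobiSym.mul_left, Nat.cast_ofNat, jacobiSym_two_natAbs hd, mul_zpow]
      have hs : (((χ₈ (g.mat 1 1) : ℤ) : ℂ)) ^ (s.a i).sign * ((χ₈ (g.mat 1 1) : ℤ) : ℂ) = 1 := by
        rcases lt_or_gt_of_ne (s.a_ne_zero i) with hi | hi
        · rw [Int.sign_eq_neg_one_of_neg hi]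
          rcases hχ with h | h <;> rw [h] <;> simp
        · rw [Int.sign_eq_one_of_pos hi]
          rcases hχ with h | h <;> rw [h] <;> simp
      rw [Int.cast_mul]
      linear_combination (-(chiTheta g ^ (s.a i).sign *
        (J((s.a i).natAbs | (g.mat 1 1).natAbs) : ℂ))) * hs
    have hJ : J((∏ i, 2 * (s.a i).natAbs : ℕ) | (g.mat 1 1).natAbs) =
        J(Nat.card Λ.Disc | (g.mat 1 1).natAbs) := by
      have hcop := isCoprime_natAbs (a := h) (g := g) (dvd_trans (by
        rw [Int.natCast_dvd_natCast, hcard', sq]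
        exact Dvd.intro (h * Nat.card Λ.Disc * 4) (by ring)) hg')
      rw [hcard', Nat.cast_mul, jacobiSym.mul_left, Nat.cast_pow, jacobiSym.pow_left,
        jacobiSym.sq_one hcop, one_mul]
    have hχ0 : chiTheta g * ((χ₈ (g.mat 1 1) : ℤ) : ℂ) ≠ 0 := by
      refine mul_ne_zero (fun h0 => ?_) ?_
      · have := g.chiTheta_pow_four hd
        rw [h0] at this
        norm_num at this
      · rcases hχ with h | h <;> rw [h] <;> simp
    rw [Finset.prod_congr rfl fun i _ => hfac i, Finset.prod_mul_distrib, s.sgn_eq, ← hJ,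
      jacobiSym_prod, Int.cast_prod]
    congr 1
    exact (zpow_sum_of_ne_zero hχ0 _ _).symm

end EvenLattice
end

noncomputable section

/-! ### The character of `Γ̃₀(N)` on `𝔢₀` -/

open scoped NumberTheorySymbols
open ZMod (χ₄ χ₈)

/-- Take for `n` the product of the primes of `M` not dividing `d`. A prime of `M` dividing `d`
divides neither `n` nor `c`; any other prime of `M` divides `n` but not `d`. -/
theorem exists_isCoprime_add_mul {c d : ℤ} (h : IsCoprime c d) {M : ℕ} (hM : M ≠ 0) :
    ∃ n : ℤ, IsCoprime (d + n * c) M := by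
  refine ⟨∏ p ∈ M.primeFactors with ¬((p : ℕ) : ℤ) ∣ d, (p : ℤ), ?_⟩
  rw [Int.isCoprime_iff_gcd_eq_one]
  refine Nat.Coprime.symm (Nat.coprime_of_dvd fun p hp hpM hpd => ?_)
  rw [Int.natAbs_natCast] at hpM
  have hpd' : (p : ℤ) ∣ d + (∏ p ∈ M.primeFactors with ¬((p : ℕ) : ℤ) ∣ d, (p : ℤ)) * c :=
    Int.natCast_dvd.mpr hpd
  have hpp : Prime (p : ℤ) := Nat.prime_iff_prime_int.mp hp
  by_cases hd : (p : ℤ) ∣ d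
  · have h1 := (dvd_add_right hd).mp hpd'
    rcases hpp.dvd_or_dvd h1 with h2 | h2
    · obtain ⟨q, hq, hpq⟩ := (Prime.dvd_finsetProd_iff hpp _).mp h2
      obtain ⟨hq1, hq2⟩ := Finset.mem_filter.mp hq
      rw [Int.natCast_dvd_natCast,
        Nat.prime_dvd_prime_iff_eq hp (Nat.prime_of_mem_primeFactors hq1)] at hpq
      exact hq2 (hpq ▸ hd)
    · exact hpp.not_isUnit (h.isUnit_of_dvd' h2 hd)
  · refine hd ((dvd_add_left (Dvd.dvd.mul_right (Finset.dvd_prod_of_mem _ ?_) c)).mp hpd')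
    rw [Finset.mem_filter]
    exact ⟨Nat.mem_primeFactors.mpr ⟨hp, hpM, hM⟩, hd⟩

theorem exists_dvd_sub_mul {d M : ℤ} (h : IsCoprime d M) (k : ℤ) : ∃ m : ℤ, M ∣ k - m * d := by
  obtain ⟨u, v, huv⟩ := h
  exact ⟨k * u, k * v, by linear_combination (-k) * huv⟩

theorem jacobiSym_add_of_forall_prime_dvd {c d : ℤ} {D : ℕ}
    (h : ∀ p : ℕ, p.Prime → p ∣ D → (p : ℤ) ∣ c) : J(d + c | D) = J(d | D) := by
  rw [jacobiSym, jacobiSym]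
  congr 1
  refine List.pmap_congr_left _ fun p hp h1 h2 => ?_
  have hp' := Nat.prime_of_mem_primeFactorsList hp
  have hc := h p hp' (Nat.dvd_of_mem_primeFactorsList hp)
  have : Fact p.Prime := ⟨hp'⟩
  rw [legendreSym.mod p (d + c), legendreSym.mod p d, Int.add_emod, Int.emod_eq_zero_of_dvd hc, add_zero,
    Int.emod_emod]

namespace Mp2Z

theorem mem_Gamma0_iff {N : ℕ} {g : Mp2Z} : g ∈ Gamma0 N ↔ (N : ℤ) ∣ g.mat 1 0 := by
  rw [Gamma0, Subgroup.mem_comap, CongruenceSubgroup.Gamma0_mem]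
  exact ZMod.intCast_zmod_eq_zero_iff_dvd _ _

theorem chiTheta_sq (g : Mp2Z) (hd : Odd (g.mat 1 1)) :
    chiTheta g ^ 2 = ((χ₄ (g.mat 1 1) : ℤ) : ℂ) := by
  have hJ : J(g.mat 1 0 | (g.mat 1 1).natAbs) ^ 2 = 1 := by
    refine jacobiSym.sq_one ?_
    have := Int.isCoprime_iff_gcd_eq_one.mp g.gcd_eq_one
    rw [Int.gcd] at this ⊢
    simpa only [Int.natAbs_natCast] using this
  have hK : (kroneckerSymbol (g.mat 1 0) (g.mat 1 1)) ^ 2 = 1 := by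
    rw [kroneckerSymbol_of_odd _ hd, mul_pow, hJ]
    split_ifs <;> norm_num
  have hs : g.sign ^ 2 = 1 := by
    rcases g.sign_eq_or with h | h <;> rw [h] <;> norm_num
  have hK' : ((kroneckerSymbol (g.mat 1 0) (g.mat 1 1) : ℤ) : ℂ) ^ 2 = 1 := by exact_mod_cast hK
  rw [chiTheta, mul_pow, mul_pow, hs, hK', one_mul, mul_one]
  have h4 : g.mat 1 1 % 4 = 1 ∨ g.mat 1 1 % 4 = 3 := by
    obtain ⟨k, hk⟩ := hd
    omega
  rcases h4 with h | h
  · rw [if_pos h, ZMod.χ₄_int_one_mod_four h]; norm_num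
  · rw [if_neg (by omega), ZMod.χ₄_int_three_mod_four h]; norm_num

end Mp2Z

namespace EvenLattice

variable {L : Type*} [AddCommGroup L] [Module.Free ℤ L] [Module.Finite ℤ L] (Λ : EvenLattice L)

theorem IsWeilRep.unique {ρ ρ' : Representation ℂ Mp2Z (Λ.Disc → ℂ)} (h : Λ.IsWeilRep ρ)
    (h' : Λ.IsWeilRep ρ') : ρ = ρ' := by
  classical
  have hbasis : ∀ γ, Λ.basisVec γ = Pi.basisFun ℂ Λ.Disc γ := fun γ => by
    rw [basisVec, Pi.basisFun_apply]
  refine MonoidHom.ext fun g => ?_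
  induction g using Mp2Z.induction_S_T with
  | h1 => rw [map_one, map_one]
  | hT => exact (Pi.basisFun ℂ Λ.Disc).ext fun γ => by rw [← hbasis, h.1, h'.1]
  | hS => exact (Pi.basisFun ℂ Λ.Disc).ext fun γ => by rw [← hbasis, h.2, h'.2]
  | hmul g k hg hk => rw [map_mul, map_mul, hg, hk]

variable {Λ} in
theorem isWeilRep_of_isWeil {ρ : Representation ℂ Mp2Z (Λ.Disc → ℂ)}
    (hρ : Λ.quadModule.IsWeil Λ.fourierConst ρ) : Λ.IsWeilRep ρ := by
  classical
  have hb : ∀ γ δ, Λ.basisVec γ δ = if δ = γ then 1 else 0 := fun γ δ => by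
    rw [basisVec, Pi.single_apply]
  refine ⟨fun γ => funext fun x => ?_, fun γ => funext fun x => ?_⟩
  · rw [hρ.T_apply, Pi.smul_apply, smul_eq_mul, quadModule_q, hb]
    split_ifs with h
    · rw [h]
    · rw [mul_zero, mul_zero]
  · rw [hρ.S_apply, Pi.smul_apply, Finset.sum_apply]
    simp only [Pi.smul_apply, smul_eq_mul, hb, mul_ite, mul_one, mul_zero, Finset.sum_ite_eq,
      Finset.sum_ite_eq', Finset.mem_univ, if_true]
    rw [quadModule_b, b_comm]
    rfl

theorem weilRep_eq {ρ : Representation ℂ Mp2Z (Λ.Disc → ℂ)} (h : Λ.IsWeilRep ρ) :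
    Λ.weilRep = ρ := by
  have hex : ∃ ρ, Λ.IsWeilRep ρ := ⟨ρ, h⟩
  rw [weilRep, dif_pos hex]
  exact IsWeilRep.unique Λ hex.choose_spec h

theorem isWeil_weilRep : Λ.quadModule.IsWeil Λ.fourierConst Λ.weilRep := by
  obtain ⟨ρ, M, hρ, -⟩ := Λ.exists_isWeil
  rw [Λ.weilRep_eq (isWeilRep_of_isWeil hρ)]
  exact hρ

/-! ### The level -/

section level

variable {Λ}

theorem nsmul_q_eq_zero_iff (N : ℕ) : (∀ γ : Λ.Disc, N • Λ.q γ = 0) ↔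
    ∀ x ∈ Λ.dual, ∃ m : ℤ, (N : ℚ) * (Λ.formQ x x / 2) = m := by
  have key : ∀ x : Λ.dual, N • Λ.q (Submodule.Quotient.mk x) = 0 ↔
      ∃ m : ℤ, (N : ℚ) * (Λ.formQ x x / 2) = m := fun x => by
    rw [← coe_eq_zero_iff_exists_int, q_mk, ← AddCircle.coe_nsmul, nsmul_eq_mul]
    push_cast
    rfl
  constructor
  · intro h x hx
    exact (key ⟨x, hx⟩).mp (h _)
  · intro h γ
    obtain ⟨x, rfl⟩ := Submodule.Quotient.mk_surjective _ γ
    exact (key x).mpr (h x x.2)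

theorem IsElementary.two_mul_nsmul_q {m : ℕ} (hm : ∀ γ : Λ.Disc, m • γ = 0) (γ : Λ.Disc) :
    (2 * m) • Λ.q γ = 0 := by
  rw [mul_comm, mul_nsmul', ← quadModule_q, ← QuadModule.b_self, ← map_nsmul, hm, map_zero]

theorem level_spec (hΛ : Λ.IsElementary) :
    0 < Λ.level ∧ ∀ γ : Λ.Disc, Λ.level • Λ.q γ = 0 := by
  obtain ⟨m, hm, hm'⟩ := hΛ
  have hne : {N : ℕ | 0 < N ∧ ∀ x ∈ Λ.dual, ∃ m : ℤ,
      (N : ℚ) * (Λ.formQ x x / 2) = m}.Nonempty :=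
    ⟨2 * m, Nat.mul_pos two_pos (Nat.pos_of_ne_zero hm.ne_zero),
      (nsmul_q_eq_zero_iff _).mp (IsElementary.two_mul_nsmul_q hm')⟩
  have := Nat.sInf_mem hne
  exact ⟨this.1, (nsmul_q_eq_zero_iff _).mpr this.2⟩

theorem level_dvd (hΛ : Λ.IsElementary) {k : ℕ} (hk : ∀ γ : Λ.Disc, k • Λ.q γ = 0) :
    Λ.level ∣ k := by
  obtain ⟨hpos, hspec⟩ := level_spec hΛ
  by_contra h
  have h0 : 0 < k % Λ.level := Nat.pos_of_ne_zero fun h' => h (Nat.dvd_of_mod_eq_zero h')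
  have h1 : ∀ γ : Λ.Disc, (k % Λ.level) • Λ.q γ = 0 := fun γ => by
    have := hk γ
    rw [← Nat.mod_add_div k Λ.level, add_nsmul, mul_comm, mul_nsmul', hspec, smul_zero,
      add_zero] at this
    exact this
  exact absurd (Nat.sInf_le (s := {N : ℕ | 0 < N ∧ ∀ x ∈ Λ.dual, ∃ m : ℤ,
      (N : ℚ) * (Λ.formQ x x / 2) = m}) ⟨h0, (nsmul_q_eq_zero_iff _).mp h1⟩)
    (not_le.mpr (Nat.mod_lt k hpos))

/-- The level divides `2m` with `m` squarefree. -/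
theorem not_eight_dvd_level (hΛ : Λ.IsElementary) : ¬8 ∣ Λ.level := by
  intro h
  obtain ⟨m, hm, hm'⟩ := id hΛ
  have h1 := h.trans (level_dvd hΛ (IsElementary.two_mul_nsmul_q hm'))
  have h2 : 2 * 2 ∣ m := by omega
  have := hm 2 h2
  exact absurd (Nat.isUnit_iff.mp this) (by norm_num)

/-- By polarisation the level annihilates `b`, hence `A`; it is therefore a multiple of the order of
an element of order `p`. -/
theorem dvd_level_of_prime_dvd_card (hΛ : Λ.IsElementary) {p : ℕ} (hp : p.Prime)
    (hdvd : p ∣ Nat.card Λ.Disc) : p ∣ Λ.level := by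
  have : Fact p.Prime := ⟨hp⟩
  obtain ⟨x, hx⟩ := exists_prime_addOrderOf_dvd_card' p hdvd
  rw [← hx]
  refine addOrderOf_dvd_of_nsmul_eq_zero (Λ.quadModule.nondeg _ fun y => ?_)
  have h := Λ.quadModule.q_add x y
  have h2 := congrArg (Λ.level • ·) h
  simp only [nsmul_add, quadModule_q, (level_spec hΛ).2, zero_add] at h2
  rw [map_nsmul, AddMonoidHom.nsmul_apply, ← h2]

end level

end EvenLattice
end

/-! ### Passage from a deep subgroup `Γ̃₀(M)` to `Γ̃₀(N)`. -/

noncomputable section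

open scoped NumberTheorySymbols
open ZMod (χ₄ χ₈)

namespace EvenLattice

variable {L : Type*} [AddCommGroup L] [Module.Free ℤ L] [Module.Finite ℤ L] (Λ : EvenLattice L)

/-- The coefficient at `0` is an eigenvector of `g` with eigenvalue `c`. -/
def RowScalar (g : Mp2Z) (c : ℂ) : Prop := ∀ w, Λ.weilRep g w 0 = c * w 0

namespace RowScalar

variable {Λ} {g h : Mp2Z} {c c' : ℂ}

theorem unique (h : Λ.RowScalar g c) (h' : Λ.RowScalar g c') : c = c' := by
  have h1 := h (fun _ => 1)
  rw [h' (fun _ => 1)] at h1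
  simpa using h1.symm

theorem mul (hg : Λ.RowScalar g c) (hh : Λ.RowScalar h c') : Λ.RowScalar (g * h) (c * c') :=
  fun w => by rw [map_mul, Module.End.mul_apply, hg, hh, mul_assoc]

theorem inv (hg : Λ.RowScalar g 1) : Λ.RowScalar g⁻¹ 1 := fun w => by
  have h := hg (Λ.weilRep g⁻¹ w)
  rw [← Module.End.mul_apply, ← map_mul, mul_inv_cancel, map_one, Module.End.one_apply] at h
  rw [h, one_mul, one_mul]

theorem T_zpow (n : ℤ) : Λ.RowScalar (Mp2Z.T ^ n) 1 := by
  have hnat : ∀ k : ℕ, Λ.RowScalar (Mp2Z.T ^ k) 1 := fun k w => by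
    rw [Λ.isWeil_weilRep.T_pow_apply, QuadModule.q_zero, smul_zero, e_zero]
  obtain ⟨k, rfl | rfl⟩ := n.eq_nat_or_neg
  · rw [zpow_natCast]; exact hnat k
  · rw [zpow_neg, zpow_natCast]; exact (hnat k).inv

/-- By definition of the level `T^N` acts trivially, and `U (N m)` is conjugate to a power of it. -/
theorem U_level (hΛ : Λ.IsElementary) (m : ℤ) : Λ.RowScalar (Mp2Z.U (Λ.level * m)) 1 := by
  have hT : Mp2Z.T ^ Λ.level ∈ Λ.weilRep.ker := by
    rw [MonoidHom.mem_ker]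
    refine LinearMap.ext fun w => funext fun x => ?_
    rw [Λ.isWeil_weilRep.T_pow_apply, quadModule_q, (level_spec hΛ).2, e_zero, one_mul,
      Module.End.one_apply]
  have hU : Mp2Z.U (Λ.level * m) ∈ Λ.weilRep.ker := by
    rw [Mp2Z.U, zpow_mul, zpow_natCast]
    exact (inferInstance : Λ.weilRep.ker.Normal).conj_mem _ (zpow_mem hT m) _
  intro w
  rw [MonoidHom.mem_ker.mp hU, Module.End.one_apply, one_mul]

theorem mul_T_mul_U_iff (hΛ : Λ.IsElementary) (n m : ℤ) :
    Λ.RowScalar (g * Mp2Z.T ^ n * Mp2Z.U (Λ.level * m)) c ↔ Λ.RowScalar g c := by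
  have h1 : Λ.RowScalar (Mp2Z.T ^ n * Mp2Z.U (Λ.level * m)) 1 := by
    simpa using (T_zpow n).mul (U_level hΛ m)
  rw [mul_assoc]
  constructor
  · intro h
    have h2 := h.mul h1.inv
    rwa [mul_inv_cancel_right, mul_one] at h2
  · intro h
    simpa using h.mul h1

end RowScalar

/-- The exponent of `2` in the order of the discriminant group. -/
def twoExp : ℕ := (Nat.card Λ.Disc).factorization 2

/-- The odd part of the order of the discriminant group. -/
def oddPart : ℕ := Nat.card Λ.Disc / 2 ^ Λ.twoExp

theorem card_eq : Nat.card Λ.Disc = 2 ^ Λ.twoExp * Λ.oddPart :=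
  (Nat.ordProj_mul_ordCompl_eq_self _ 2).symm

theorem odd_oddPart : Odd Λ.oddPart := by
  rw [← Nat.not_even_iff_odd, even_iff_two_dvd]
  exact Nat.not_dvd_ordCompl Nat.prime_two Nat.card_pos.ne'

theorem kroneckerSymbol_card (d : ℤ) :
    kroneckerSymbol d (Nat.card Λ.Disc) = χ₈ d ^ Λ.twoExp * J(d | Λ.oddPart) := by
  have h0 : (Nat.card Λ.Disc : ℤ) ≠ 0 := by exact_mod_cast Nat.card_pos.ne'
  have h1 : ¬((Nat.card Λ.Disc : ℤ) < 0 ∧ d < 0) := fun h => absurd h.1 (by simp)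
  rw [kroneckerSymbol, if_neg h0, if_neg h1, one_mul, Int.natAbs_natCast]
  rfl

theorem kroneckerSymbol_two (d : ℤ) : kroneckerSymbol d 2 = χ₈ d := by
  have h : Nat.factorization 2 2 = 1 := by
    rw [Nat.Prime.factorization_self Nat.prime_two]
  simp [kroneckerSymbol, h]

theorem kroneckerSymbol_neg_one_card :
    kroneckerSymbol (-1) (Nat.card Λ.Disc) = if Λ.oddPart % 4 = 3 then -1 else 1 := by
  have h8 : χ₈ ((-1 : ℤ) : ZMod 8) = 1 := by decide
  rw [kroneckerSymbol_card, h8, one_pow, one_mul, jacobiSym.at_neg_one Λ.odd_oddPart]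
  have h4 : Λ.oddPart % 4 = 1 ∨ Λ.oddPart % 4 = 3 := by
    obtain ⟨k, hk⟩ := Λ.odd_oddPart
    omega
  rcases h4 with h | h
  · rw [if_neg (by omega), ZMod.χ₄_nat_one_mod_four h]
  · rw [if_pos h, ZMod.χ₄_nat_three_mod_four h]

/-- The exponent of the theta character in `χ_A`. -/
def thetaExp : ℤ := Λ.sgn + kroneckerSymbol (-1) (Nat.card Λ.Disc) - 1

/-- Reciprocity turns `(|A| / |d|)` into a symbol with `d` on top. The extra factor `χ₄(d)`, present
when the odd part of `|A|` is `3` modulo `4`, is `χ_ϑ² = χ_ϑ⁻²` and accounts for the correction in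
the exponent of `χ_ϑ`. -/
theorem char_eq {g : Mp2Z} (hd : Odd (g.mat 1 1)) :
    (chiTheta g * (χ₈ (g.mat 1 1) : ℤ)) ^ Λ.sgn * (J(Nat.card Λ.Disc | (g.mat 1 1).natAbs) : ℂ) =
      chiTheta g ^ Λ.thetaExp * ((χ₈ (g.mat 1 1) : ℤ) : ℂ) ^ (Λ.sgn + Λ.twoExp) *
        (J(g.mat 1 1 | Λ.oddPart) : ℂ) := by
  have hχ : ((χ₈ (g.mat 1 1) : ℤ) : ℂ) ≠ 0 := by
    intro h
    have h2 := chi₈_sq_of_odd hd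
    have h3 : χ₈ (g.mat 1 1) = 0 := by exact_mod_cast h
    rw [h3] at h2
    norm_num at h2
  have hθ : chiTheta g ≠ 0 := fun h0 => by
    have := g.chiTheta_pow_four hd
    rw [h0] at this
    norm_num at this
  have h1 : J(Nat.card Λ.Disc | (g.mat 1 1).natAbs) =
      χ₈ (g.mat 1 1) ^ Λ.twoExp * (if Λ.oddPart % 4 = 3 then χ₄ (g.mat 1 1) else 1) *
        J(g.mat 1 1 | Λ.oddPart) := by
    have h2 := kroneckerSymbol_reciprocity (Or.inl rfl) Λ.twoExp Λ.odd_oddPart hd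
    rw [one_mul, if_neg (by norm_num), mul_one, kroneckerSymbol_of_odd _ hd,
      if_neg (fun h => absurd h.2 (not_lt.mpr (by positivity))), one_mul] at h2
    rw [← h2, Λ.card_eq]
    push_cast
    rfl
  have h2 : chiTheta g ^ Λ.thetaExp =
      chiTheta g ^ Λ.sgn * ((if Λ.oddPart % 4 = 3 then χ₄ (g.mat 1 1) else 1 : ℤ) : ℂ) := by
    rw [thetaExp, kroneckerSymbol_neg_one_card, add_sub_assoc, zpow_add₀ hθ]
    congr 1
    split_ifs
    · have h4 := g.chiTheta_pow_four hd
      rw [← g.chiTheta_sq hd, show (-1 - 1 : ℤ) = -(2 : ℕ) by norm_num, zpow_neg, zpow_natCast]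
      refine inv_eq_of_mul_eq_one_left ?_
      rw [← pow_add]
      exact h4
    · simp
  rw [h1, h2, mul_zpow, zpow_add₀ hχ, zpow_natCast]
  push_cast
  ring

theorem exists_rowScalar : ∃ M : ℕ, 0 < M ∧ 4 ∣ M ∧ Nat.card Λ.Disc ∣ M ∧
    ∀ g ∈ Mp2Z.Gamma0 M, Odd (g.mat 1 1) ∧ Λ.RowScalar g
      (chiTheta g ^ Λ.thetaExp * ((χ₈ (g.mat 1 1) : ℤ) : ℂ) ^ (Λ.sgn + Λ.twoExp) *
        (J(g.mat 1 1 | Λ.oddPart) : ℂ)) := by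
  obtain ⟨ρ, M, hρ, hM, h4, hcard, hrow⟩ := Λ.exists_isWeil
  refine ⟨M, hM, h4, hcard, fun g hg => ?_⟩
  have hd : Odd (g.mat 1 1) := g.odd_of_dvd (dvd_trans (by
    have : ((2 : ℕ) : ℤ) ∣ M := Int.natCast_dvd_natCast.mpr (dvd_trans (by norm_num) h4)
    exact this) (Mp2Z.mem_Gamma0_iff.mp hg))
  refine ⟨hd, fun w => ?_⟩
  rw [Λ.weilRep_eq (isWeilRep_of_isWeil hρ), hrow g hg w, Λ.char_eq hd]

section elementary

variable {Λ}

/-- For suitable lower right entries `1 + n k N` there are elements of `Γ̃₀(M)` acting trivially on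
the coefficient at `0`. -/
theorem exists_rowScalar_one (hΛ : Λ.IsElementary) {M : ℕ} {n k : ℤ}
    (hcop : IsCoprime (1 + n * (Λ.level * k)) (M : ℤ)) :
    ∃ g ∈ Mp2Z.Gamma0 M, g.mat 1 1 = 1 + n * (Λ.level * k) ∧ Λ.RowScalar g 1 ∧
      (4 ∣ Λ.level * k → Odd (g.mat 1 1) → chiTheta g = 1) := by
  obtain ⟨m, hm⟩ := exists_dvd_sub_mul hcop k
  -- The element is `U(-Nk) Tⁿ U(Nm)`: the first factor has lower row `(Nk, 1)`, the second produces
  -- the desired `d`, and the third makes `c` divisible by `M`. Each acts trivially on the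
  -- coefficient at `0`.
  set g₁ := (1 : Mp2Z) * Mp2Z.U (Λ.level * (-k)) with hg₁
  have h10 : g₁.mat 1 0 = Λ.level * k := by
    rw [hg₁, (Mp2Z.mul_U_mat 1 _).1]; simp
  have h11 : g₁.mat 1 1 = 1 := by
    rw [hg₁, (Mp2Z.mul_U_mat 1 _).2]; simp
  set g₂ := g₁ * Mp2Z.T ^ n with hg₂
  have h20 : g₂.mat 1 0 = Λ.level * k := by rw [hg₂, (Mp2Z.mul_T_zpow_mat g₁ n).1, h10]
  have h21 : g₂.mat 1 1 = 1 + n * (Λ.level * k) := by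
    rw [hg₂, (Mp2Z.mul_T_zpow_mat g₁ n).2, h10, h11]
  have h31 : (g₂ * Mp2Z.U (Λ.level * m)).mat 1 1 = 1 + n * (Λ.level * k) := by
    rw [(Mp2Z.mul_U_mat g₂ _).2, h21]
  refine ⟨g₂ * Mp2Z.U (Λ.level * m), ?_, h31, ?_, fun h4 hodd => ?_⟩
  · rw [Mp2Z.mem_Gamma0_iff, (Mp2Z.mul_U_mat g₂ _).1, h20, h21]
    have : (Λ.level : ℤ) * k - Λ.level * m * (1 + n * (Λ.level * k)) =
        Λ.level * (k - m * (1 + n * (Λ.level * k))) := by ring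
    rw [this]
    exact hm.mul_left _
  · rw [RowScalar.mul_T_mul_U_iff hΛ, hg₁, one_mul]
    exact RowScalar.U_level hΛ _
  · rw [h31] at hodd
    rw [Mp2Z.chiTheta_mul_U _ (by rwa [h21]), hg₂, Mp2Z.chiTheta_mul_T_zpow _ (by rwa [h10]), hg₁,
      Mp2Z.chiTheta_mul_U _ (by simp)]
    have hs : (1 : Mp2Z).sign = 1 := by
      rw [Mp2Z.sign, if_pos]
      intro τ
      simp
    simp [chiTheta, hs, kroneckerSymbol_of_odd 0 odd_one]

theorem exists_odd_level_mul (hΛ : Λ.IsElementary) {j : ℕ} (hj : ¬2 ^ (j + 1) ∣ Λ.level) :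
    ∃ k o : ℤ, Odd o ∧ Λ.level * k = 2 ^ j * o := by
  have hpos := (level_spec hΛ).1
  set v := Λ.level.factorization 2
  have hv : v ≤ j := by
    by_contra h
    exact hj ((pow_dvd_pow 2 (by omega)).trans (Nat.ordProj_dvd _ 2))
  refine ⟨2 ^ (j - v), ((Λ.level / 2 ^ v : ℕ) : ℤ), ?_, ?_⟩
  · rw [Int.odd_coe_nat, ← Nat.not_even_iff_odd, even_iff_two_dvd]
    exact Nat.not_dvd_ordCompl Nat.prime_two hpos.ne'
  · have h1 : Λ.level = 2 ^ v * (Λ.level / 2 ^ v) :=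
      (Nat.ordProj_mul_ordCompl_eq_self _ 2).symm
    have h2 : (2 : ℤ) ^ j = 2 ^ v * 2 ^ (j - v) := by rw [← pow_add]; congr 1; omega
    conv_lhs => rw [h1]
    rw [h2]
    push_cast
    ring

/-- For `j = 1, 2` with `2 ^ (j + 1) ∤ N` there is an element of `Γ̃₀(M)` with trivial action and
`d ≡ 1 + 2 ^ j mod 2 ^ (j + 1)`. -/
theorem exists_char_eq_one (hΛ : Λ.IsElementary) {j : ℕ} (hj0 : 1 ≤ j)
    (hj : ¬2 ^ (j + 1) ∣ Λ.level) :
    ∃ g : Mp2Z, ∃ o : ℤ, Odd o ∧ g.mat 1 1 = 1 + 2 ^ j * o ∧ Odd (g.mat 1 1) ∧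
      chiTheta g ^ Λ.thetaExp * ((χ₈ (g.mat 1 1) : ℤ) : ℂ) ^ (Λ.sgn + Λ.twoExp) = 1 ∧
      (2 ≤ j → chiTheta g = 1) := by
  obtain ⟨M, hM, h4, hcard, hrow⟩ := Λ.exists_rowScalar
  obtain ⟨k, o, ho, hk⟩ := exists_odd_level_mul hΛ hj
  -- With the odd part of `M` in the role of `n`, the entry `d` is `1` modulo `O`. This makes `d`
  -- prime to `M` and trivialises the Jacobi symbol, leaving only the conditions at `2`.
  set O := M / 2 ^ M.factorization 2
  have hMO : M = 2 ^ M.factorization 2 * O := (Nat.ordProj_mul_ordCompl_eq_self _ 2).symm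
  have hO : Odd O := by
    rw [← Nat.not_even_iff_odd, even_iff_two_dvd]
    exact Nat.not_dvd_ordCompl Nat.prime_two hM.ne'
  have hd : 1 + (O : ℤ) * (Λ.level * k) = 1 + 2 ^ j * (O * o) := by rw [hk]; ring
  have hodd : Odd (1 + (O : ℤ) * (Λ.level * k)) := by
    rw [hd]
    refine Odd.add_even odd_one ?_
    exact (Even.pow_of_ne_zero even_two (by omega)).mul_right _
  have hcop : IsCoprime (1 + (O : ℤ) * (Λ.level * k)) (M : ℤ) := by
    rw [hMO]
    push_cast
    refine IsCoprime.mul_right (IsCoprime.pow_right (Int.isCoprime_two_right.mpr hodd)) ?_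
    exact ⟨1, -(Λ.level * k), by ring⟩
  obtain ⟨g, hg, hgd, hg1, hgθ⟩ := exists_rowScalar_one hΛ hcop
  obtain ⟨-, hg2⟩ := hrow g hg
  have hDO : Λ.oddPart ∣ O := by
    have h1 : Λ.oddPart ∣ 2 ^ M.factorization 2 * O := by
      rw [← hMO]
      exact (Dvd.intro_left _ Λ.card_eq.symm).trans hcard
    exact (Nat.Coprime.pow_right _ (Nat.coprime_two_right.mpr Λ.odd_oddPart)).dvd_of_dvd_mul_left h1
  have hJ : J(g.mat 1 1 | Λ.oddPart) = 1 := by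
    rw [hgd, jacobiSym.mod_left, Int.add_emod, Int.emod_eq_zero_of_dvd
      ((Int.natCast_dvd_natCast.mpr hDO).mul_right _), add_zero, Int.emod_emod,
      ← jacobiSym.mod_left, jacobiSym.one_left]
  refine ⟨g, O * o, (Int.odd_coe_nat O |>.mpr hO).mul ho, hgd.trans hd, hgd ▸ hodd, ?_, fun h2 => ?_⟩
  · have := hg2.unique hg1
    rwa [hJ, Int.cast_one, mul_one] at this
  · refine hgθ ?_ (hgd ▸ hodd)
    rw [hk]
    exact ((pow_dvd_pow 2 h2).trans (dvd_mul_right _ _))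

/-- As `8 ∤ N`, some element with `d ≡ 5` modulo `8` and `χ_ϑ = 1` acts trivially on the coefficient
at `0`. The explicit eigenvalue is then a power of `χ₈(d) = -1`, so the exponent is even. -/
theorem even_sgn_add_twoExp (hΛ : Λ.IsElementary) : Even (Λ.sgn + Λ.twoExp) := by
  obtain ⟨g, o, ho, hgd, hodd, h1, hθ⟩ := exists_char_eq_one hΛ (j := 2) (by norm_num)
    (not_eight_dvd_level hΛ)
  have h8 : χ₈ (g.mat 1 1) = -1 := by
    rw [ZMod.χ₈_int_eq_if_mod_eight]
    obtain ⟨r, hr⟩ := ho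
    rw [hgd]
    rw [if_neg (by omega), if_neg (by omega)]
  rw [hθ le_rfl, one_zpow, one_mul, h8] at h1
  by_contra h
  rw [Int.not_even_iff_odd] at h
  rw [Int.cast_neg, Int.cast_one, h.neg_one_zpow] at h1
  norm_num at h1

theorem zpow_sgn_add_twoExp (hΛ : Λ.IsElementary) {d : ℤ} (hd : Odd d) :
    ((χ₈ d : ℤ) : ℂ) ^ (Λ.sgn + Λ.twoExp) = 1 := by
  obtain ⟨r, hr⟩ := even_sgn_add_twoExp hΛ
  have h2 : ((χ₈ d : ℤ) : ℂ) ^ 2 = 1 := by exact_mod_cast chi₈_sq_of_odd hd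
  rw [hr, ← two_mul, zpow_mul, zpow_ofNat, h2, one_zpow]

/-- If `4 ∤ N`, there is an element acting trivially with `d ≡ 3` modulo `4`. There `χ_ϑ² = -1`, so
`χ_ϑ` has order exactly four, and its power with exponent `thetaExp` is `1`. -/
theorem four_dvd_thetaExp (hΛ : Λ.IsElementary) (h4 : ¬4 ∣ Λ.level) : 4 ∣ Λ.thetaExp := by
  obtain ⟨g, o, ho, hgd, hodd, h1, -⟩ := exists_char_eq_one hΛ (j := 1) le_rfl h4
  rw [zpow_sgn_add_twoExp hΛ hodd, mul_one] at h1
  have hsq : chiTheta g ^ 2 = -1 := by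
    rw [g.chiTheta_sq hodd, ZMod.χ₄_int_three_mod_four (by
      obtain ⟨r, hr⟩ := ho
      rw [hgd]; omega)]
    norm_num
  have h0 : chiTheta g ≠ 0 := fun h => by rw [h] at hsq; norm_num at hsq
  have h4 : chiTheta g ^ 4 = 1 := g.chiTheta_pow_four hodd
  have hr : chiTheta g ^ (Λ.thetaExp % 4) = 1 := by
    rw [← Int.mul_ediv_add_emod Λ.thetaExp 4, zpow_add₀ h0, zpow_mul, zpow_ofNat, h4, one_zpow,
      one_mul] at h1
    exact h1
  have hcases : Λ.thetaExp % 4 = 0 ∨ Λ.thetaExp % 4 = 1 ∨ Λ.thetaExp % 4 = 2 ∨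
      Λ.thetaExp % 4 = 3 := by omega
  rcases hcases with h | h | h | h
  · exact Int.dvd_of_emod_eq_zero h
  · rw [h, zpow_one] at hr
    rw [hr] at hsq; norm_num at hsq
  · rw [h, zpow_ofNat, hsq] at hr
    norm_num at hr
  · rw [h, zpow_ofNat, pow_succ, hsq] at hr
    have : chiTheta g = -1 := by linear_combination -hr
    rw [this] at hsq; norm_num at hsq

/-- `Γ̃₀(N)` acts on the coefficient at `0` by `χ_A`. -/
theorem rowScalar_chi (hΛ : Λ.IsElementary) {h : Mp2Z} (hh : h ∈ Mp2Z.Gamma0 Λ.level) :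
    Λ.RowScalar h (Λ.chi h) := by
  obtain ⟨M, hM, h4M, hcard, hrow⟩ := Λ.exists_rowScalar
  rw [Mp2Z.mem_Gamma0_iff] at hh
  -- A power `Tⁿ` makes `d` prime to `M`; then `U(Nm)` can move `c` into `Mℤ`. The eigenvalue of `h`
  -- is thus that of an element of `Γ̃₀(M)`.
  obtain ⟨n, hn⟩ := exists_isCoprime_add_mul h.gcd_eq_one hM.ne'
  obtain ⟨c₀, hc₀⟩ := hh
  obtain ⟨m, hm⟩ := exists_dvd_sub_mul hn c₀
  set g₁ := h * Mp2Z.T ^ n with hg₁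
  have h10 : g₁.mat 1 0 = h.mat 1 0 := (Mp2Z.mul_T_zpow_mat h n).1
  have h11 : g₁.mat 1 1 = h.mat 1 1 + n * h.mat 1 0 := (Mp2Z.mul_T_zpow_mat h n).2
  set g := g₁ * Mp2Z.U (Λ.level * m) with hg
  have hg11 : g.mat 1 1 = h.mat 1 1 + n * h.mat 1 0 := by
    rw [hg, (Mp2Z.mul_U_mat g₁ _).2, h11]
  have hgM : g ∈ Mp2Z.Gamma0 M := by
    rw [Mp2Z.mem_Gamma0_iff, hg, (Mp2Z.mul_U_mat g₁ _).1, h10, h11]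
    have : h.mat 1 0 - Λ.level * m * (h.mat 1 1 + n * h.mat 1 0) =
        Λ.level * (c₀ - m * (h.mat 1 1 + n * h.mat 1 0)) := by
      linear_combination hc₀
    rw [this]
    exact hm.mul_left _
  obtain ⟨hodd, hgrow⟩ := hrow g hgM
  rw [zpow_sgn_add_twoExp hΛ hodd, mul_one, hg, hg₁, RowScalar.mul_T_mul_U_iff hΛ, ← hg₁, ← hg]
    at hgrow
  have hJ : J(g.mat 1 1 | Λ.oddPart) = J(h.mat 1 1 | Λ.oddPart) := by
    rw [hg11]
    refine jacobiSym_add_of_forall_prime_dvd fun p hp hpD => ?_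
    have h1 := dvd_level_of_prime_dvd_card hΛ hp (hpD.trans (Dvd.intro_left _ Λ.card_eq.symm))
    refine Dvd.dvd.mul_left ?_ n
    rw [hc₀]
    exact (Int.natCast_dvd_natCast.mpr h1).mul_right _
  rw [hJ] at hgrow
  convert hgrow using 1
  have hcardχ : chiNat (Nat.card Λ.Disc) h =
      ((χ₈ (h.mat 1 1) ^ Λ.twoExp * J(h.mat 1 1 | Λ.oddPart) : ℤ) : ℂ) := by
    rw [chiNat, kroneckerSymbol_card]
  rw [chi, hcardχ]
  split_ifs with h4
  · have hc4 : 4 ∣ h.mat 1 0 := by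
      rw [hc₀]
      exact (Int.natCast_dvd_natCast.mpr h4).mul_right _
    have hd : Odd (h.mat 1 1) := h.odd_of_dvd (dvd_trans (by norm_num) hc4)
    have hθ : chiTheta g = chiTheta h := by
      rw [hg, Mp2Z.chiTheta_mul_U _ (by rw [h11, ← hg11]; exact hodd), hg₁,
        Mp2Z.chiTheta_mul_T_zpow _ hc4]
    have h8 := zpow_sgn_add_twoExp hΛ hd
    have hχ : ((χ₈ (h.mat 1 1) : ℤ) : ℂ) ≠ 0 := by
      intro h0
      have h2 := chi₈_sq_of_odd hd
      have h3 : χ₈ (h.mat 1 1) = 0 := by exact_mod_cast h0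
      rw [h3] at h2
      norm_num at h2
    rw [zpow_add₀ hχ, zpow_natCast] at h8
    have h2χ : chiNat 2 h = ((χ₈ (h.mat 1 1) : ℤ) : ℂ) := by
      rw [chiNat, Nat.cast_ofNat, kroneckerSymbol_two]
    change chiTheta h ^ Λ.thetaExp * _ = _
    rw [hθ, h2χ]
    push_cast
    linear_combination (chiTheta h ^ Λ.thetaExp * (J(h.mat 1 1 | Λ.oddPart) : ℂ)) * h8
  -- Here the theta character disappears because it has order dividing four. The entry `d` of `h`
  -- itself may be even, but only when `N` is odd, and then `|A|` is odd and `twoExp` is zero.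
  · obtain ⟨r, hr⟩ := four_dvd_thetaExp hΛ h4
    have hθ : chiTheta g ^ Λ.thetaExp = 1 := by
      rw [hr, zpow_mul, zpow_ofNat, g.chiTheta_pow_four hodd, one_zpow]
    have heven : Even Λ.twoExp := by
      have h1 := even_sgn_add_twoExp hΛ
      rw [thetaExp, kroneckerSymbol_neg_one_card] at hr
      rw [← Int.even_coe_nat]
      obtain ⟨a, ha⟩ := h1
      split_ifs at hr
      · exact ⟨a - 2 * r - 1, by omega⟩
      · exact ⟨a - 2 * r, by omega⟩
    have h8 : χ₈ (h.mat 1 1) ^ Λ.twoExp = 1 := by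
      by_cases h0 : Λ.twoExp = 0
      · rw [h0, pow_zero]
      · have h2 : 2 ∣ Nat.card Λ.Disc := by
          rw [Λ.card_eq]
          exact (dvd_pow_self 2 h0).mul_right _
        have hd : Odd (h.mat 1 1) := h.odd_of_dvd (by
          rw [hc₀]
          exact (Int.natCast_dvd_natCast.mpr
            (dvd_level_of_prime_dvd_card hΛ Nat.prime_two h2)).mul_right _)
        obtain ⟨a, ha⟩ := heven
        rw [ha, ← two_mul, pow_mul, chi₈_sq_of_odd hd, one_pow]
    rw [hθ, h8, one_mul, one_mul]

end elementary

end EvenLattice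
end

noncomputable section

/-! ### Poles at the cusps -/

theorem PoleAtMost.mono {n m : ℕ} (h : n ≤ m) {f : ℍ → ℂ} (hf : PoleAtMost n f) :
    PoleAtMost m f := by
  obtain ⟨k, rfl⟩ := Nat.exists_eq_add_of_le h
  have hb : UpperHalfPlane.IsBoundedAtImInfty
      fun τ : ℍ => Complex.exp (2 * Real.pi * Complex.I * (τ : ℂ)) ^ k := by
    rw [UpperHalfPlane.isBoundedAtImInfty_iff]
    refine ⟨1, 0, fun τ _ => ?_⟩
    rw [norm_pow]
    refine pow_le_one₀ (norm_nonneg _) ?_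
    exact (UpperHalfPlane.norm_exp_two_pi_I_lt_one τ).le
  have := Filter.BoundedAtFilter.mul hb hf
  refine Asymptotics.IsBigO.congr_left this fun τ => ?_
  simp only [Pi.mul_apply]
  ring

theorem PoleAtMost.sum {ι : Type*} [Fintype ι] {n : ℕ} {f : ι → ℍ → ℂ}
    (hf : ∀ i, PoleAtMost n (f i)) (c : ι → ℂ) : PoleAtMost n fun τ => ∑ i, c i * f i τ := by
  have h := Asymptotics.IsBigO.fun_sum (s := Finset.univ) fun i _ =>
    (hf i : Asymptotics.IsBigO _ _ _).const_mul_left (c i)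
  refine h.congr_left fun τ => ?_
  rw [Finset.mul_sum]
  exact Finset.sum_congr rfl fun i _ => by ring

namespace EvenLattice

variable {L : Type*} [AddCommGroup L] [Module.Free ℤ L] [Module.Finite ℤ L] {Λ : EvenLattice L}

/-- The automorphy factors cancel, so slashing `⟨u, F⟩` amounts to applying `ρ(g)` to `F(τ)`;
statements about `f` become pointwise linear algebra. -/
theorem slashHalf_dotProduct {κ : ℤ} {F : ℍ → Λ.Disc → ℂ} (hF : Λ.IsVectorForm κ F)
    (u : Λ.Disc → ℂ) (g : Mp2Z) (τ : ℍ) :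
    slashHalf κ (fun τ => u ⬝ᵥ F τ) g τ = u ⬝ᵥ Λ.weilRep g (F τ) := by
  rw [slashHalf, hF.transform, dotProduct_smul, smul_eq_mul, ← mul_assoc,
    ← zpow_add₀ (g.root_ne_zero τ), neg_add_cancel, zpow_zero, one_mul]

/-- The expansion of `f` at any cusp is a fixed linear combination of the components of `F`, so its
poles are bounded by those of `F` at `i∞`. -/
theorem exists_slashHalf_eq_sum {κ : ℤ} {F : ℍ → Λ.Disc → ℂ} (hF : Λ.IsVectorForm κ F)
    (u : Λ.Disc → ℂ) (g : Mp2Z) : ∃ v : Λ.Disc → ℂ,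
      slashHalf κ (fun τ => u ⬝ᵥ F τ) g = fun τ => ∑ γ, v γ * F τ γ := by
  classical
  refine ⟨fun γ => u ⬝ᵥ Λ.weilRep g (Pi.single γ 1), funext fun τ => ?_⟩
  rw [slashHalf_dotProduct hF]
  conv_lhs => rw [pi_eq_sum_univ' (F τ), map_sum, dotProduct_sum]
  refine Finset.sum_congr rfl fun γ _ => ?_
  rw [map_smul, dotProduct_smul, smul_eq_mul, mul_comm]

end EvenLattice

end

/-! ### The main theorem. -/

theorem mainTheorem5 {L : Type*} [AddCommGroup L] [Module.Free ℤ L] [Module.Finite ℤ L]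
    (Λ : EvenLattice L) (hΛ : Λ.IsElementary) (κ : ℤ) (F : ℍ → Λ.Disc → ℂ)
    (hF : Λ.IsVectorForm κ F)
    (hinv : ∀ σ ∈ Λ.discAut, ∀ (τ : ℍ) (γ : Λ.Disc), F τ (σ γ) = F τ γ) :
    ∃ (c : Λ.Disc → ℂ) (f : ℍ → ℂ),
      (∀ γ, Λ.q γ ≠ 0 → c γ = 0) ∧
      (∀ τ, f τ = ∑ γ, c γ * F τ γ) ∧
      IsScalarForm Λ.level κ Λ.chi f ∧
      ((∀ γ, PoleAtMost 0 fun τ => F τ γ) → ∀ g : Mp2Z, PoleAtMost 0 (slashHalf κ f g)) ∧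
      ∀ τ, F τ = Λ.induced κ f τ := by
  classical
  have : NeZero Λ.level := ⟨(EvenLattice.level_spec hΛ).1.ne'⟩
  have hindex : (Mp2Z.Gamma0 Λ.level).FiniteIndex :=
    ⟨by
      rw [Mp2Z.Gamma0, Subgroup.index_comap]
      exact Subgroup.FiniteIndex.index_ne_zero
        (H := (CongruenceSubgroup.Gamma0 Λ.level).subgroupOf Mp2Z.proj.range)⟩
  have : Finite (Quotient (QuotientGroup.rightRel (Mp2Z.Gamma0 Λ.level))) :=
    Finite.of_equiv _ (QuotientGroup.quotientRightRelEquivQuotientLeftRel _).symm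
  have := Fintype.ofFinite (Quotient (QuotientGroup.rightRel (Mp2Z.Gamma0 Λ.level)))
  obtain ⟨m, hm, hm'⟩ := id hΛ
  -- The vector `u` depends on the lattice alone; it is applied to the invariant vector `F τ` for
  -- each `τ` separately.
  obtain ⟨u, hu, hind⟩ := Λ.isWeil_weilRep.exists_induction (Γ := Mp2Z.Gamma0 Λ.level) (χ := Λ.chi)
    (fun h hh => EvenLattice.rowScalar_chi hΛ hh)
    (fun w hw h0 => Λ.isWeil_weilRep.eq_zero_of_coeff_zero hm hm' hw h0)
  have hFinv : ∀ τ, ∀ σ ∈ Λ.quadModule.aut, ∀ γ, F τ (σ γ) = F τ γ := fun τ σ hσ γ =>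
    hinv σ hσ τ γ
  refine ⟨u, fun τ => u ⬝ᵥ F τ, hu, fun τ => rfl, ⟨?_, fun g hg τ => ?_, fun g => ?_⟩,
    fun h0 g => ?_, fun τ => ?_⟩
  · rw [UpperHalfPlane.mdifferentiable_iff]
    exact DifferentiableOn.fun_sum fun γ _ =>
      (UpperHalfPlane.mdifferentiable_iff.mp (hF.holo γ)).const_mul (u γ)
  · rw [EvenLattice.slashHalf_dotProduct hF]
    exact (hind (F τ) (hFinv τ)).1 g hg
  · obtain ⟨v, hv⟩ := EvenLattice.exists_slashHalf_eq_sum hF u g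
    choose n hn using hF.pole
    refine ⟨Finset.univ.sup n, ?_⟩
    rw [hv]
    exact PoleAtMost.sum (fun γ => (hn γ).mono (Finset.le_sup (Finset.mem_univ γ))) v
  · obtain ⟨v, hv⟩ := EvenLattice.exists_slashHalf_eq_sum hF u g
    rw [hv]
    exact PoleAtMost.sum h0 v
  · rw [EvenLattice.induced, finsum_eq_sum_of_fintype]
    simp only [EvenLattice.slashHalf_dotProduct hF]
    exact (hind (F τ) (hFinv τ)).2
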